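/- Let $n\ge 2$, write $x=(x',x_n)$ with $x'\in\mathbb R^{n-1}$, and let $\mathbf e_1,\dots,\mathbf e_n$ be the coordinate vectors. Let $\Gamma$ be the Gaussian kernel of $\mathbb R^n$ and $N$ the Newtonian kernel of $\mathbb R^n$ with $\Delta N=\delta$. For boundary data $g:\mathbb R^{n-1}\times(0,2)\to\mathbb R^n$, let $w=(w_1,\dots,w_n)$ be the solution of the Stokes system $$w_t-\Delta w+\nabla p=0,\quad \operatorname{div}w=0\ \text{ in } \mathbb R^n_+\times(0,2),\qquad w|_{t=0}=0,\quad w|_{x_n=0}=g,$$ given by the Poisson kernel of the half space, $$w_i(x,t)=\sum_{j=1}^n\int_0^t\!\int_{\mathbb R^{n-1}}\bigl(-2\delta_{ij}D_{x_n}\Gamma+L_{ij}\bigr)(x'-y',x_n,t-s)\,g_j(y',s)\,dy'ds+2\int_{\mathbb R^{n-1}}D_{x_i}N(x'-y',x_n)\,g_n(y',t)\,dy',$$ $$L_{ij}(x,t)=4D_{x_j}\int_0^{x_n}\!\int_{\mathbb R^{n-1}}D_{z_n}\Gamma(z,t)\,D_{x_i}N(x-z)\,dz'dz_n .$$ A point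 $(x',t^*)$ with $t^*>0$ is a *boundary layer separation point* of $w_i$ if (1) for every $0<t<t^*$ there is $\epsilon>0$ with $w_i(x',x_n,t)>0$ for all $0<x_n<\epsilon$, and (2) there are $t_k>t^*$ with $t_k\to t^*$ such that for each $k$ there is $\epsilon>0$ with $w_i(x',x_n,t_k)<0$ for all $0<x_n<\epsilon$. **Theorem.** There is a constant $c_{*3}>1$, depending only on $n$, with the following property. Let $$g(y',s)=a\,\psi(|y'|)\,\phi(s)\,\mathbf e_n,$$ where $a>0$; the function $y'\mapsto\psi(|y'|)$ is in $C_c^\infty$ of the open unit ball of $\mathbb R^{n-1}$, is nonnegative, and is greater than $1$ on the open ball of radius $\tfrac12$ about the origin; $\phi\in C^{1+\frac\alpha2}([0,2])$ for some $0<\alpha<1$, $\phi(0)=0$ (and $\phi$ is extended by $0$ to negative times), $\phi$ is positive and nondecreasing on $(0,1)$ and nonincreasing on $(1,2)$. Put $$M(t)=\int_{-\infty}^t\frac{\phi(t)-\phi(s)}{(t-s)^{3/2}}\,ds,\qquad t_0^*=\sup\{r\in(0,2): M(t)>0\ \text{for all } 0<t<r\},$$ and assume that there are $1<t_0<t_1<2$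 such that $M(t)<0$ for all $t_0<t<t_1$. Then for each $1\le i\le n-1$: (i) For every $x>c_{*3}$ there is exactly one $t_i^*(x\mathbf e_i)>0$ such that $(x\mathbf e_i,t_i^*(x\mathbf e_i))$ is a boundary layer separation point of $w_i$; it lies in $(1,t_0)$; and $t_i^*(x_1\mathbf e_i)<t_i^*(x_2\mathbf e_i)$ whenever $c_{*3}<x_1<x_2$. (ii) $t_i^*(x\mathbf e_i)<t_0^*$ for all $x>c_{*3}$, and $\displaystyle\lim_{x\to\infty}t_i^*(x\mathbf e_i)=t_0^*$. -/

import Mathlib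

open Set Filter Topology MeasureTheory

namespace StokesHalfSpace

noncomputable section

/-- The Euclidean space `ℝᵏ`. -/
abbrev Eu (k : ℕ) : Type := EuclideanSpace ℝ (Fin k)

/-- The point `(x', r)` of `ℝⁿ`, `n = d + 1`, with tangential part `x' ∈ ℝᵈ` and normal
(last) coordinate `r`. -/
def joinPt {d : ℕ} (x' : Eu d) (r : ℝ) : Eu (d + 1) :=
  WithLp.toLp 2 (Fin.snoc (α := fun _ => ℝ) (fun i => x' i) r)

/-- The `i`-th coordinate vector of `ℝᵏ`. -/
def axis {k : ℕ} (i : Fin k) : Eu k := EuclideanSpace.single i 1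

/-- The partial derivative `D_{x_j} f` at `x`. -/
def partialD {k : ℕ} (j : Fin k) (f : Eu k → ℝ) (x : Eu k) : ℝ :=
  lineDeriv ℝ f x (axis j)

/-- The Gaussian kernel `Γ(x, t)` on `ℝᵏ`. -/
def heatKernel {k : ℕ} (x : Eu k) (t : ℝ) : ℝ :=
  if 0 < t then (4 * Real.pi * t) ^ (-(k : ℝ) / 2) * Real.exp (-‖x‖ ^ 2 / (4 * t)) else 0

/-- The volume `ω_k` of the unit ball of `ℝᵏ`. -/
def unitBallVolume (k : ℕ) : ℝ := volume.real (Metric.ball (0 : Eu k) 1)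

/-- The Newtonian kernel `N` on `ℝᵏ`, `k ≥ 2`, normalized by `Δ N = δ`. -/
def newtonKernel {k : ℕ} (x : Eu k) : ℝ :=
  if k = 2 then 1 / (2 * Real.pi) * Real.log ‖x‖
  else -(1 / ((k : ℝ) * ((k : ℝ) - 2) * unitBallVolume k)) * ‖x‖ ^ (2 - (k : ℝ))

/-- The tensor
`L_{ij}(x,t) = 4 D_{x_j} ∫_0^{x_n} ∫_{ℝ^{n-1}} D_{z_n} Γ(z,t) D_{x_i} N(x-z) dz' dz_n`. -/
def tensorL {d : ℕ} (i j : Fin (d + 1)) (x : Eu (d + 1)) (t : ℝ) : ℝ :=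
  4 * partialD j
    (fun y : Eu (d + 1) => ∫ r in (0 : ℝ)..(y (Fin.last d)), ∫ z' : Eu d,
      partialD (Fin.last d) (fun z => heatKernel z t) (joinPt z' r) *
        partialD i newtonKernel (y - joinPt z' r)) x

/-- The part `-2 δ_{ij} D_{x_n} Γ + L_{ij}` of the Poisson kernel
`K_{ij} = -2 δ_{ij} D_{x_n} Γ + L_{ij} + 2 δ_{jn} δ(t) D_{x_i} N`
of the Stokes system in the half space, which is a function for `t > 0`. -/
def poissonRegular {d : ℕ} (i j : Fin (d + 1)) (x : Eu (d + 1)) (t : ℝ) : ℝ :=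
  -2 * (if i = j then 1 else 0) * partialD (Fin.last d) (fun z => heatKernel z t) x
    + tensorL i j x t

/-- The `i`-th component of the solution of the Stokes system in `ℝⁿ₊ × (0,T)` with zero initial
data and boundary data `g`:
`w_i(x,t) = ∑_j ∫_0^t ∫_{ℝ^{n-1}} K_{ij}(x'-y', x_n, t-s) g_j(y',s) dy' ds`.
The term `2 δ_{jn} δ(t) D_{x_i} N` of `K_{ij}`, with a Dirac mass in time, contributes the last
summand. -/
def stokesVelocity {d : ℕ} (g : Eu d → ℝ → Eu (d + 1)) (i : Fin (d + 1))
    (x : Eu (d + 1)) (t : ℝ) : ℝ :=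
  (∑ j : Fin (d + 1), ∫ s in (0 : ℝ)..t, ∫ y' : Eu d,
      poissonRegular i j (x - joinPt y' 0) (t - s) * g y' s j)
    + 2 * ∫ y' : Eu d, partialD i newtonKernel (x - joinPt y' 0) * g y' t (Fin.last d)

/-- The boundary data `g(y', s) = a ψ(|y'|) φ(s) e_n`. -/
def boundaryData (d : ℕ) (a : ℝ) (ψ φ : ℝ → ℝ) (y' : Eu d) (s : ℝ) : Eu (d + 1) :=
  (a * ψ ‖y'‖ * φ s) • axis (Fin.last d)

/-- `y' ↦ ψ(|y'|)` belongs to `C_c^∞(B'_1)`, is nonnegative, and exceeds `1` in `B'_{1/2}`. -/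
structure IsSpatialProfile (d : ℕ) (ψ : ℝ → ℝ) : Prop where
  smooth : ContDiff ℝ (⊤ : ℕ∞) (fun y' : Eu d => ψ ‖y'‖)
  support : tsupport (fun y' : Eu d => ψ ‖y'‖) ⊆ Metric.ball 0 1
  nonneg : ∀ y' : Eu d, 0 ≤ ψ ‖y'‖
  one_lt : ∀ y' ∈ Metric.ball (0 : Eu d) (1 / 2), 1 < ψ ‖y'‖

/-- `φ ∈ C^{1+α/2}([0,2])`: `φ` is `C¹` on `[0,2]` and `φ'` is Hölder continuous there with
exponent `α/2`. -/
def IsC1Holder (α : ℝ) (φ : ℝ → ℝ) : Prop :=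
  ContDiffOn ℝ 1 φ (Icc 0 2) ∧
    ∃ C : ℝ, ∀ s ∈ Icc (0 : ℝ) 2, ∀ t ∈ Icc (0 : ℝ) 2,
      |derivWithin φ (Icc 0 2) s - derivWithin φ (Icc 0 2) t| ≤ C * |s - t| ^ (α / 2)

/-- The shape of the temporal profile: `φ(0) = 0`, `φ` is extended by zero to negative times,
is positive and increasing on `(0,1)`, and is decreasing on `(1,2)`. -/
structure IsTemporalProfile (φ : ℝ → ℝ) : Prop where
  zero : ∀ s ≤ 0, φ s = 0
  pos : ∀ s ∈ Ioo (0 : ℝ) 1, 0 < φ s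
  mono : MonotoneOn φ (Ioo 0 1)
  anti : AntitoneOn φ (Ioo 1 2)

/-- `M(t) = ∫_{-∞}^t (φ(t) - φ(s)) (t - s)^{-3/2} ds`. -/
def M (φ : ℝ → ℝ) (t : ℝ) : ℝ :=
  ∫ s in Iio t, (φ t - φ s) / (t - s) ^ (3 / 2 : ℝ)

/-- `t_0^* = sup {r ∈ (0,2) | M > 0 on (0,r)}`. -/
def escapeTime (φ : ℝ → ℝ) : ℝ :=
  sSup {r : ℝ | r ∈ Ioo (0 : ℝ) 2 ∧ ∀ t ∈ Ioo (0 : ℝ) r, 0 < M φ t}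

/-- The condition `P_+` for the scalar function `v` at `(x', t)`. -/
def CondPlus {d : ℕ} (v : Eu (d + 1) → ℝ → ℝ) (x' : Eu d) (t : ℝ) : Prop :=
  ∃ ε > 0, ∀ r ∈ Ioo (0 : ℝ) ε, 0 < v (joinPt x' r) t

/-- The condition `P_-` for the scalar function `v` at `(x', t)`. -/
def CondMinus {d : ℕ} (v : Eu (d + 1) → ℝ → ℝ) (x' : Eu d) (t : ℝ) : Prop :=
  ∃ ε > 0, ∀ r ∈ Ioo (0 : ℝ) ε, v (joinPt x' r) t < 0

/-- `(x', t)` is a boundary layer separation point of the velocity component `v`. -/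
def IsSeparationPoint {d : ℕ} (v : Eu (d + 1) → ℝ → ℝ) (x' : Eu d) (t : ℝ) : Prop :=
  0 < t ∧ (∀ s ∈ Ioo 0 t, CondPlus v x' s) ∧
    ∃ τ : ℕ → ℝ, (∀ k, t < τ k) ∧ Tendsto τ atTop (𝓝 t) ∧ ∀ k, CondMinus v x' (τ k)

end

end StokesHalfSpace

open StokesHalfSpace

/-!
On a normal line over `x e_i`, subordination of the Newtonian kernel to the heat kernel writes the
`i`-th velocity component at height `r` as a positive multiple of
`φ(t) (1 - ∫₀ʳ α(u,0) du) - κ ∫₀ᵗ φ(t-τ) (ϖ(r,τ) ρ(x,τ) - ∫₀ʳ ϖ(r-u,τ) α(u,τ) du) dτ`,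
where `κ ϖ(r,·)` is the density of the first passage time of Brownian motion at distance `r`,
`ρ(x,τ)` is the growth factor of the tangential gradient of the potential of the boundary data under
the heat flow, and `α ≥ 0` is the corresponding flux. As `r → 0` the velocity divided by `r` tends
to a multiple of the wall shear `∫₀^∞ τ^{-3/2} (φ(t) - φ(t-τ) ρ(x,τ)) dτ`, which is `M(t)` when
`ρ = 1`. Where the shear vanishes, the next term of the expansion in `r` is positive, so the
separation time is the infimum of the times of negative shear.

Far from the support of the data, `ρ(x,τ)` exceeds `1`, decreases strictly in `x` and tends to `1`.
Hence the shear increases strictly with `x` and stays below `M`, and its reversal times increase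
strictly to `t₀*`.
-/

namespace StokesHalfSpace

noncomputable section

/-! ### One-dimensional kernels -/

lemma rpow_mul_exp_neg_le {s b v : ℝ} (hs : 0 < s) (hb : 0 < b) (hv : 0 ≤ v) :
    v ^ s * Real.exp (-(b * v)) ≤ (s / b) ^ s := by
  have hlin : v ≤ s / b * Real.exp (b * v / s) :=
    calc v = s / b * (b * v / s) := by field_simp
      _ ≤ _ := by gcongr; linarith [Real.add_one_le_exp (b * v / s)]
  have hpow : v ^ s ≤ (s / b) ^ s * Real.exp (b * v) :=
    calc v ^ s ≤ (s / b * Real.exp (b * v / s)) ^ s := Real.rpow_le_rpow hv hlin hs.le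
      _ = (s / b) ^ s * Real.exp (b * v) := by
        rw [Real.mul_rpow (by positivity) (Real.exp_pos _).le, ← Real.exp_mul]
        congr 2; field_simp
  calc v ^ s * Real.exp (-(b * v)) ≤ (s / b) ^ s * Real.exp (b * v) * Real.exp (-(b * v)) := by
        gcongr
    _ = (s / b) ^ s := by rw [mul_assoc, ← Real.exp_add]; simp

lemma exp_neg_div_le_one {m ρ : ℝ} (hm : 0 ≤ m) (hρ : 0 ≤ ρ) :
    Real.exp (-m / (4 * ρ)) ≤ 1 := by
  rw [Real.exp_le_one_iff, neg_div, neg_nonpos]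
  positivity

/-- The radial profile, as a function of the time `ρ`, of Gaussians and their derivatives at
squared distance `m`. -/
def radialHeat (s m ρ : ℝ) : ℝ := ρ ^ (-s) * Real.exp (-m / (4 * ρ))

/-- The one-dimensional Gaussian at time `σ`, without its factor `(4π)^(-1/2)`. -/
def lineHeat (u σ : ℝ) : ℝ := σ ^ (-(1 / 2) : ℝ) * Real.exp (-u ^ 2 / (4 * σ))

/-- The density at time `σ` of the first passage of a Brownian motion through height `u`, without
its factor `(4π)^(-1/2)`; it is `-2 ∂_u` of `lineHeat`. -/
def passageDensity (u σ : ℝ) : ℝ := u * σ ^ (-(3 / 2) : ℝ) * Real.exp (-u ^ 2 / (4 * σ))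

/-- An integrable function on `(0, ∞)` dominating all the kernels below: `σ ^ (-3/4)` near `0` and
`σ ^ (-3/2)` near `∞`. -/
def majorant (σ : ℝ) : ℝ := min (σ ^ (-(3 / 4) : ℝ)) (σ ^ (-(3 / 2) : ℝ))

section RadialHeat

variable {s m m' σ τ ρ : ℝ}

lemma radialHeat_nonneg (hρ : 0 ≤ ρ) : 0 ≤ radialHeat s m ρ := by
  unfold radialHeat; positivity

lemma radialHeat_pos (hρ : 0 < ρ) : 0 < radialHeat s m ρ := by
  unfold radialHeat; positivity

lemma radialHeat_anti (hρ : 0 < ρ) (hmm : m ≤ m') : radialHeat s m' ρ ≤ radialHeat s m ρ := by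
  unfold radialHeat
  gcongr

lemma radialHeat_le_rpow (hρ : 0 < ρ) (hm : 0 ≤ m) : radialHeat s m ρ ≤ ρ ^ (-s) :=
  mul_le_of_le_one_right (by positivity) (exp_neg_div_le_one hm hρ.le)

lemma radialHeat_le_const (hs : 0 < s) (hρ : 0 < ρ) (hm : 0 < m) :
    radialHeat s m ρ ≤ (s / (m / 4)) ^ s := by
  have hexp : -m / (4 * ρ) = -(m / 4 * ρ⁻¹) := by field_simp
  rw [radialHeat, Real.rpow_neg hρ.le, ← Real.inv_rpow hρ.le, hexp]
  exact rpow_mul_exp_neg_le hs (by positivity) (by positivity)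

lemma radialHeat_eq_mul (hρ : 0 < ρ) : radialHeat s m ρ = ρ * radialHeat (s + 1) m ρ := by
  have hpow : ρ ^ (-s) = ρ ^ (-(s + 1)) * ρ := by
    rw [← Real.rpow_add_one hρ.ne']; congr 1; ring
  rw [radialHeat, radialHeat, hpow]; ring

lemma radialHeat_shift_le (hs : 1 ≤ s) (hm : 0 < m) (hτ : 0 ≤ τ) (hσ : 1 ≤ σ) :
    radialHeat s m (σ + τ) ≤ σ ^ (-1 : ℝ) :=
  calc radialHeat s m (σ + τ) ≤ (σ + τ) ^ (-s) := radialHeat_le_rpow (by linarith) hm.le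
    _ ≤ (σ + τ) ^ (-1 : ℝ) := Real.rpow_le_rpow_of_exponent_le (by linarith) (by linarith)
    _ ≤ σ ^ (-1 : ℝ) := Real.rpow_le_rpow_of_nonpos (by linarith) (by linarith) (by norm_num)

/-- An upper bound, at least `1`, for `radialHeat s m'` on `(0, ∞)` for all `m' ≥ m`. -/
def radialBound (s m : ℝ) : ℝ := max 1 ((s / (m / 4)) ^ s)

lemma one_le_radialBound (s m : ℝ) : 1 ≤ radialBound s m := le_max_left _ _

lemma radialHeat_le (hs : 0 < s) (hρ : 0 < ρ) (hm : 0 < m) (hmm : m ≤ m') :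
    radialHeat s m' ρ ≤ radialBound s m :=
  ((radialHeat_anti hρ hmm).trans (radialHeat_le_const hs hρ hm)).trans (le_max_right _ _)

lemma rpow_neg_sub_le_rpow_neg_add (hs : 1 ≤ s) (hσ : 0 < σ) (hτ : 0 ≤ τ) :
    σ ^ (-s) - s * τ * σ ^ (-(s + 1)) ≤ (σ + τ) ^ (-s) := by
  have hsum : 0 < σ + τ := by linarith
  have hbernoulli : 1 - s * (τ / (σ + τ)) ≤ (σ / (σ + τ)) ^ s := by
    have hle : τ / (σ + τ) ≤ 1 := by rw [div_le_one hsum]; linarith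
    have h := one_add_mul_self_le_rpow_one_add (s := -(τ / (σ + τ))) (by linarith) hs
    rwa [show 1 + -(τ / (σ + τ)) = σ / (σ + τ) by field_simp; ring, mul_neg, ← sub_eq_add_neg] at h
  have hquot : s * (τ / (σ + τ)) ≤ s * (τ / σ) := by gcongr; linarith
  have hpow : σ ^ (-(s + 1)) = σ ^ (-s) / σ := by
    rw [← Real.rpow_sub_one hσ.ne']; congr 1; ring
  calc σ ^ (-s) - s * τ * σ ^ (-(s + 1)) = σ ^ (-s) * (1 - s * (τ / σ)) := by
        rw [hpow]; field_simp
    _ ≤ σ ^ (-s) * (σ / (σ + τ)) ^ s := by gcongr; linarith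
    _ = (σ + τ) ^ (-s) := by
        rw [Real.div_rpow hσ.le hsum.le, Real.rpow_neg hσ.le, Real.rpow_neg hsum.le]
        field_simp

lemma radialHeat_shift_sub_ge (hs : 1 ≤ s) (hm : 0 ≤ m) (hσ : 0 < σ) (hτ : 0 ≤ τ) :
    -(s * τ * radialHeat (s + 1) m σ) ≤ radialHeat s m (σ + τ) - radialHeat s m σ := by
  have hexp : Real.exp (-m / (4 * σ)) ≤ Real.exp (-m / (4 * (σ + τ))) := by
    rw [Real.exp_le_exp, neg_div, neg_div, neg_le_neg_iff]
    gcongr; linarith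
  have hpow := rpow_neg_sub_le_rpow_neg_add hs hσ hτ
  have hlower : (σ ^ (-s) - s * τ * σ ^ (-(s + 1))) * Real.exp (-m / (4 * σ)) ≤
      (σ + τ) ^ (-s) * Real.exp (-m / (4 * (σ + τ))) := by gcongr
  unfold radialHeat
  linarith

lemma hasDerivAt_radialHeat (hρ : 0 < ρ) :
    HasDerivAt (radialHeat s m)
      (m / 4 * radialHeat (s + 2) m ρ - s * radialHeat (s + 1) m ρ) ρ := by
  have hpow : HasDerivAt (fun ρ : ℝ => ρ ^ (-s)) (-s * ρ ^ (-s - 1)) ρ := by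
    simpa using Real.hasDerivAt_rpow_const (x := ρ) (p := -s) (Or.inl hρ.ne')
  have hquot : HasDerivAt (fun ρ : ℝ => -m / (4 * ρ)) (m / (4 * ρ ^ 2)) ρ := by
    refine ((hasDerivAt_const ρ (-m)).fun_div ((hasDerivAt_id ρ).const_mul 4)
      (by simpa using hρ.ne')).congr_deriv ?_
    simp only [id]; field_simp; ring
  refine (hpow.mul hquot.exp).congr_deriv ?_
  have h_two : ρ ^ (-(s + 2)) = ρ ^ (-s) / ρ ^ 2 := by
    rw [← Real.rpow_natCast, ← Real.rpow_sub hρ]; congr 1; push_cast; ring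
  have h_one : ρ ^ (-(s + 1)) = ρ ^ (-s) / ρ := by
    rw [← Real.rpow_sub_one hρ.ne']; congr 1; ring
  rw [radialHeat, radialHeat, h_two, h_one, Real.rpow_sub_one hρ.ne']
  field_simp; ring

@[fun_prop] lemma measurable_radialHeat {α : Type*} [MeasurableSpace α] {f g : α → ℝ}
    (hf : Measurable f) (hg : Measurable g) :
    Measurable (fun x => radialHeat s (f x) (g x)) := by
  unfold radialHeat; fun_prop

end RadialHeat

section Majorant

variable {σ : ℝ}

lemma majorant_nonneg (hσ : 0 ≤ σ) : 0 ≤ majorant σ := by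
  unfold majorant; positivity

lemma majorant_of_le_one (hσ : 0 < σ) (hσ1 : σ ≤ 1) : majorant σ = σ ^ (-(3 / 4) : ℝ) :=
  min_eq_left (Real.rpow_le_rpow_of_exponent_ge hσ hσ1 (by norm_num))

lemma majorant_of_one_le (hσ : 1 ≤ σ) : majorant σ = σ ^ (-(3 / 2) : ℝ) :=
  min_eq_right (Real.rpow_le_rpow_of_exponent_le hσ (by norm_num))

lemma le_mul_majorant {A f : ℝ} (hσ : 0 < σ)
    (hsmall : σ ≤ 1 → f ≤ A * σ ^ (-(3 / 4) : ℝ)) (hlarge : 1 ≤ σ → f ≤ A * σ ^ (-(3 / 2) : ℝ)) :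
    f ≤ A * majorant σ := by
  rcases le_total σ 1 with h | h
  · rw [majorant_of_le_one hσ h]; exact hsmall h
  · rw [majorant_of_one_le h]; exact hlarge h

lemma integrableOn_majorant : IntegrableOn majorant (Ioi 0) := by
  rw [← Ioc_union_Ioi_eq_Ioi (zero_le_one (α := ℝ))]
  refine IntegrableOn.union ?_ ?_
  · have h : IntegrableOn (fun σ : ℝ => σ ^ (-(3 / 4) : ℝ)) (Ioc 0 1) :=
      (intervalIntegrable_iff_integrableOn_Ioc_of_le zero_le_one).1
        (intervalIntegral.intervalIntegrable_rpow' (by norm_num))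
    exact h.congr_fun (fun σ hσ => (majorant_of_le_one hσ.1 hσ.2).symm) measurableSet_Ioc
  · have h : IntegrableOn (fun σ : ℝ => σ ^ (-(3 / 2) : ℝ)) (Ioi 1) :=
      integrableOn_Ioi_rpow_of_lt (by norm_num) one_pos
    exact h.congr_fun (fun σ hσ => (majorant_of_one_le (le_of_lt hσ)).symm) measurableSet_Ioi

lemma integral_majorant_nonneg : 0 ≤ ∫ σ in Ioi (0 : ℝ), majorant σ :=
  setIntegral_nonneg measurableSet_Ioi fun _ hσ => majorant_nonneg (le_of_lt hσ)

lemma rpow_neg_half_le (hσ : 0 < σ) (hσ1 : σ ≤ 1) :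
    σ ^ (-(1 / 2) : ℝ) ≤ σ ^ (-(3 / 4) : ℝ) :=
  Real.rpow_le_rpow_of_exponent_ge hσ hσ1 (by norm_num)

end Majorant

section LineKernels

variable {s m m' σ τ u : ℝ}

lemma lineHeat_pos (hσ : 0 < σ) : 0 < lineHeat u σ := by
  unfold lineHeat; positivity

lemma lineHeat_zero (σ : ℝ) : lineHeat 0 σ = σ ^ (-(1 / 2) : ℝ) := by simp [lineHeat]

lemma lineHeat_le (hσ : 0 ≤ σ) : lineHeat u σ ≤ σ ^ (-(1 / 2) : ℝ) :=
  mul_le_of_le_one_right (by positivity) (exp_neg_div_le_one (sq_nonneg u) hσ)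

lemma passageDensity_nonneg (hu : 0 ≤ u) (hσ : 0 ≤ σ) : 0 ≤ passageDensity u σ := by
  unfold passageDensity; positivity

lemma passageDensity_le (hu : 0 ≤ u) (hσ : 0 ≤ σ) :
    passageDensity u σ ≤ u * σ ^ (-(3 / 2) : ℝ) :=
  mul_le_of_le_one_right (by positivity) (exp_neg_div_le_one (sq_nonneg u) hσ)

lemma rpow_mul_exp_neg_quarter_le {v : ℝ} (hv : 0 ≤ v) :
    v ^ (3 / 4 : ℝ) * Real.exp (-v / 4) ≤ 4 := by
  have hpow : v ^ (3 / 4 : ℝ) ≤ 1 + v :=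
    calc v ^ (3 / 4 : ℝ) ≤ (1 + v) ^ (3 / 4 : ℝ) := by gcongr; linarith
      _ ≤ (1 + v) ^ (1 : ℝ) :=
        Real.rpow_le_rpow_of_exponent_le (by linarith) (by norm_num)
      _ = 1 + v := Real.rpow_one _
  calc v ^ (3 / 4 : ℝ) * Real.exp (-v / 4) ≤ 4 * Real.exp (v / 4) * Real.exp (-v / 4) := by
        gcongr; linarith [Real.add_one_le_exp (v / 4)]
    _ = 4 := by rw [mul_assoc, ← Real.exp_add, neg_div, add_neg_cancel, Real.exp_zero, mul_one]

lemma passageDensity_eq_rpow_mul (hu : 0 < u) (hσ : 0 < σ) :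
    passageDensity u σ = u ^ (-(1 / 2) : ℝ) * σ ^ (-(3 / 4) : ℝ) *
      ((u ^ 2 / σ) ^ (3 / 4 : ℝ) * Real.exp (-(u ^ 2 / σ) / 4)) := by
  have hu_pow : (u ^ 2) ^ (3 / 4 : ℝ) = u * u ^ (1 / 2 : ℝ) := by
    rw [← Real.rpow_natCast u 2, ← Real.rpow_mul hu.le, mul_comm u, ← Real.rpow_add_one hu.ne']
    norm_num
  have hσ_pow : σ ^ (-(3 / 2) : ℝ) = σ ^ (-(3 / 4) : ℝ) / σ ^ (3 / 4 : ℝ) := by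
    rw [← Real.rpow_sub hσ]; norm_num
  have hexp : -u ^ 2 / (4 * σ) = -(u ^ 2 / σ) / 4 := by field_simp
  rw [passageDensity, Real.div_rpow (by positivity) hσ.le, hu_pow, hσ_pow, hexp,
    Real.rpow_neg hu.le]
  field_simp

lemma passageDensity_le_rpow (hu : 0 < u) (hσ : 0 < σ) :
    passageDensity u σ ≤ 4 * u ^ (-(1 / 2) : ℝ) * σ ^ (-(3 / 4) : ℝ) := by
  rw [passageDensity_eq_rpow_mul hu hσ, mul_assoc 4, mul_comm 4]
  gcongr
  exact rpow_mul_exp_neg_quarter_le (by positivity)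

lemma passageDensity_le_majorant {a b : ℝ} (ha : 0 < a) (hu : u ∈ Icc a b) (hσ : 0 < σ) :
    passageDensity u σ ≤ max b (4 * a ^ (-(1 / 2) : ℝ)) * majorant σ := by
  have hu0 : 0 < u := ha.trans_le hu.1
  refine le_mul_majorant hσ (fun _ => ?_) (fun _ => ?_)
  · refine (passageDensity_le_rpow hu0 hσ).trans ?_
    gcongr
    refine le_max_of_le_right ?_
    gcongr ?_ * ?_
    exact Real.rpow_le_rpow_of_nonpos ha hu.1 (by norm_num)
  · refine (passageDensity_le hu0.le hσ.le).trans ?_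
    gcongr
    exact le_max_of_le_left hu.2

lemma mul_passageDensity_le (hu : 0 ≤ u) (hσ : 0 < σ) (hσ1 : σ ≤ 1) :
    σ * passageDensity u σ ≤ u * majorant σ := by
  have hpow : σ * σ ^ (-(3 / 2) : ℝ) = σ ^ (-(1 / 2) : ℝ) := by
    rw [mul_comm, ← Real.rpow_add_one hσ.ne']; norm_num
  calc σ * passageDensity u σ ≤ σ * (u * σ ^ (-(3 / 2) : ℝ)) := by
        gcongr; exact passageDensity_le hu hσ.le
    _ = u * σ ^ (-(1 / 2) : ℝ) := by rw [← hpow]; ring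
    _ ≤ u * majorant σ := by
        rw [majorant_of_le_one hσ hσ1]; gcongr ?_ * ?_; exact rpow_neg_half_le hσ hσ1

@[fun_prop] lemma measurable_lineHeat {α : Type*} [MeasurableSpace α] {f g : α → ℝ}
    (hf : Measurable f) (hg : Measurable g) : Measurable (fun x => lineHeat (f x) (g x)) := by
  unfold lineHeat; fun_prop

@[fun_prop] lemma measurable_passageDensity {α : Type*} [MeasurableSpace α] {f g : α → ℝ}
    (hf : Measurable f) (hg : Measurable g) :
    Measurable (fun x => passageDensity (f x) (g x)) := by
  unfold passageDensity; fun_prop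

lemma hasDerivAt_lineHeat (u : ℝ) (hσ : 0 < σ) :
    HasDerivAt (fun u => lineHeat u σ) (-(1 / 2) * passageDensity u σ) u := by
  have hquot : HasDerivAt (fun u : ℝ => -u ^ 2 / (4 * σ)) (-(2 * u) / (4 * σ)) u := by
    simpa using ((hasDerivAt_pow 2 u).neg).div_const (4 * σ)
  have hpow : σ ^ (-(3 / 2) : ℝ) = σ ^ (-(1 / 2) : ℝ) / σ := by
    rw [← Real.rpow_sub_one hσ.ne']; norm_num
  refine (hquot.exp.const_mul (σ ^ (-(1 / 2) : ℝ))).congr_deriv ?_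
  rw [passageDensity, hpow]; field_simp; ring

lemma integrableOn_passageDensity (hu : 0 < u) : IntegrableOn (passageDensity u) (Ioi 0) := by
  refine Integrable.mono' (integrableOn_majorant.const_mul (max u (4 * u ^ (-(1 / 2) : ℝ))))
    (by fun_prop) (ae_restrict_of_forall_mem measurableSet_Ioi fun σ (hσ : 0 < σ) => ?_)
  rw [Real.norm_of_nonneg (passageDensity_nonneg hu.le hσ.le)]
  exact passageDensity_le_majorant hu ⟨le_rfl, le_rfl⟩ hσ

lemma integral_passageDensity (hu : 0 < u) :
    ∫ σ in Ioi (0 : ℝ), passageDensity u σ = 2 * √Real.pi := by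
  have hsubst : ∀ x ∈ Ioi (0 : ℝ),
      (|(-2 : ℝ)| * x ^ ((-2 : ℝ) - 1)) • passageDensity u (x ^ (-2 : ℝ)) =
        2 * u * Real.exp (-(u ^ 2 / 4) * x ^ 2) := by
    intro x (hx : 0 < x)
    have hexp : -u ^ 2 / (4 * x ^ (-2 : ℝ)) = -(u ^ 2 / 4) * x ^ 2 := by
      rw [Real.rpow_neg hx.le, Real.rpow_two]; field_simp
    have hcancel : x ^ ((-2 : ℝ) - 1) * x ^ ((-2 : ℝ) * -(3 / 2)) = 1 := by
      rw [← Real.rpow_add hx]; norm_num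
    rw [passageDensity, ← Real.rpow_mul hx.le, smul_eq_mul, hexp, abs_neg, abs_two]
    linear_combination (2 * u * Real.exp (-(u ^ 2 / 4) * x ^ 2)) * hcancel
  have hsqrt : √(Real.pi / (u ^ 2 / 4)) = 2 * √Real.pi / u := by
    rw [Real.sqrt_div (by positivity), show u ^ 2 / 4 = (u / 2) ^ 2 by ring,
      Real.sqrt_sq (by positivity)]
    field_simp
  rw [← integral_comp_rpow_Ioi (passageDensity u) (p := -2) (by norm_num),
    setIntegral_congr_fun measurableSet_Ioi hsubst, integral_const_mul, integral_gaussian_Ioi,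
    hsqrt]
  field_simp

lemma radialHeat_mul_lineHeat_nonneg (hτ : 0 ≤ τ) (hσ : 0 < σ) :
    0 ≤ radialHeat s m (σ + τ) * lineHeat u σ :=
  mul_nonneg (radialHeat_nonneg (by linarith)) (lineHeat_pos hσ).le

lemma radialHeat_mul_lineHeat_le (hs : 1 ≤ s) (hm : 0 < m) (hmm : m ≤ m') (hτ : 0 ≤ τ)
    (hσ : 0 < σ) :
    radialHeat s m' (σ + τ) * lineHeat u σ ≤ radialBound s m * majorant σ := by
  have hbound := one_le_radialBound s m
  have hline := lineHeat_le (u := u) hσ.le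
  have hline_nonneg := (lineHeat_pos (u := u) hσ).le
  refine le_mul_majorant hσ (fun hσ1 => ?_) (fun hσ1 => ?_)
  · calc _ ≤ radialBound s m * σ ^ (-(1 / 2) : ℝ) := by
          gcongr
          exact radialHeat_le (by linarith) (by linarith) hm hmm
      _ ≤ _ := by gcongr ?_ * ?_; exact rpow_neg_half_le hσ hσ1
  · calc _ ≤ σ ^ (-1 : ℝ) * σ ^ (-(1 / 2) : ℝ) := by
          gcongr
          exact radialHeat_shift_le hs (hm.trans_le hmm) hτ hσ1
      _ = 1 * σ ^ (-(3 / 2) : ℝ) := by rw [← Real.rpow_add hσ]; norm_num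
      _ ≤ _ := by gcongr

lemma norm_radialHeat_mul_lineHeat_le (hs : 1 ≤ s) (hm : 0 < m) (hτ : 0 ≤ τ) (hσ : 0 < σ) :
    ‖radialHeat s m (σ + τ) * lineHeat u σ‖ ≤ radialBound s m * majorant σ := by
  rw [Real.norm_of_nonneg (radialHeat_mul_lineHeat_nonneg hτ hσ)]
  exact radialHeat_mul_lineHeat_le hs hm le_rfl hτ hσ

lemma radialHeat_mul_passageDensity_nonneg (hu : 0 ≤ u) (hτ : 0 ≤ τ) (hσ : 0 < σ) :
    0 ≤ radialHeat s m (σ + τ) * passageDensity u σ :=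
  mul_nonneg (radialHeat_nonneg (by linarith)) (passageDensity_nonneg hu hσ.le)

lemma radialHeat_mul_passageDensity_le (hs : 1 ≤ s) (hm : 0 < m) (hmm : m ≤ m') (hτ : 0 ≤ τ)
    (hu : 0 ≤ u) (hσ : 0 < σ) :
    radialHeat s m' (σ + τ) * passageDensity u σ ≤
      (radialBound s m + radialBound (s + 1) m) * (u * majorant σ + τ * passageDensity u σ) := by
  have hB := one_le_radialBound s m
  have hB' := one_le_radialBound (s + 1) m
  have hρ : 0 < σ + τ := by linarith
  have hp := passageDensity_nonneg hu hσ.le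
  rcases le_total σ 1 with hσ1 | hσ1
  · have hr : radialHeat s m' (σ + τ) ≤ (radialBound s m + radialBound (s + 1) m) * (σ + τ) := by
      rw [radialHeat_eq_mul hρ, mul_comm]
      gcongr
      linarith [radialHeat_le (s := s + 1) (by linarith) hρ hm hmm]
    have hmaj := mul_passageDensity_le hu hσ hσ1
    calc _ ≤ (radialBound s m + radialBound (s + 1) m) * (σ + τ) * passageDensity u σ := by gcongr
      _ = (radialBound s m + radialBound (s + 1) m) *
          (σ * passageDensity u σ + τ * passageDensity u σ) := by ring
      _ ≤ _ := by gcongr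
  · have hr : radialHeat s m' (σ + τ) ≤ radialBound s m + radialBound (s + 1) m := by
      linarith [radialHeat_le (s := s) (by linarith) hρ hm hmm]
    have hpass := passageDensity_le hu hσ.le
    rw [← majorant_of_one_le hσ1] at hpass
    calc _ ≤ (radialBound s m + radialBound (s + 1) m) * (u * majorant σ) := by gcongr
      _ ≤ _ := by gcongr; exact le_add_of_nonneg_right (by positivity)

end LineKernels

/-! ### The evolved potential and its flux -/

/-- The radial profile of the tangential gradient of the Newtonian potential at height `u`,
evolved by the tangential heat flow for time `τ`. -/
def potential (s m u τ : ℝ) : ℝ := ∫ σ in Ioi (0 : ℝ), radialHeat s m (σ + τ) * lineHeat u σ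

/-- The flux `-∂_u` of `potential` through height `u`. -/
def potentialFlux (s m u τ : ℝ) : ℝ :=
  1 / 2 * ∫ σ in Ioi (0 : ℝ), radialHeat s m (σ + τ) * passageDensity u σ

section Potential

variable {s m m' τ u : ℝ}

lemma integrableOn_potential (hs : 1 ≤ s) (hm : 0 < m) (hτ : 0 ≤ τ) (u : ℝ) :
    IntegrableOn (fun σ => radialHeat s m (σ + τ) * lineHeat u σ) (Ioi 0) :=
  Integrable.mono' (integrableOn_majorant.const_mul (radialBound s m)) (by fun_prop)
    (ae_restrict_of_forall_mem measurableSet_Ioi fun _ hσ =>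
      norm_radialHeat_mul_lineHeat_le hs hm hτ hσ)

lemma integrableOn_potentialFlux (hs : 0 < s) (hm : 0 < m) (hτ : 0 ≤ τ) (hu : 0 < u) :
    IntegrableOn (fun σ => radialHeat s m (σ + τ) * passageDensity u σ) (Ioi 0) := by
  refine Integrable.mono' ((integrableOn_passageDensity hu).const_mul (radialBound s m))
    (by fun_prop) (ae_restrict_of_forall_mem measurableSet_Ioi fun σ (hσ : 0 < σ) => ?_)
  rw [Real.norm_of_nonneg (radialHeat_mul_passageDensity_nonneg hu.le hτ hσ)]
  exact mul_le_mul_of_nonneg_right (radialHeat_le hs (by linarith) hm le_rfl)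
    (passageDensity_nonneg hu.le hσ.le)

lemma potential_pos (hs : 1 ≤ s) (hm : 0 < m) (hτ : 0 ≤ τ) (u : ℝ) : 0 < potential s m u τ := by
  have hpos : ∀ σ ∈ Ioi (0 : ℝ), 0 < radialHeat s m (σ + τ) * lineHeat u σ :=
    fun σ (hσ : 0 < σ) => mul_pos (radialHeat_pos (by linarith)) (lineHeat_pos hσ)
  refine (setIntegral_pos_iff_support_of_nonneg_ae
    (ae_restrict_of_forall_mem measurableSet_Ioi fun σ hσ => (hpos σ hσ).le)
    (integrableOn_potential hs hm hτ u)).2 ?_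
  rw [inter_eq_right.2 fun σ hσ => Function.mem_support.2 (hpos σ hσ).ne']
  simp

lemma potential_le (hs : 1 ≤ s) (hm : 0 < m) (hmm : m ≤ m') (hτ : 0 ≤ τ) (u : ℝ) :
    potential s m' u τ ≤ radialBound s m * ∫ σ in Ioi (0 : ℝ), majorant σ := by
  rw [potential, ← integral_const_mul]
  exact setIntegral_mono_on (integrableOn_potential hs (hm.trans_le hmm) hτ u)
    (integrableOn_majorant.const_mul _) measurableSet_Ioi
    fun _ hσ => radialHeat_mul_lineHeat_le hs hm hmm hτ hσ

lemma potentialFlux_nonneg (hτ : 0 ≤ τ) (hu : 0 ≤ u) : 0 ≤ potentialFlux s m u τ :=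
  mul_nonneg (by norm_num) (setIntegral_nonneg measurableSet_Ioi fun _ hσ =>
    radialHeat_mul_passageDensity_nonneg hu hτ hσ)

lemma continuous_potential (hs : 1 ≤ s) (hm : 0 < m) (hτ : 0 ≤ τ) :
    Continuous (fun u => potential s m u τ) := by
  refine continuous_of_dominated (bound := fun σ => radialBound s m * majorant σ)
    (fun u => by fun_prop) (fun u => ?_) (integrableOn_majorant.const_mul _)
    (Eventually.of_forall fun σ => by unfold lineHeat; fun_prop)
  exact ae_restrict_of_forall_mem measurableSet_Ioi fun σ hσ =>
    norm_radialHeat_mul_lineHeat_le hs hm hτ hσ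

lemma hasDerivAt_potential (hs : 1 ≤ s) (hm : 0 < m) (hτ : 0 ≤ τ) (hu : 0 < u) :
    HasDerivAt (fun u => potential s m u τ) (-potentialFlux s m u τ) u := by
  have hderiv := hasDerivAt_integral_of_dominated_loc_of_deriv_le
    (μ := volume.restrict (Ioi (0 : ℝ)))
    (F := fun v σ => radialHeat s m (σ + τ) * lineHeat v σ)
    (F' := fun v σ => radialHeat s m (σ + τ) * (-(1 / 2) * passageDensity v σ)) (x₀ := u)
    (s := Ioo (u / 2) (2 * u))
    (bound := fun σ => radialBound s m * (max (2 * u) (4 * (u / 2) ^ (-(1 / 2) : ℝ)) * majorant σ))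
    (Ioo_mem_nhds (by linarith) (by linarith)) (Eventually.of_forall fun v => by fun_prop)
    (integrableOn_potential hs hm hτ u) (by fun_prop) ?_
    ((integrableOn_majorant.const_mul _).const_mul _) ?_
  · refine hderiv.2.congr_deriv ?_
    rw [potentialFlux, ← neg_mul, ← integral_const_mul]
    congr 1; ext σ; ring
  · refine ae_restrict_of_forall_mem measurableSet_Ioi fun σ (hσ : 0 < σ) v hv => ?_
    have hradial := radialHeat_le (s := s) (ρ := σ + τ) (by linarith) (by linarith) hm le_rfl
    have hpass := passageDensity_le_majorant (half_pos hu) (Ioo_subset_Icc_self hv) hσ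
    have hpass_nonneg : 0 ≤ passageDensity v σ :=
      passageDensity_nonneg ((half_pos hu).trans hv.1).le hσ.le
    have hradial_nonneg : 0 ≤ radialHeat s m (σ + τ) := radialHeat_nonneg (by linarith)
    rw [norm_mul, norm_mul, Real.norm_of_nonneg hradial_nonneg, Real.norm_of_nonneg hpass_nonneg]
    refine mul_le_mul hradial (le_trans ?_ hpass) (by positivity) (by linarith)
    norm_num; linarith
  · exact ae_restrict_of_forall_mem measurableSet_Ioi fun σ hσ v _ =>
      (hasDerivAt_lineHeat v hσ).const_mul _

/-- The constant `C` in the bound `potentialFlux s m' u τ ≤ C (u + τ)` for `m' ≥ m`. -/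
def potentialFluxBound (s m : ℝ) : ℝ :=
  (radialBound s m + radialBound (s + 1) m) * (2 * √Real.pi + ∫ σ in Ioi (0 : ℝ), majorant σ)

lemma potentialFluxBound_nonneg (s m : ℝ) : 0 ≤ potentialFluxBound s m := by
  have hB := one_le_radialBound s m
  have hB' := one_le_radialBound (s + 1) m
  have := integral_majorant_nonneg
  unfold potentialFluxBound; positivity

lemma integral_radialHeat_mul_passageDensity_le (hs : 1 ≤ s) (hm : 0 < m) (hmm : m ≤ m')
    (hτ : 0 ≤ τ) (hu : 0 < u) :
    ∫ σ in Ioi (0 : ℝ), radialHeat s m' (σ + τ) * passageDensity u σ ≤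
      (radialBound s m + radialBound (s + 1) m) *
        (u * (∫ σ in Ioi (0 : ℝ), majorant σ) + τ * (2 * √Real.pi)) := by
  have hmaj : IntegrableOn (fun σ => u * majorant σ) (Ioi 0) := integrableOn_majorant.const_mul u
  have hpass : IntegrableOn (fun σ => τ * passageDensity u σ) (Ioi 0) :=
    (integrableOn_passageDensity hu).const_mul τ
  calc _ ≤ ∫ σ in Ioi (0 : ℝ), (radialBound s m + radialBound (s + 1) m) *
        (u * majorant σ + τ * passageDensity u σ) :=
        setIntegral_mono_on (integrableOn_potentialFlux (by linarith) (hm.trans_le hmm) hτ hu)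
          ((hmaj.add hpass).const_mul _) measurableSet_Ioi fun σ hσ =>
          radialHeat_mul_passageDensity_le hs hm hmm hτ hu.le hσ
    _ = _ := by
        rw [integral_const_mul, integral_add hmaj hpass, integral_const_mul, integral_const_mul,
          integral_passageDensity hu]

lemma potentialFlux_le (hs : 1 ≤ s) (hm : 0 < m) (hmm : m ≤ m') (hτ : 0 ≤ τ) (hu : 0 < u) :
    potentialFlux s m' u τ ≤ potentialFluxBound s m * (u + τ) := by
  have hB := one_le_radialBound s m
  have hB' := one_le_radialBound (s + 1) m
  have hJ := integral_majorant_nonneg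
  set J := ∫ σ in Ioi (0 : ℝ), majorant σ
  have hsum : u * J + τ * (2 * √Real.pi) ≤ (2 * √Real.pi + J) * (u + τ) := by
    have : 0 ≤ u * √Real.pi := by positivity
    have : 0 ≤ τ * J := by positivity
    linarith
  have hflux : potentialFlux s m' u τ ≤
      ∫ σ in Ioi (0 : ℝ), radialHeat s m' (σ + τ) * passageDensity u σ := by
    have := potentialFlux_nonneg (s := s) (m := m') hτ hu.le
    rw [potentialFlux] at this ⊢; linarith
  calc _ ≤ _ := hflux.trans (integral_radialHeat_mul_passageDensity_le hs hm hmm hτ hu)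
    _ ≤ (radialBound s m + radialBound (s + 1) m) * ((2 * √Real.pi + J) * (u + τ)) := by gcongr
    _ = _ := by rw [potentialFluxBound]; ring

/-- The constant `C` in the bound `-C u τ ≤ potentialFlux s m' u τ - potentialFlux s m' u 0` for
`m' ≥ m`. -/
def potentialFluxDropBound (s m : ℝ) : ℝ :=
  s * ((radialBound (s + 1) m + radialBound (s + 1 + 1) m) * ∫ σ in Ioi (0 : ℝ), majorant σ)

lemma potentialFluxDropBound_nonneg (hs : 0 ≤ s) (m : ℝ) : 0 ≤ potentialFluxDropBound s m := by
  have h₁ := one_le_radialBound (s + 1) m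
  have h₂ := one_le_radialBound (s + 1 + 1) m
  have hJ := integral_majorant_nonneg
  unfold potentialFluxDropBound
  positivity

lemma potentialFlux_sub_ge (hs : 1 ≤ s) (hm : 0 < m) (hmm : m ≤ m') (hτ : 0 ≤ τ) (hu : 0 < u) :
    -(potentialFluxDropBound s m * (u * τ)) ≤ potentialFlux s m' u τ - potentialFlux s m' u 0 := by
  have hm' : 0 < m' := hm.trans_le hmm
  have hint {τ : ℝ} (hτ : 0 ≤ τ) := integrableOn_potentialFlux (s := s) (by linarith) hm' hτ hu
  have hint' := integrableOn_potentialFlux (s := s + 1) (by linarith) hm' le_rfl hu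
  have hmono : -(s * τ) * ∫ σ in Ioi (0 : ℝ), radialHeat (s + 1) m' (σ + 0) * passageDensity u σ ≤
      ∫ σ in Ioi (0 : ℝ), (radialHeat s m' (σ + τ) * passageDensity u σ
        - radialHeat s m' (σ + 0) * passageDensity u σ) := by
    rw [← integral_const_mul]
    refine setIntegral_mono_on (hint'.const_mul _) ((hint hτ).sub (hint le_rfl)) measurableSet_Ioi
      fun σ (hσ : 0 < σ) => ?_
    rw [add_zero, ← sub_mul, ← mul_assoc, neg_mul]
    exact mul_le_mul_of_nonneg_right (radialHeat_shift_sub_ge hs hm'.le hσ hτ)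
      (passageDensity_nonneg hu.le hσ.le)
  rw [integral_sub (hint hτ) (hint le_rfl)] at hmono
  have hle := integral_radialHeat_mul_passageDensity_le (s := s + 1) (by linarith) hm hmm le_rfl hu
  rw [zero_mul, add_zero] at hle
  have hpos : 0 ≤ ∫ σ in Ioi (0 : ℝ), radialHeat (s + 1) m' (σ + 0) * passageDensity u σ :=
    setIntegral_nonneg measurableSet_Ioi fun _ hσ =>
      radialHeat_mul_passageDensity_nonneg hu.le le_rfl hσ
  have hmul := mul_le_mul_of_nonneg_left hle (show 0 ≤ s * τ by positivity)
  have hmul_pos := mul_nonneg (show 0 ≤ s * τ by positivity) hpos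
  unfold potentialFlux potentialFluxDropBound
  linarith

end Potential

section BoundaryPotential

variable {s m τ : ℝ}

/-! ### The time dependence of the potential on the boundary -/

lemma potential_scale (hm : 0 < m) (hτ : 0 ≤ τ) (u : ℝ) :
    potential s m u τ = m ^ (1 / 2 - s) * potential s 1 (u / √m) (τ / m) := by
  have hsubst := integral_comp_mul_left_Ioi
    (fun σ => radialHeat s m (σ + τ) * lineHeat u σ) 0 hm
  have hscale : ∀ σ ∈ Ioi (0 : ℝ), radialHeat s m (m * σ + τ) * lineHeat u (m * σ) =
      m ^ (-1 / 2 - s) * (radialHeat s 1 (σ + τ / m) * lineHeat (u / √m) σ) := by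
    intro σ (hσ : 0 < σ)
    have hpos : 0 ≤ σ + τ / m := by positivity
    have hradial : -m / (4 * (m * (σ + τ / m))) = -1 / (4 * (σ + τ / m)) := by
      rw [show 4 * (m * (σ + τ / m)) = m * (4 * (σ + τ / m)) by ring,
        show -m = m * (-1) by ring, mul_div_mul_left _ _ hm.ne']
    have hline : -u ^ 2 / (4 * (m * σ)) = -(u ^ 2 / m) / (4 * σ) := by field_simp
    rw [show m * σ + τ = m * (σ + τ / m) by field_simp]
    unfold radialHeat lineHeat
    rw [hradial, hline, Real.mul_rpow hm.le hpos, Real.mul_rpow hm.le hσ.le,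
      show (-1 / 2 - s : ℝ) = -s + -(1 / 2) by ring, Real.rpow_add hm, div_pow,
      Real.sq_sqrt hm.le]
    ring
  have hpow : m ^ (1 / 2 - s) = m * m ^ (-1 / 2 - s) := by
    rw [mul_comm, ← Real.rpow_add_one hm.ne']; congr 1; ring
  rw [mul_zero, smul_eq_mul, setIntegral_congr_fun measurableSet_Ioi hscale,
    integral_const_mul] at hsubst
  rw [potential, potential, hpow, mul_assoc, hsubst, mul_inv_cancel_left₀ hm.ne']

lemma continuousOn_potential_time (hs : 1 ≤ s) (hm : 0 < m) (u : ℝ) :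
    ContinuousOn (fun τ => potential s m u τ) (Ici 0) := by
  refine continuousOn_of_dominated (bound := fun σ => radialBound s m * majorant σ)
    (fun τ _ => by fun_prop) (fun τ hτ => ?_) (integrableOn_majorant.const_mul _) ?_
  · exact ae_restrict_of_forall_mem measurableSet_Ioi fun σ hσ =>
      norm_radialHeat_mul_lineHeat_le hs hm hτ hσ
  · refine ae_restrict_of_forall_mem measurableSet_Ioi fun σ (hσ : 0 < σ) τ (hτ : 0 ≤ τ) => ?_
    have hradial : ContinuousAt (fun τ => radialHeat s m (σ + τ)) τ :=
      ((hasDerivAt_radialHeat (by linarith)).comp_const_add σ τ).continuousAt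
    exact (hradial.mul continuousAt_const).continuousWithinAt

lemma hasDerivAt_potential_time (hs : 1 ≤ s) (hτ : 0 < τ) :
    HasDerivAt (fun τ => potential s 1 0 τ)
      (1 / 4 * potential (s + 2) 1 0 τ - s * potential (s + 1) 1 0 τ) τ := by
  have hderiv := hasDerivAt_integral_of_dominated_loc_of_deriv_le
    (μ := volume.restrict (Ioi (0 : ℝ)))
    (F := fun τ σ => radialHeat s 1 (σ + τ) * lineHeat 0 σ)
    (F' := fun τ σ => 1 / 4 * (radialHeat (s + 2) 1 (σ + τ) * lineHeat 0 σ)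
      - s * (radialHeat (s + 1) 1 (σ + τ) * lineHeat 0 σ)) (x₀ := τ) (s := Ioi 0)
    (bound := fun σ => 1 / 4 * (radialBound (s + 2) 1 * majorant σ) +
      s * (radialBound (s + 1) 1 * majorant σ))
    (Ioi_mem_nhds hτ) (Eventually.of_forall fun v => by fun_prop)
    (integrableOn_potential hs one_pos hτ.le 0) (by fun_prop) ?_
    (((integrableOn_majorant.const_mul _).const_mul _).add
      ((integrableOn_majorant.const_mul _).const_mul _)) ?_
  · refine hderiv.2.congr_deriv ?_
    rw [integral_sub, integral_const_mul, integral_const_mul]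
    · rfl
    · exact (integrableOn_potential (by linarith) one_pos hτ.le 0).const_mul _
    · exact (integrableOn_potential (by linarith) one_pos hτ.le 0).const_mul _
  · refine ae_restrict_of_forall_mem measurableSet_Ioi fun σ hσ τ (hτ : 0 < τ) => ?_
    refine (norm_sub_le _ _).trans (add_le_add ?_ ?_)
    · rw [norm_mul, Real.norm_of_nonneg (by norm_num : (0 : ℝ) ≤ 1 / 4)]
      gcongr
      exact norm_radialHeat_mul_lineHeat_le (by linarith) one_pos hτ.le hσ
    · rw [norm_mul, Real.norm_of_nonneg (zero_le_one.trans hs)]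
      gcongr
      exact norm_radialHeat_mul_lineHeat_le (by linarith) one_pos hτ.le hσ
  · refine ae_restrict_of_forall_mem measurableSet_Ioi fun σ (hσ : 0 < σ) τ (hτ : 0 < τ) => ?_
    refine (((hasDerivAt_radialHeat (s := s) (m := 1) (by linarith : 0 < σ + τ)).comp_const_add
      σ τ).mul_const (lineHeat 0 σ)).congr_deriv ?_
    ring

lemma potential_eq_Gamma (hs : 1 / 2 < s) :
    potential s 1 0 0 = 4 ^ (s - 1 / 2) * Real.Gamma (s - 1 / 2) := by
  have hsubst : ∀ x ∈ Ioi (0 : ℝ), (|(-1 : ℝ)| * x ^ ((-1 : ℝ) - 1)) •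
      (radialHeat s 1 (x ^ (-1 : ℝ) + 0) * lineHeat 0 (x ^ (-1 : ℝ))) =
      x ^ (s - 1 / 2 - 1) * Real.exp (-(1 / 4 * x)) := by
    intro x (hx : 0 < x)
    have hexp : -1 / (4 * x⁻¹) = -(1 / 4 * x) := by field_simp
    rw [lineHeat_zero, add_zero, radialHeat, ← Real.rpow_mul hx.le, ← Real.rpow_mul hx.le,
      smul_eq_mul, Real.rpow_neg_one, hexp,
      show s - 1 / 2 - 1 = (-1 - 1) + -1 * -s + -1 * -(1 / 2) by ring,
      Real.rpow_add hx, Real.rpow_add hx, abs_neg, abs_one]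
    ring
  rw [potential, ← integral_comp_rpow_Ioi _ (p := -1) (by norm_num),
    setIntegral_congr_fun measurableSet_Ioi hsubst,
    Real.integral_rpow_mul_exp_neg_mul_Ioi (by linarith) (by norm_num)]
  norm_num

lemma potential_add_one (hs : 1 / 2 < s) :
    potential (s + 1) 1 0 0 = 4 * (s - 1 / 2) * potential s 1 0 0 := by
  rw [potential_eq_Gamma hs, potential_eq_Gamma (by linarith),
    show s + 1 - 1 / 2 = (s - 1 / 2) + 1 by ring, Real.Gamma_add_one (by linarith),
    Real.rpow_add_one (by norm_num)]
  ring

/-- The slopes of `f` on `[0, ε₀]` lie in `[L, 2L]`. -/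
def HasSlopeBounds (f : ℝ → ℝ) (L ε₀ : ℝ) : Prop :=
  ∀ ⦃ε₁ ε₂ : ℝ⦄, 0 ≤ ε₁ → ε₁ ≤ ε₂ → ε₂ ≤ ε₀ →
    L * (ε₂ - ε₁) ≤ f ε₂ - f ε₁ ∧ f ε₂ - f ε₁ ≤ 2 * L * (ε₂ - ε₁)

lemma exists_hasSlopeBounds {f f' : ℝ → ℝ} (hf : ContinuousOn f (Ici 0))
    (hf' : ContinuousOn f' (Ici 0)) (hderiv : ∀ ε > 0, HasDerivAt f (f' ε) ε) (hpos : 0 < f' 0) :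
    ∃ ε₀ > 0, ∃ L > 0, HasSlopeBounds f L ε₀ := by
  have hnear : ∀ᶠ ε in 𝓝[≥] (0 : ℝ), f' ε ∈ Ioo (3 / 4 * f' 0) (3 / 2 * f' 0) :=
    (hf' 0 self_mem_Ici).eventually (Ioo_mem_nhds (by linarith) (by linarith))
  obtain ⟨ε₀, hε₀, hsub⟩ := (mem_nhdsGE_iff_exists_Icc_subset).1 hnear
  refine ⟨ε₀, hε₀, 3 / 4 * f' 0, by linarith, fun ε₁ ε₂ h₁ h₁₂ h₂ => ?_⟩
  rcases h₁₂.eq_or_lt with rfl | hlt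
  · simp
  obtain ⟨ξ, hξ, hslope⟩ := exists_hasDerivAt_eq_slope f f' hlt
    (hf.mono fun y hy => h₁.trans hy.1) (fun y hy => hderiv y (h₁.trans_lt hy.1))
  obtain ⟨hlower, hupper⟩ := hsub ⟨h₁.trans hξ.1.le, hξ.2.le.trans h₂⟩
  rw [eq_div_iff (sub_pos.2 hlt).ne'] at hslope
  rw [← hslope]
  have hlen := (sub_pos.2 hlt).le
  exact ⟨mul_le_mul_of_nonneg_right hlower.le hlen,
    mul_le_mul_of_nonneg_right (by linarith) hlen⟩

lemma exists_hasSlopeBounds_potential (hs : 1 ≤ s) :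
    ∃ ε₀ > 0, ∃ L > 0, HasSlopeBounds (potential s 1 0) L ε₀ := by
  refine exists_hasSlopeBounds (continuousOn_potential_time hs one_pos 0)
    (((continuousOn_potential_time (s := s + 2) (by linarith) one_pos 0).const_mul (1 / 4)).sub
      ((continuousOn_potential_time (s := s + 1) (by linarith) one_pos 0).const_mul s))
    (fun _ => hasDerivAt_potential_time hs) ?_
  have hpos := potential_pos (s := s + 1) (by linarith) one_pos le_rfl 0
  have hrec := potential_add_one (s := s + 1) (by linarith)
  rw [show s + 1 + 1 = s + 2 by ring] at hrec
  rw [Pi.sub_apply, hrec]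
  linarith

lemma HasSlopeBounds.increment_div_sqrt_mono {f : ℝ → ℝ} {L ε₀ ε₁ ε₂ : ℝ}
    (hf : HasSlopeBounds f L ε₀) (hL : 0 ≤ L) (h₁ : 0 < ε₁) (h₁₂ : ε₁ ≤ ε₂) (h₂ : ε₂ ≤ ε₀) :
    (f ε₁ - f 0) / √ε₁ ≤ (f ε₂ - f 0) / √ε₂ := by
  have hupper : f ε₁ - f 0 ≤ 2 * L * ε₁ := by simpa using (hf le_rfl h₁.le (h₁₂.trans h₂)).2
  have hlower := (hf h₁.le h₁₂ h₂).1
  rw [div_le_div_iff₀ (Real.sqrt_pos.2 h₁) (Real.sqrt_pos.2 (h₁.trans_le h₁₂))]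
  obtain ⟨a, ha, rfl⟩ : ∃ a, 0 ≤ a ∧ ε₁ = a ^ 2 := ⟨√ε₁, by positivity, (Real.sq_sqrt h₁.le).symm⟩
  obtain ⟨b, hb, rfl⟩ : ∃ b, 0 ≤ b ∧ ε₂ = b ^ 2 :=
    ⟨√ε₂, by positivity, (Real.sq_sqrt (h₁.le.trans h₁₂)).symm⟩
  rw [Real.sqrt_sq ha, Real.sqrt_sq hb]
  have hab : a ≤ b := (pow_le_pow_iff_left₀ ha hb two_ne_zero).1 h₁₂
  have hab_upper := mul_le_mul_of_nonneg_right hupper (sub_nonneg.2 hab)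
  have hab_lower := mul_le_mul_of_nonneg_right hlower ha
  have hsq : 0 ≤ L * a * (b - a) ^ 2 := by positivity
  linarith

/-- The change of the boundary potential in time `τ`. -/
def potentialIncrement (s m τ : ℝ) : ℝ := potential s m 0 τ - potential s m 0 0

lemma potential_eq_rpow_mul (hm : 0 < m) (hτ : 0 ≤ τ) :
    potential s m 0 τ = m ^ (1 / 2 - s) * potential s 1 0 (τ / m) := by
  simpa using potential_scale (s := s) hm hτ 0

lemma potentialIncrement_eq (hm : 0 < m) (hτ : 0 ≤ τ) :
    potentialIncrement s m τ =
      m ^ (1 / 2 - s) * (potential s 1 0 (τ / m) - potential s 1 0 0) := by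
  rw [potentialIncrement, potential_eq_rpow_mul hm hτ, potential_eq_rpow_mul hm le_rfl, zero_div,
    mul_sub]

lemma potentialIncrement_eq_div_sqrt (hm : 0 < m) (hτ : 0 < τ) :
    potentialIncrement s m τ = m ^ (-s) *
      (√τ * ((potential s 1 0 (τ / m) - potential s 1 0 0) / √(τ / m))) := by
  have hm' : √m ≠ 0 := by positivity
  have hτ' : √τ ≠ 0 := by positivity
  rw [potentialIncrement_eq hm hτ.le, Real.sqrt_div hτ.le,
    show (1 / 2 - s : ℝ) = -s + 1 / 2 by ring, Real.rpow_add hm, ← Real.sqrt_eq_rpow]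
  field_simp

section Increment

variable {L ε₀ : ℝ}

lemma le_potentialIncrement (hslope : HasSlopeBounds (potential s 1 0) L ε₀) (hs : 1 ≤ s)
    (hm : 0 < m) (hτ : 0 ≤ τ) (hε : τ / m ≤ ε₀) :
    L / potential s 1 0 0 * (τ / m) * potential s m 0 0 ≤ potentialIncrement s m τ := by
  have hpos := potential_pos hs one_pos le_rfl 0
  have hlower : L * (τ / m) ≤ potential s 1 0 (τ / m) - potential s 1 0 0 := by
    simpa using (hslope le_rfl (by positivity) hε).1
  rw [potentialIncrement_eq hm hτ, potential_eq_rpow_mul hm le_rfl, zero_div]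
  calc _ = m ^ (1 / 2 - s) * (L * (τ / m)) := by field_simp
    _ ≤ _ := by gcongr

lemma potentialIncrement_le (hslope : HasSlopeBounds (potential s 1 0) L ε₀) (hs : 1 ≤ s)
    (hm : 0 < m) (hτ : 0 ≤ τ) (hε : τ / m ≤ ε₀) :
    potentialIncrement s m τ ≤ 2 * L / potential s 1 0 0 * (τ / m) * potential s m 0 0 := by
  have hpos := potential_pos hs one_pos le_rfl 0
  have hupper : potential s 1 0 (τ / m) - potential s 1 0 0 ≤ 2 * L * (τ / m) := by
    simpa using (hslope le_rfl (by positivity) hε).2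
  rw [potentialIncrement_eq hm hτ, potential_eq_rpow_mul hm le_rfl, zero_div]
  calc _ ≤ m ^ (1 / 2 - s) * (2 * L * (τ / m)) := by gcongr
    _ = _ := by field_simp

lemma potentialIncrement_pos (hslope : HasSlopeBounds (potential s 1 0) L ε₀) (hL : 0 < L)
    (hm : 0 < m) (hτ : 0 < τ) (hε : τ / m ≤ ε₀) :
    0 < potentialIncrement s m τ := by
  have hlower : L * (τ / m) ≤ potential s 1 0 (τ / m) - potential s 1 0 0 := by
    simpa using (hslope le_rfl (by positivity) hε).1
  have hpos : 0 < L * (τ / m) := by positivity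
  rw [potentialIncrement_eq hm hτ.le]
  exact mul_pos (by positivity) (hpos.trans_le hlower)

lemma rpow_mul_potentialIncrement_anti {m' : ℝ}
    (hslope : HasSlopeBounds (potential s 1 0) L ε₀) (hL : 0 ≤ L) (hm : 0 < m) (hmm : m ≤ m')
    (hτ : 0 < τ) (hε : τ / m ≤ ε₀) :
    m' ^ s * potentialIncrement s m' τ ≤ m ^ s * potentialIncrement s m τ := by
  have hm' : 0 < m' := hm.trans_le hmm
  rw [potentialIncrement_eq_div_sqrt hm hτ, potentialIncrement_eq_div_sqrt hm' hτ,
    Real.rpow_neg hm.le, Real.rpow_neg hm'.le, mul_inv_cancel_left₀ (Real.rpow_pos_of_pos hm s).ne',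
    mul_inv_cancel_left₀ (Real.rpow_pos_of_pos hm' s).ne']
  refine mul_le_mul_of_nonneg_left ?_ (Real.sqrt_nonneg τ)
  exact hslope.increment_div_sqrt_mono hL (by positivity) (by gcongr) hε

end Increment

end BoundaryPotential

/-! ### Monotonicity along a coordinate axis -/

/-- The axial component at `x` of the field `v ↦ |v|^(-2κ) v` of a source at axial coordinate `η`
and squared distance `q` from the axis, compensated by the power `x ^ N`. -/
def axisProfile (η q κ N x : ℝ) : ℝ := (x - η) * ((x - η) ^ 2 + q) ^ (-κ) * x ^ N

section AxisProfile

variable {s η q κ N x : ℝ}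

lemma log_axisProfile (hx : 0 < x) (hp : 0 < x - η) (hq : 0 ≤ q) :
    Real.log (axisProfile η q κ N x) =
      Real.log (x - η) - κ * Real.log ((x - η) ^ 2 + q) + N * Real.log x := by
  have hm : 0 < (x - η) ^ 2 + q := by positivity
  rw [axisProfile, Real.log_mul (by positivity) (by positivity),
    Real.log_mul hp.ne' (by positivity), Real.log_rpow hm, Real.log_rpow hx]
  ring

lemma axisProfile_pos (hx : 0 < x) (hp : 0 < x - η) (hq : 0 ≤ q) :
    0 < axisProfile η q κ N x := by
  unfold axisProfile; positivity

lemma hasDerivAt_log_axisProfile (hx : 0 < x) (hp : 0 < x - η) (hq : 0 ≤ q) :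
    HasDerivAt (fun x => Real.log (axisProfile η q κ N x))
      (1 / (x - η) - κ * (2 * (x - η) / ((x - η) ^ 2 + q)) + N * (1 / x)) x := by
  have hsub : HasDerivAt (fun x : ℝ => x - η) 1 x := (hasDerivAt_id x).sub_const η
  have hsq : HasDerivAt (fun x : ℝ => (x - η) ^ 2 + q) (2 * (x - η)) x :=
    ((hsub.pow 2).add_const q).congr_deriv (by simp)
  refine (((hsub.log hp.ne').sub ((hsq.log (by positivity)).const_mul κ)).add
    (((hasDerivAt_id x).log hx.ne').const_mul N)).congr_of_eventuallyEq ?_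
  filter_upwards [lt_mem_nhds hx, lt_mem_nhds (sub_pos.1 hp)] with z hz hzη
  exact log_axisProfile hz (sub_pos.2 hzη) hq

lemma log_deriv_axisProfile_pos (hs : 1 ≤ s) (hx : 8 * s + 4 < x) (hη : |η| ≤ 1) (hq : 0 ≤ q) :
    0 < 1 / (x - η) - (s - 1 / 2) * (2 * (x - η) / ((x - η) ^ 2 + q))
      + (2 * s - 3 / 2) * (1 / x) := by
  obtain ⟨hη1, hη2⟩ := abs_le.1 hη
  have hx0 : 0 < x := by linarith
  have hx1 : 0 < x - 1 := by linarith
  have hp : 0 < x - η := by linarith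
  have hfirst : 1 / (x + 1) ≤ 1 / (x - η) := by gcongr; linarith
  have hquot : 2 * (x - η) / ((x - η) ^ 2 + q) ≤ 2 * (1 / (x - 1)) := by
    rw [mul_one_div, div_le_div_iff₀ (by positivity) hx1]
    nlinarith
  have hsecond : (s - 1 / 2) * (2 * (x - η) / ((x - η) ^ 2 + q)) ≤
      (s - 1 / 2) * (2 * (1 / (x - 1))) := by gcongr; linarith
  have hsplit : 1 / (x + 1) - (s - 1 / 2) * (2 * (1 / (x - 1))) + (2 * s - 3 / 2) * (1 / x) =
      (1 / 2 - 1 / (x + 1) - (2 * s - 1) * (1 / (x - 1))) * (1 / x) := by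
    field_simp; ring
  have hcomm : 1 / (x + 1) ≤ 1 / (x - 1) := one_div_le_one_div_of_le hx1 (by linarith)
  have hlarge : 2 * s * (1 / (x - 1)) < 1 / 2 := by
    rw [mul_one_div, div_lt_iff₀ hx1]; linarith
  have hpos : 0 < (1 / 2 - 1 / (x + 1) - (2 * s - 1) * (1 / (x - 1))) * (1 / x) :=
    mul_pos (by linarith) (by positivity)
  linarith

lemma log_deriv_axisProfile_neg (hs : 1 ≤ s) (hx : 8 * s + 4 < x) (hη : |η| ≤ 1) (hq : 0 ≤ q)
    (hq1 : q ≤ 1) :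
    1 / (x - η) - s * (2 * (x - η) / ((x - η) ^ 2 + q)) + (2 * s - 3 / 2) * (1 / x) < 0 := by
  obtain ⟨hη1, hη2⟩ := abs_le.1 hη
  have hx0 : 0 < x := by linarith
  have hx1 : 0 < x - 1 := by linarith
  have hp : 0 < x - η := by linarith
  have hfirst : 1 / (x - η) ≤ 1 / (x - 1) := one_div_le_one_div_of_le hx1 (by linarith)
  have hquot : 2 * (1 / (x + 2)) ≤ 2 * (x - η) / ((x - η) ^ 2 + q) := by
    rw [mul_one_div, div_le_div_iff₀ (by positivity) (by positivity)]
    nlinarith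
  have hsecond : s * (2 * (1 / (x + 2))) ≤ s * (2 * (x - η) / ((x - η) ^ 2 + q)) := by gcongr
  have hsplit : 1 / (x - 1) - s * (2 * (1 / (x + 2))) + (2 * s - 3 / 2) * (1 / x) =
      -((1 / 2 - 1 / (x - 1) - 4 * s * (1 / (x + 2))) * (1 / x)) := by
    field_simp; ring
  have hcomm : s * (1 / (x + 2)) ≤ s * (1 / (x - 1)) := by gcongr; linarith
  have hlarge : (1 + 4 * s) * (1 / (x - 1)) < 1 / 2 := by
    rw [mul_one_div, div_lt_iff₀ hx1]; linarith
  have hpos : 0 < (1 / 2 - 1 / (x - 1) - 4 * s * (1 / (x + 2))) * (1 / x) :=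
    mul_pos (by linarith) (by positivity)
  linarith

lemma strictMonoOn_axisProfile (hs : 1 ≤ s) (hη : |η| ≤ 1) (hq : 0 ≤ q) :
    StrictMonoOn (axisProfile η q (s - 1 / 2) (2 * s - 3 / 2)) (Ioi (8 * s + 4)) := by
  have hη' := (abs_le.1 hη).2
  have hpos : ∀ x ∈ Ioi (8 * s + 4), 0 < x ∧ 0 < x - η := fun x (hx : _ < x) =>
    ⟨by linarith, by linarith⟩
  have hderiv := fun x hx => hasDerivAt_log_axisProfile (κ := s - 1 / 2) (N := 2 * s - 3 / 2)
    (hpos x hx).1 (hpos x hx).2 hq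
  have hlog : StrictMonoOn (fun x => Real.log (axisProfile η q (s - 1 / 2) (2 * s - 3 / 2) x))
      (Ioi (8 * s + 4)) := by
    refine strictMonoOn_of_deriv_pos (convex_Ioi _)
      (fun x hx => (hderiv x hx).continuousAt.continuousWithinAt) fun x hx => ?_
    rw [interior_Ioi] at hx
    rw [(hderiv x hx).deriv]
    exact log_deriv_axisProfile_pos hs hx hη hq
  exact fun x hx y hy hxy => (Real.log_lt_log_iff (axisProfile_pos (hpos x hx).1 (hpos x hx).2 hq)
    (axisProfile_pos (hpos y hy).1 (hpos y hy).2 hq)).1 (hlog hx hy hxy)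

lemma strictAntiOn_axisProfile (hs : 1 ≤ s) (hη : |η| ≤ 1) (hq : 0 ≤ q) (hq1 : q ≤ 1) :
    StrictAntiOn (axisProfile η q s (2 * s - 3 / 2)) (Ioi (8 * s + 4)) := by
  have hη' := (abs_le.1 hη).2
  have hpos : ∀ x ∈ Ioi (8 * s + 4), 0 < x ∧ 0 < x - η := fun x (hx : _ < x) =>
    ⟨by linarith, by linarith⟩
  have hderiv := fun x hx => hasDerivAt_log_axisProfile (κ := s) (N := 2 * s - 3 / 2)
    (hpos x hx).1 (hpos x hx).2 hq
  have hlog : StrictAntiOn (fun x => Real.log (axisProfile η q s (2 * s - 3 / 2) x))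
      (Ioi (8 * s + 4)) := by
    refine strictAntiOn_of_deriv_neg (convex_Ioi _)
      (fun x hx => (hderiv x hx).continuousAt.continuousWithinAt) fun x hx => ?_
    rw [interior_Ioi] at hx
    rw [(hderiv x hx).deriv]
    exact log_deriv_axisProfile_neg hs hx hη hq hq1
  exact fun x hx y hy hxy => (Real.log_lt_log_iff (axisProfile_pos (hpos y hy).1 (hpos y hy).2 hq)
    (axisProfile_pos (hpos x hx).1 (hpos x hx).2 hq)).1 (hlog hx hy hxy)

end AxisProfile

/-! ### Averages over the support of the boundary data -/

lemma measurable_potential_uncurried (s : ℝ) :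
    Measurable (fun p : ℝ × ℝ × ℝ => potential s p.1 p.2.1 p.2.2) := by
  have hmeas : StronglyMeasurable (fun z : (ℝ × ℝ × ℝ) × ℝ =>
      radialHeat s z.1.1 (z.2 + z.1.2.2) * lineHeat z.1.2.1 z.2) :=
    Measurable.stronglyMeasurable (by fun_prop)
  exact hmeas.integral_prod_right'.measurable

@[fun_prop] lemma measurable_potential {Ω : Type*} [MeasurableSpace Ω] {s : ℝ} {f g h : Ω → ℝ}
    (hf : Measurable f) (hg : Measurable g) (hh : Measurable h) :
    Measurable (fun x => potential s (f x) (g x) (h x)) :=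
  (measurable_potential_uncurried s).comp (hf.prodMk (hg.prodMk hh))

lemma measurable_potentialFlux_uncurried (s : ℝ) :
    Measurable (fun p : ℝ × ℝ × ℝ => potentialFlux s p.1 p.2.1 p.2.2) := by
  have hmeas : StronglyMeasurable (fun z : (ℝ × ℝ × ℝ) × ℝ =>
      radialHeat s z.1.1 (z.2 + z.1.2.2) * passageDensity z.1.2.1 z.2) :=
    Measurable.stronglyMeasurable (by fun_prop)
  exact hmeas.integral_prod_right'.measurable.const_mul _

@[fun_prop] lemma measurable_potentialFlux {Ω : Type*} [MeasurableSpace Ω] {s : ℝ} {f g h : Ω → ℝ}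
    (hf : Measurable f) (hg : Measurable g) (hh : Measurable h) :
    Measurable (fun x => potentialFlux s (f x) (g x) (h x)) :=
  (measurable_potentialFlux_uncurried s).comp (hf.prodMk (hg.prodMk hh))

section Axis

variable {d : ℕ} {i : Fin d} {x : ℝ} {y : Eu d}

lemma norm_axis {k : ℕ} (i : Fin k) : ‖(axis i : Eu k)‖ = 1 := by simp [axis]

lemma norm_sq_smul_axis_sub (i : Fin d) (x : ℝ) (y : Eu d) :
    ‖x • axis i - y‖ ^ 2 = (x - y i) ^ 2 + (‖y‖ ^ 2 - y i ^ 2) := by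
  have hinner : inner ℝ (axis i : Eu d) y = y i := by simp [axis, EuclideanSpace.inner_single_left]
  rw [norm_sub_sq_real, norm_smul, norm_axis, mul_one, real_inner_smul_left, hinner,
    Real.norm_eq_abs, sq_abs]
  ring

lemma abs_coord_le (i : Fin d) (y : Eu d) : |y i| ≤ ‖y‖ := by
  simpa using PiLp.norm_apply_le y i

lemma coord_sq_le (i : Fin d) (y : Eu d) : y i ^ 2 ≤ ‖y‖ ^ 2 :=
  sq_le_sq.2 ((abs_coord_le i y).trans_eq (abs_norm y).symm)

lemma sub_coord_pos (i : Fin d) (hx : 1 < x) (hy : ‖y‖ < 1) : 0 < x - y i := by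
  linarith [abs_le.1 (abs_coord_le i y)]

lemma norm_sq_smul_axis_sub_mem_Icc (i : Fin d) (hx : 1 < x) (hy : ‖y‖ < 1) :
    ‖x • axis i - y‖ ^ 2 ∈ Icc ((x - 1) ^ 2) ((x + 1) ^ 2) := by
  have hnorm : ‖x • (axis i : Eu d)‖ = x := by
    rw [norm_smul, norm_axis, mul_one, Real.norm_of_nonneg (by linarith)]
  have hlower := norm_sub_norm_le (x • axis i) y
  have hupper := norm_sub_le (x • axis i) y
  rw [hnorm] at hlower hupper
  exact ⟨pow_le_pow_left₀ (by linarith) (by linarith) 2,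
    pow_le_pow_left₀ (norm_nonneg _) (by linarith) 2⟩

lemma norm_sq_smul_axis_sub_mono {x₁ x₂ : ℝ} (hx₁ : 1 < x₁) (hx : x₁ ≤ x₂) (hy : ‖y‖ < 1) :
    ‖x₁ • axis i - y‖ ^ 2 ≤ ‖x₂ • axis i - y‖ ^ 2 := by
  have hpos := sub_coord_pos i hx₁ hy
  rw [norm_sq_smul_axis_sub, norm_sq_smul_axis_sub]
  gcongr

end Axis

/-- The spatial factors of the boundary data that are considered: nontrivial nonnegative integrable
functions supported in the unit ball. -/
structure IsSpatialWeight {d : ℕ} (w : Eu d → ℝ) : Prop where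
  integrable : Integrable w
  eq_zero : ∀ y, 1 ≤ ‖y‖ → w y = 0
  nonneg : ∀ y, 0 ≤ w y
  integral_pos : 0 < ∫ y, w y

namespace IsSpatialWeight

variable {d : ℕ} {w : Eu d → ℝ} {G H : Eu d → ℝ}

lemma integrable_mul (hw : IsSpatialWeight w) {C : ℝ} (hG : AEStronglyMeasurable G)
    (hC : ∀ y, ‖y‖ < 1 → |G y| ≤ C) : Integrable (fun y => w y * G y) := by
  refine (hw.integrable.const_mul C).mono' (hw.integrable.aestronglyMeasurable.mul hG)
    (ae_of_all _ fun y => ?_)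
  rcases lt_or_ge ‖y‖ 1 with hy | hy
  · rw [norm_mul, Real.norm_of_nonneg (hw.nonneg y), mul_comm]
    exact mul_le_mul_of_nonneg_right (hC y hy) (hw.nonneg y)
  · simp [hw.eq_zero y hy]

lemma mul_le_mul (hw : IsSpatialWeight w) (hGH : ∀ y, ‖y‖ < 1 → G y ≤ H y) (y : Eu d) :
    w y * G y ≤ w y * H y := by
  rcases lt_or_ge ‖y‖ 1 with hy | hy
  · exact mul_le_mul_of_nonneg_left (hGH y hy) (hw.nonneg y)
  · simp [hw.eq_zero y hy]

lemma integral_mul_le (hw : IsSpatialWeight w) (hG : Integrable (fun y => w y * G y))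
    (hH : Integrable (fun y => w y * H y)) (hGH : ∀ y, ‖y‖ < 1 → G y ≤ H y) :
    ∫ y, w y * G y ≤ ∫ y, w y * H y :=
  integral_mono hG hH (hw.mul_le_mul hGH)

lemma integral_mul_lt (hw : IsSpatialWeight w) (hG : Integrable (fun y => w y * G y))
    (hH : Integrable (fun y => w y * H y)) (hGH : ∀ y, ‖y‖ < 1 → G y < H y) :
    ∫ y, w y * G y < ∫ y, w y * H y := by
  have hnonneg : ∀ y, 0 ≤ w y * H y - w y * G y := fun y =>
    sub_nonneg.2 (hw.mul_le_mul (fun z hz => (hGH z hz).le) y)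
  rw [← sub_pos, ← integral_sub hH hG, integral_pos_iff_support_of_nonneg hnonneg (hH.sub hG)]
  refine ((integral_pos_iff_support_of_nonneg hw.nonneg hw.integrable).1 hw.integral_pos).trans_le
    (measure_mono fun y hwy => ?_)
  have hy : ‖y‖ < 1 := not_le.1 fun hy => hwy (hw.eq_zero y hy)
  rw [Function.mem_support, ← mul_sub]
  exact mul_ne_zero hwy (sub_pos.2 (hGH y hy)).ne'

end IsSpatialWeight

/-- The measurable functions that are bounded away from the origin; these have finite tangential
averages. -/
structure IsRadialKernel (F : ℝ → ℝ) : Prop where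
  measurable : Measurable F
  bounded : ∀ r > 0, ∃ C, ∀ m ≥ r, |F m| ≤ C

namespace IsRadialKernel

variable {F G : ℝ → ℝ}

lemma sub (hF : IsRadialKernel F) (hG : IsRadialKernel G) :
    IsRadialKernel (fun m => F m - G m) where
  measurable := hF.measurable.sub hG.measurable
  bounded r hr := by
    obtain ⟨A, hA⟩ := hF.bounded r hr
    obtain ⟨B, hB⟩ := hG.bounded r hr
    exact ⟨A + B, fun m hm => (abs_sub _ _).trans (add_le_add (hA m hm) (hB m hm))⟩

lemma const_mul (hF : IsRadialKernel F) (c : ℝ) : IsRadialKernel (fun m => c * F m) where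
  measurable := hF.measurable.const_mul c
  bounded r hr := by
    obtain ⟨C, hC⟩ := hF.bounded r hr
    refine ⟨|c| * C, fun m hm => ?_⟩
    rw [abs_mul]
    exact mul_le_mul_of_nonneg_left (hC m hm) (abs_nonneg c)

lemma const (c : ℝ) : IsRadialKernel (fun _ => c) where
  measurable := measurable_const
  bounded _ _ := ⟨|c|, fun _ _ => le_rfl⟩

lemma potential {s τ : ℝ} (hs : 1 ≤ s) (hτ : 0 ≤ τ) (u : ℝ) :
    IsRadialKernel (fun m => potential s m u τ) where
  measurable := by fun_prop
  bounded r hr := ⟨radialBound s r * ∫ σ in Ioi (0 : ℝ), majorant σ, fun m hm => by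
    rw [abs_of_pos (potential_pos hs (hr.trans_le hm) hτ u)]
    exact potential_le hs hr hm hτ u⟩

lemma potentialFlux {s u τ : ℝ} (hs : 1 ≤ s) (hu : 0 < u) (hτ : 0 ≤ τ) :
    IsRadialKernel (fun m => potentialFlux s m u τ) where
  measurable := by fun_prop
  bounded r hr := ⟨potentialFluxBound s r * (u + τ), fun m hm => by
    rw [abs_of_nonneg (potentialFlux_nonneg hτ hu.le)]
    exact potentialFlux_le hs hr hm hτ hu⟩

end IsRadialKernel

section Average

variable {d : ℕ} {w : Eu d → ℝ} {i : Fin d} {F G : ℝ → ℝ} {x u τ : ℝ}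

/-- The `i`-th component at `x • axis i` of the convolution of `w` with the vector field
`z ↦ F(|z|²) z`. -/
def tangentialAverage (w : Eu d → ℝ) (i : Fin d) (F : ℝ → ℝ) (x : ℝ) : ℝ :=
  ∫ y, w y * ((x - y i) * F (‖x • axis i - y‖ ^ 2))

lemma sq_sub_one_pos (hx : 1 < x) : 0 < (x - 1) ^ 2 := pow_pos (sub_pos.2 hx) 2

lemma IsSpatialWeight.integrable_tangentialAverage (hw : IsSpatialWeight w) (hF : IsRadialKernel F)
    (hx : 1 < x) : Integrable (fun y => w y * ((x - y i) * F (‖x • axis i - y‖ ^ 2))) := by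
  obtain ⟨C, hC⟩ := hF.bounded _ (sq_sub_one_pos hx)
  have hmeas : Measurable fun y : Eu d => (x - y i) * F (‖x • axis i - y‖ ^ 2) :=
    (by fun_prop : Measurable fun y : Eu d => x - y i).mul (hF.measurable.comp (by fun_prop))
  refine hw.integrable_mul (C := (x + 1) * C) hmeas.aestronglyMeasurable fun y hy => ?_
  have hcoord := abs_le.1 (abs_coord_le i y)
  rw [abs_mul]
  gcongr
  · exact abs_le.2 ⟨by linarith, by linarith⟩
  · exact hC _ (norm_sq_smul_axis_sub_mem_Icc i hx hy).1

lemma tangentialAverage_sub (hw : IsSpatialWeight w) (hF : IsRadialKernel F)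
    (hG : IsRadialKernel G) (hx : 1 < x) :
    tangentialAverage w i (fun m => F m - G m) x =
      tangentialAverage w i F x - tangentialAverage w i G x := by
  rw [tangentialAverage, tangentialAverage, tangentialAverage, ← integral_sub
    (hw.integrable_tangentialAverage hF hx) (hw.integrable_tangentialAverage hG hx)]
  simp only [mul_sub]

lemma tangentialAverage_const_mul (c : ℝ) :
    tangentialAverage w i (fun m => c * F m) x = c * tangentialAverage w i F x := by
  rw [tangentialAverage, tangentialAverage, ← integral_const_mul]
  congr! 2
  ring

lemma tangentialAverage_mono (hw : IsSpatialWeight w) (hF : IsRadialKernel F)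
    (hG : IsRadialKernel G) (hx : 1 < x)
    (hFG : ∀ m ∈ Icc ((x - 1) ^ 2) ((x + 1) ^ 2), F m ≤ G m) :
    tangentialAverage w i F x ≤ tangentialAverage w i G x :=
  hw.integral_mul_le (hw.integrable_tangentialAverage hF hx) (hw.integrable_tangentialAverage hG hx)
    fun _ hy => mul_le_mul_of_nonneg_left (hFG _ (norm_sq_smul_axis_sub_mem_Icc i hx hy))
      (sub_coord_pos i hx hy).le

lemma tangentialAverage_nonneg (hw : IsSpatialWeight w) (hx : 1 < x) (hF : ∀ m, 0 ≤ F m) :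
    0 ≤ tangentialAverage w i F x := by
  refine integral_nonneg fun y => ?_
  simpa using hw.mul_le_mul (G := 0) (fun z hz => mul_nonneg (sub_coord_pos i hx hz).le
    (hF (‖x • axis i - z‖ ^ 2))) y

lemma tangentialAverage_pos (hw : IsSpatialWeight w) (hF : IsRadialKernel F) (hx : 1 < x)
    (hpos : ∀ m ≥ (x - 1) ^ 2, 0 < F m) : 0 < tangentialAverage w i F x := by
  simpa [tangentialAverage] using hw.integral_mul_lt (G := 0) (by simp)
    (hw.integrable_tangentialAverage hF hx) fun _ hy =>
    mul_pos (sub_coord_pos i hx hy) (hpos _ (norm_sq_smul_axis_sub_mem_Icc i hx hy).1)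

lemma one_le_half_add_one (d : ℕ) : (1 : ℝ) ≤ d / 2 + 1 := by
  linarith [d.cast_nonneg (α := ℝ)]

/-- Up to a constant, the `i`-th derivative at `(x • axis i, 0)` of the Newtonian potential of `w`
after diffusing for the time `τ` in the tangential directions. -/
def tangentialPotential (w : Eu d → ℝ) (i : Fin d) (x τ : ℝ) : ℝ :=
  tangentialAverage w i (fun m => potential ((d : ℝ) / 2 + 1) m 0 τ) x

/-- The negative of the normal derivative corresponding to `tangentialPotential`, at height `u`. -/
def tangentialFlux (w : Eu d → ℝ) (i : Fin d) (x u τ : ℝ) : ℝ :=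
  tangentialAverage w i (fun m => potentialFlux ((d : ℝ) / 2 + 1) m u τ) x

lemma tangentialPotential_pos (hw : IsSpatialWeight w) (hx : 1 < x) (hτ : 0 ≤ τ) :
    0 < tangentialPotential w i x τ :=
  tangentialAverage_pos hw (.potential (one_le_half_add_one d) hτ 0) hx fun _ hm =>
    potential_pos (one_le_half_add_one d) ((sq_sub_one_pos hx).trans_le hm) hτ 0

lemma tangentialFlux_nonneg (hw : IsSpatialWeight w) (hx : 1 < x) (hu : 0 ≤ u) (hτ : 0 ≤ τ) :
    0 ≤ tangentialFlux w i x u τ :=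
  tangentialAverage_nonneg hw hx fun _ => potentialFlux_nonneg hτ hu

lemma exists_tangentialFlux_le (hw : IsSpatialWeight w) (i : Fin d) (hx : 1 < x) :
    ∃ C ≥ 0, ∀ u τ, 0 < u → 0 ≤ τ → tangentialFlux w i x u τ ≤ C * (u + τ) := by
  refine ⟨potentialFluxBound ((d : ℝ) / 2 + 1) ((x - 1) ^ 2) * tangentialAverage w i (fun _ => 1) x,
    mul_nonneg (potentialFluxBound_nonneg _ _)
      (tangentialAverage_nonneg hw hx fun _ => zero_le_one), fun u τ hu hτ => ?_⟩
  rw [mul_right_comm, ← tangentialAverage_const_mul]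
  refine tangentialAverage_mono hw (.potentialFlux (one_le_half_add_one d) hu hτ)
    ((IsRadialKernel.const 1).const_mul _) hx fun m hm => ?_
  rw [mul_one]
  exact potentialFlux_le (one_le_half_add_one d) (sq_sub_one_pos hx) hm.1 hτ hu

lemma exists_tangentialFlux_sub_ge (hw : IsSpatialWeight w) (i : Fin d) (hx : 1 < x) :
    ∃ C ≥ 0, ∀ u τ, 0 < u → 0 ≤ τ →
      -(C * (u * τ)) ≤ tangentialFlux w i x u τ - tangentialFlux w i x u 0 := by
  have hs := one_le_half_add_one d
  refine ⟨potentialFluxDropBound ((d : ℝ) / 2 + 1) ((x - 1) ^ 2) *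
    tangentialAverage w i (fun _ => 1) x, mul_nonneg (potentialFluxDropBound_nonneg (by linarith) _)
      (tangentialAverage_nonneg hw hx fun _ => zero_le_one), fun u τ hu hτ => ?_⟩
  have hkernel {τ : ℝ} (hτ : 0 ≤ τ) := IsRadialKernel.potentialFlux hs hu hτ
  rw [mul_right_comm, ← neg_mul, ← tangentialAverage_const_mul, tangentialFlux, tangentialFlux,
    ← tangentialAverage_sub hw (hkernel hτ) (hkernel le_rfl) hx]
  refine tangentialAverage_mono hw ((IsRadialKernel.const 1).const_mul _)
    ((hkernel hτ).sub (hkernel le_rfl)) hx fun m hm => ?_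
  rw [mul_one]
  exact potentialFlux_sub_ge hs (sq_sub_one_pos hx) hm.1 hτ hu

lemma measurable_integral_mul {Ω : Type*} [MeasurableSpace Ω] {K : Ω → Eu d → ℝ}
    (hw : AEStronglyMeasurable w) (hK : Measurable (Function.uncurry K)) :
    Measurable (fun ω => ∫ y, w y * K ω y) := by
  have hmk : ∀ ω, ∫ y, w y * K ω y = ∫ y, hw.mk w y * K ω y := fun ω =>
    integral_congr_ae (hw.ae_eq_mk.mono fun y hy => congrArg (· * K ω y) hy)
  have hmeas : StronglyMeasurable fun z : Ω × Eu d => hw.mk w z.2 * K z.1 z.2 :=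
    ((hw.stronglyMeasurable_mk.measurable.comp measurable_snd).mul hK).stronglyMeasurable
  simpa only [hmk] using hmeas.integral_prod_right'.measurable

lemma measurable_tangentialPotential (hw : IsSpatialWeight w) (i : Fin d) (x : ℝ) :
    Measurable (tangentialPotential w i x) :=
  measurable_integral_mul hw.integrable.aestronglyMeasurable (by fun_prop)

lemma measurable_tangentialFlux (hw : IsSpatialWeight w) (i : Fin d) (x : ℝ) :
    Measurable (Function.uncurry (tangentialFlux w i x)) :=
  measurable_integral_mul (K := fun p : ℝ × ℝ => _) hw.integrable.aestronglyMeasurable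
    (by fun_prop)

end Average

/-! ### Dependence of the diffused potential on the distance -/

section TangentialRatio

variable {d : ℕ} {w : Eu d → ℝ} {i : Fin d} {F : ℝ → ℝ} {c₁ c₂ x x₁ x₂ ε L τ m : ℝ}

lemma tangentialAverage_mul_lt (hw : IsSpatialWeight w) (hF : IsRadialKernel F) (hx₁ : 1 < x₁)
    (hx₂ : 1 < x₂) (hlt : ∀ y : Eu d, ‖y‖ < 1 → (x₁ - y i) * F (‖x₁ • axis i - y‖ ^ 2) * c₁ <
      (x₂ - y i) * F (‖x₂ • axis i - y‖ ^ 2) * c₂) :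
    tangentialAverage w i F x₁ * c₁ < tangentialAverage w i F x₂ * c₂ := by
  rw [tangentialAverage, tangentialAverage, ← integral_mul_const, ← integral_mul_const]
  simp_rw [mul_assoc (w _)]
  refine hw.integral_mul_lt ?_ ?_ hlt
  · simpa only [mul_assoc] using (hw.integrable_tangentialAverage hF hx₁).mul_const c₁
  · simpa only [mul_assoc] using (hw.integrable_tangentialAverage hF hx₂).mul_const c₂

lemma tangentialAverage_mul_le (hw : IsSpatialWeight w) (hF : IsRadialKernel F) (hx₁ : 1 < x₁)
    (hx₂ : 1 < x₂) (hle : ∀ y : Eu d, ‖y‖ < 1 → (x₁ - y i) * F (‖x₁ • axis i - y‖ ^ 2) * c₁ ≤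
      (x₂ - y i) * F (‖x₂ • axis i - y‖ ^ 2) * c₂) :
    tangentialAverage w i F x₁ * c₁ ≤ tangentialAverage w i F x₂ * c₂ := by
  rw [tangentialAverage, tangentialAverage, ← integral_mul_const, ← integral_mul_const]
  simp_rw [mul_assoc (w _)]
  refine hw.integral_mul_le ?_ ?_ hle
  · simpa only [mul_assoc] using (hw.integrable_tangentialAverage hF hx₁).mul_const c₁
  · simpa only [mul_assoc] using (hw.integrable_tangentialAverage hF hx₂).mul_const c₂

/-- The part of `tangentialPotential` that has been gained by diffusing for the time `τ`. -/
def tangentialIncrement (w : Eu d → ℝ) (i : Fin d) (x τ : ℝ) : ℝ :=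
  tangentialAverage w i (fun m => potentialIncrement ((d : ℝ) / 2 + 1) m τ) x

lemma IsRadialKernel.potentialIncrement {s : ℝ} (hs : 1 ≤ s) (hτ : 0 ≤ τ) :
    IsRadialKernel (fun m => potentialIncrement s m τ) :=
  (IsRadialKernel.potential hs hτ 0).sub (.potential hs le_rfl 0)

lemma tangentialIncrement_eq (hw : IsSpatialWeight w) (hx : 1 < x) (hτ : 0 ≤ τ) :
    tangentialIncrement w i x τ = tangentialPotential w i x τ - tangentialPotential w i x 0 :=
  have hs := one_le_half_add_one d
  tangentialAverage_sub hw (.potential hs hτ 0) (.potential hs le_rfl 0) hx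

lemma tangentialPotential_mul_rpow_lt (hw : IsSpatialWeight w)
    (hx₁ : 8 * ((d : ℝ) / 2 + 1) + 4 < x₁) (hx : x₁ < x₂) :
    tangentialPotential w i x₁ 0 * x₁ ^ (2 * ((d : ℝ) / 2 + 1) - 3 / 2) <
      tangentialPotential w i x₂ 0 * x₂ ^ (2 * ((d : ℝ) / 2 + 1) - 3 / 2) := by
  have hs := one_le_half_add_one d
  have hx₁' : 1 < x₁ := by linarith
  have hx₂' : 1 < x₂ := hx₁'.trans hx
  refine tangentialAverage_mul_lt hw (.potential hs le_rfl 0) hx₁' hx₂' fun y hy => ?_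
  have hprofile := strictMonoOn_axisProfile hs ((abs_coord_le i y).trans hy.le)
    (sub_nonneg.2 (coord_sq_le i y)) hx₁ (hx₁.trans hx) hx
  have hm {x : ℝ} (hx : 1 < x) : 0 < ‖x • axis i - y‖ ^ 2 :=
    (sq_sub_one_pos hx).trans_le (norm_sq_smul_axis_sub_mem_Icc i hx hy).1
  rw [axisProfile, axisProfile, neg_sub, ← norm_sq_smul_axis_sub, ← norm_sq_smul_axis_sub]
    at hprofile
  rw [potential_eq_rpow_mul (hm hx₁') le_rfl, potential_eq_rpow_mul (hm hx₂') le_rfl, zero_div,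
    zero_div]
  calc _ = _ := by ring
    _ < _ := mul_lt_mul_of_pos_right hprofile (potential_pos hs one_pos le_rfl 0)
    _ = _ := by ring

lemma div_le_of_sq_sub_one_le (hε : 0 < ε) (hx : 2 + 2 / ε < x) (hτ : τ ≤ 2)
    (hm : (x - 1) ^ 2 ≤ m) : τ / m ≤ ε := by
  have hquot : 0 < 2 / ε := by positivity
  have hm' : 2 / ε ≤ m := by nlinarith
  rw [div_le_comm₀ (hquot.trans_le hm') hε]
  exact (div_le_div_of_nonneg_right hτ hε.le).trans hm'

lemma le_tangentialIncrement
    (hslope : HasSlopeBounds (potential ((d : ℝ) / 2 + 1) 1 0) L ε) (hw : IsSpatialWeight w)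
    (hL : 0 ≤ L) (hε : 0 < ε) (hx : 2 + 2 / ε < x) (hτ : τ ∈ Icc (0 : ℝ) 2) :
    L / potential ((d : ℝ) / 2 + 1) 1 0 0 * (τ / (x + 1) ^ 2) * tangentialPotential w i x 0 ≤
      tangentialIncrement w i x τ := by
  have hs := one_le_half_add_one d
  have hx1 : 1 < x := by linarith [div_pos two_pos hε]
  rw [tangentialPotential, ← tangentialAverage_const_mul]
  refine tangentialAverage_mono hw ((IsRadialKernel.potential hs le_rfl 0).const_mul _)
    (.potentialIncrement hs hτ.1) hx1 fun m hm => ?_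
  have hm0 := (sq_sub_one_pos hx1).trans_le hm.1
  have hpos {m : ℝ} (hm : 0 < m) := potential_pos hs hm le_rfl 0
  have hpos₁ := hpos one_pos
  have hposm := hpos hm0
  have hτ0 := hτ.1
  refine le_trans ?_ (le_potentialIncrement hslope hs hm0 hτ.1
    (div_le_of_sq_sub_one_le hε hx hτ.2 hm.1))
  gcongr
  exact hm.2

lemma tangentialIncrement_le
    (hslope : HasSlopeBounds (potential ((d : ℝ) / 2 + 1) 1 0) L ε) (hw : IsSpatialWeight w)
    (hL : 0 ≤ L) (hε : 0 < ε) (hx : 2 + 2 / ε < x) (hτ : τ ∈ Icc (0 : ℝ) 2) :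
    tangentialIncrement w i x τ ≤
      2 * L / potential ((d : ℝ) / 2 + 1) 1 0 0 * (τ / (x - 1) ^ 2) *
        tangentialPotential w i x 0 := by
  have hs := one_le_half_add_one d
  have hx1 : 1 < x := by linarith [div_pos two_pos hε]
  rw [tangentialPotential, ← tangentialAverage_const_mul]
  refine tangentialAverage_mono hw (.potentialIncrement hs hτ.1)
    ((IsRadialKernel.potential hs le_rfl 0).const_mul _) hx1 fun m hm => ?_
  have hsq := sq_sub_one_pos hx1
  have hm0 := hsq.trans_le hm.1
  have hpos {m : ℝ} (hm : 0 < m) := potential_pos hs hm le_rfl 0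
  have hpos₁ := hpos one_pos
  have hposm := hpos hm0
  have hτ0 := hτ.1
  refine (potentialIncrement_le hslope hs hm0 hτ.1
    (div_le_of_sq_sub_one_le hε hx hτ.2 hm.1)).trans ?_
  gcongr
  exact hm.1

lemma tangentialIncrement_pos
    (hslope : HasSlopeBounds (potential ((d : ℝ) / 2 + 1) 1 0) L ε) (hw : IsSpatialWeight w)
    (hL : 0 < L) (hε : 0 < ε)
    (hx : 2 + 2 / ε < x) (hτ : τ ∈ Ioc (0 : ℝ) 2) : 0 < tangentialIncrement w i x τ := by
  have hx1 : 1 < x := by linarith [div_pos two_pos hε]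
  exact tangentialAverage_pos hw (.potentialIncrement (one_le_half_add_one d) hτ.1.le) hx1
    fun m hm => potentialIncrement_pos hslope hL ((sq_sub_one_pos hx1).trans_le hm) hτ.1
      (div_le_of_sq_sub_one_le hε hx hτ.2 hm)

lemma tangentialIncrement_mul_rpow_le
    (hslope : HasSlopeBounds (potential ((d : ℝ) / 2 + 1) 1 0) L ε) (hw : IsSpatialWeight w)
    (hL : 0 < L) (hε : 0 < ε)
    (hx₁ : 8 * ((d : ℝ) / 2 + 1) + 4 < x₁) (hx₁' : 2 + 2 / ε < x₁) (hx : x₁ < x₂)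
    (hτ : τ ∈ Ioc (0 : ℝ) 2) :
    tangentialIncrement w i x₂ τ * x₂ ^ (2 * ((d : ℝ) / 2 + 1) - 3 / 2) ≤
      tangentialIncrement w i x₁ τ * x₁ ^ (2 * ((d : ℝ) / 2 + 1) - 3 / 2) := by
  have hs := one_le_half_add_one d
  have h1x₁ : 1 < x₁ := by linarith
  have h1x₂ : 1 < x₂ := h1x₁.trans hx
  refine tangentialAverage_mul_le hw (.potentialIncrement hs hτ.1.le) h1x₂ h1x₁ fun y hy => ?_
  have hq1 : ‖y‖ ^ 2 - y i ^ 2 ≤ 1 := by nlinarith [norm_nonneg y, sq_nonneg (y i)]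
  have hprofile := strictAntiOn_axisProfile hs ((abs_coord_le i y).trans hy.le)
    (sub_nonneg.2 (coord_sq_le i y)) hq1 hx₁ (hx₁.trans hx) hx
  have hm₁ := (norm_sq_smul_axis_sub_mem_Icc i h1x₁ hy).1
  have hm₁' := (sq_sub_one_pos h1x₁).trans_le hm₁
  have hm₁₂ := norm_sq_smul_axis_sub_mono (i := i) h1x₁ hx.le hy
  have hsmall {m : ℝ} (hm : ‖x₁ • axis i - y‖ ^ 2 ≤ m) : τ / m ≤ ε :=
    div_le_of_sq_sub_one_le hε hx₁' hτ.2 (hm₁.trans hm)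
  have hanti := rpow_mul_potentialIncrement_anti hslope hL.le hm₁' hm₁₂ hτ.1 (hsmall le_rfl)
  have hpos := potentialIncrement_pos hslope hL (hm₁'.trans_le hm₁₂) hτ.1 (hsmall hm₁₂)
  have hcoord := sub_coord_pos i h1x₁ hy
  rw [axisProfile, axisProfile, ← norm_sq_smul_axis_sub, ← norm_sq_smul_axis_sub] at hprofile
  generalize ‖x₁ • axis i - y‖ ^ 2 = m₁ at *
  generalize ‖x₂ • axis i - y‖ ^ 2 = m₂ at *
  have hm₂' := hm₁'.trans_le hm₁₂
  have hcancel {m : ℝ} (hm : 0 < m) : m ^ (-((d : ℝ) / 2 + 1)) * m ^ ((d : ℝ) / 2 + 1) = 1 := by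
    rw [← Real.rpow_add hm, neg_add_cancel, Real.rpow_zero]
  calc (x₂ - y i) * potentialIncrement _ m₂ τ * x₂ ^ (2 * ((d : ℝ) / 2 + 1) - 3 / 2)
      = (x₂ - y i) * m₂ ^ (-((d : ℝ) / 2 + 1)) * x₂ ^ (2 * ((d : ℝ) / 2 + 1) - 3 / 2) *
          (m₂ ^ ((d : ℝ) / 2 + 1) * potentialIncrement _ m₂ τ) := by
        linear_combination -((x₂ - y i) * potentialIncrement _ m₂ τ *
          x₂ ^ (2 * ((d : ℝ) / 2 + 1) - 3 / 2)) * hcancel hm₂'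
    _ ≤ (x₁ - y i) * m₁ ^ (-((d : ℝ) / 2 + 1)) * x₁ ^ (2 * ((d : ℝ) / 2 + 1) - 3 / 2) *
          (m₁ ^ ((d : ℝ) / 2 + 1) * potentialIncrement _ m₁ τ) := by gcongr
    _ = _ := by
        linear_combination ((x₁ - y i) * potentialIncrement _ m₁ τ *
          x₁ ^ (2 * ((d : ℝ) / 2 + 1) - 3 / 2)) * hcancel hm₁'

/-- The factor by which diffusion for the time `τ` changes the tangential derivative of the boundary
potential at `x • axis i`. -/
def tangentialRatio (w : Eu d → ℝ) (i : Fin d) (x τ : ℝ) : ℝ :=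
  tangentialPotential w i x τ / tangentialPotential w i x 0

lemma tangentialRatio_sub_one (hw : IsSpatialWeight w) (hx : 1 < x) (hτ : 0 ≤ τ) :
    tangentialRatio w i x τ - 1 = tangentialIncrement w i x τ / tangentialPotential w i x 0 := by
  rw [tangentialRatio, tangentialIncrement_eq hw hx hτ, sub_div,
    div_self (tangentialPotential_pos hw hx le_rfl).ne']

lemma tangentialRatio_lt (hslope : HasSlopeBounds (potential ((d : ℝ) / 2 + 1) 1 0) L ε)
    (hw : IsSpatialWeight w) (hL : 0 < L) (hε : 0 < ε)
    (hx₁ : 8 * ((d : ℝ) / 2 + 1) + 4 < x₁) (hx₁' : 2 + 2 / ε < x₁) (hx : x₁ < x₂)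
    (hτ : τ ∈ Ioc (0 : ℝ) 2) : tangentialRatio w i x₂ τ < tangentialRatio w i x₁ τ := by
  have h1x₁ : 1 < x₁ := by linarith [one_le_half_add_one d]
  have h1x₂ := h1x₁.trans hx
  have hpow {x : ℝ} (hx : 1 < x) : 0 < x ^ (2 * ((d : ℝ) / 2 + 1) - 3 / 2) :=
    Real.rpow_pos_of_pos (by linarith) _
  have hpos₁ := tangentialPotential_pos (i := i) hw h1x₁ le_rfl
  have hpos₂ := tangentialPotential_pos (i := i) hw h1x₂ le_rfl
  rw [← sub_lt_sub_iff_right 1, tangentialRatio_sub_one hw h1x₁ hτ.1.le,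
    tangentialRatio_sub_one hw h1x₂ hτ.1.le,
    ← mul_div_mul_right _ (tangentialPotential w i x₁ 0) (hpow h1x₁).ne',
    ← mul_div_mul_right _ (tangentialPotential w i x₂ 0) (hpow h1x₂).ne']
  exact div_lt_div₀' (tangentialIncrement_mul_rpow_le hslope hw hL hε hx₁ hx₁' hx hτ)
    (tangentialPotential_mul_rpow_lt hw hx₁ hx)
    (mul_pos (tangentialIncrement_pos hslope hw hL hε hx₁' hτ) (hpow h1x₁))
    (mul_pos hpos₁ (hpow h1x₁))

end TangentialRatio

/-- The properties of the ratios `τ ↦ tangentialRatio w i x τ`, `x > c`, that determine the reversal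
of the wall shear: they start at `1`, grow at a linear rate of order `x ^ (-2)`, and decrease in
`x`. -/
structure IsRatioFamily (ρ : ℝ → ℝ → ℝ) (c B : ℝ) : Prop where
  measurable : ∀ x > c, Measurable (ρ x)
  map_zero : ∀ x > c, ρ x 0 = 1
  exists_le_sub_one : ∀ x > c, ∃ e > 0, ∀ τ ∈ Icc (0 : ℝ) 2, e * τ ≤ ρ x τ - 1
  sub_one_le : ∀ x > c, ∀ τ ∈ Icc (0 : ℝ) 2, ρ x τ - 1 ≤ B / (x - 1) ^ 2 * τ
  sub_one_le_half : ∀ x > c, ∀ τ ∈ Icc (0 : ℝ) 2, ρ x τ - 1 ≤ 1 / 2 * τ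
  strictAntiOn : ∀ τ ∈ Ioc (0 : ℝ) 2, StrictAntiOn (fun x => ρ x τ) (Ioi c)

lemma exists_isRatioFamily_tangentialRatio (d : ℕ) : ∃ c B : ℝ, 1 < c ∧
    ∀ w : Eu d → ℝ, IsSpatialWeight w → ∀ i, IsRatioFamily (tangentialRatio w i) c B := by
  have hs := one_le_half_add_one d
  obtain ⟨ε, hε, L, hL, hslope⟩ := exists_hasSlopeBounds_potential hs
  have hbase := potential_pos hs one_pos le_rfl 0
  set B : ℝ := 2 * L / potential ((d : ℝ) / 2 + 1) 1 0 0
  have hB : 0 < B := by positivity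
  set c : ℝ := max (8 * ((d : ℝ) / 2 + 1) + 4) (max (2 + 2 / ε) (1 + (1 + 2 * B)))
  have hc₁ : 8 * ((d : ℝ) / 2 + 1) + 4 ≤ c := le_max_left _ _
  have hc₂ : 2 + 2 / ε ≤ c := (le_max_left _ _).trans (le_max_right _ _)
  have hc₃ : 1 + (1 + 2 * B) ≤ c := (le_max_right _ _).trans (le_max_right _ _)
  have hc : 1 < c := by linarith
  refine ⟨c, B, hc, fun w hw i => ?_⟩
  have hpos {x : ℝ} (hx : c < x) := tangentialPotential_pos (i := i) hw (hc.trans hx) le_rfl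
  have hupper : ∀ x > c, ∀ τ ∈ Icc (0 : ℝ) 2,
      tangentialRatio w i x τ - 1 ≤ B / (x - 1) ^ 2 * τ := fun x hx τ hτ => by
    rw [tangentialRatio_sub_one hw (hc.trans hx) hτ.1, div_le_iff₀ (hpos hx), div_mul_eq_mul_div,
      ← mul_div_assoc']
    exact tangentialIncrement_le hslope hw hL.le hε (hc₂.trans_lt hx) hτ
  refine ⟨fun x _ => (measurable_tangentialPotential hw i x).div_const _,
    fun x hx => div_self (hpos hx).ne', fun x hx => ?_, hupper, fun x hx τ hτ => ?_,
    fun τ hτ x₁ hx₁ x₂ _ hx => tangentialRatio_lt hslope hw hL hε (hc₁.trans_lt hx₁)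
      (hc₂.trans_lt hx₁) hx hτ⟩
  · have hx0 : 0 < x + 1 := by linarith
    refine ⟨L / potential ((d : ℝ) / 2 + 1) 1 0 0 / (x + 1) ^ 2, by positivity, fun τ hτ => ?_⟩
    rw [tangentialRatio_sub_one hw (hc.trans hx) hτ.1, le_div_iff₀ (hpos hx), div_mul_eq_mul_div,
      ← mul_div_assoc']
    exact le_tangentialIncrement hslope hw hL.le hε (hc₂.trans_lt hx) hτ
  · refine (hupper x hx τ hτ).trans (mul_le_mul_of_nonneg_right ?_ hτ.1)
    rw [div_le_iff₀ (sq_sub_one_pos (hc.trans hx))]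
    nlinarith

/-! ### Behaviour near the wall -/

/-- Normalization of the first passage density: `passageConst * passageDensity u` is a probability
density on `(0, ∞)` for every `u > 0`. -/
def passageConst : ℝ := 1 / (2 * √Real.pi)

lemma passageConst_pos : 0 < passageConst := by
  unfold passageConst; have := Real.pi_pos; positivity

lemma passageConst_mul_integral {u : ℝ} (hu : 0 < u) :
    passageConst * ∫ σ in Ioi (0 : ℝ), passageDensity u σ = 1 := by
  have : √Real.pi ≠ 0 := by have := Real.pi_pos; positivity
  rw [integral_passageDensity hu, passageConst]
  field_simp

section PassageIntegrals

variable {t v τ δ : ℝ}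

lemma rpow_neg_three_halves_mul_self (hτ : 0 < τ) :
    τ ^ (-(3 / 2) : ℝ) * τ = τ ^ (-(1 / 2) : ℝ) := by
  rw [← Real.rpow_add_one hτ.ne']; norm_num

lemma integrableOn_Ioc_rpow {s : ℝ} (hs : -1 < s) (t : ℝ) :
    IntegrableOn (fun τ : ℝ => τ ^ s) (Ioc 0 t) := by
  rcases le_or_gt 0 t with h | h
  · exact (intervalIntegrable_iff_integrableOn_Ioc_of_le h).1
      (intervalIntegral.intervalIntegrable_rpow' hs)
  · rw [Ioc_eq_empty (not_lt.2 h.le)]; exact integrableOn_empty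

lemma integrableOn_Ioc_sub_rpow {s : ℝ} (hs : -1 < s) (t : ℝ) :
    IntegrableOn (fun u : ℝ => (t - u) ^ s) (Ioc 0 t) := by
  rcases le_or_gt 0 t with h | h
  · rw [← intervalIntegrable_iff_integrableOn_Ioc_of_le h]
    simpa using
      (intervalIntegral.intervalIntegrable_rpow' (a := t) (b := 0) hs).comp_sub_left t
  · rw [Ioc_eq_empty (not_lt.2 h.le)]; exact integrableOn_empty

lemma integral_Ioc_rpow_neg_half (ht : 0 ≤ t) :
    ∫ τ in Ioc 0 t, τ ^ (-(1 / 2) : ℝ) = 2 * √t := by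
  rw [← intervalIntegral.integral_of_le ht, integral_rpow (Or.inl (by norm_num)),
    Real.sqrt_eq_rpow]
  norm_num
  ring

lemma passageDensity_zero_left : passageDensity 0 = fun _ => 0 := by
  ext τ; simp [passageDensity]

lemma passageDensity_mul_le (hv : 0 ≤ v) (hτ : 0 < τ) :
    passageDensity v τ * τ ≤ v * τ ^ (-(1 / 2) : ℝ) := by
  rw [← rpow_neg_three_halves_mul_self hτ, ← mul_assoc]
  gcongr
  exact passageDensity_le hv hτ.le

lemma integrableOn_passageDensity_mul (hv : 0 ≤ v) (t : ℝ) :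
    IntegrableOn (fun τ => passageDensity v τ * τ) (Ioc 0 t) := by
  refine Integrable.mono' ((integrableOn_Ioc_rpow (s := -(1 / 2)) (by norm_num) t).const_mul v)
    (Measurable.aestronglyMeasurable (by fun_prop))
    (ae_restrict_of_forall_mem measurableSet_Ioc fun τ hτ => ?_)
  rw [Real.norm_of_nonneg (mul_nonneg (passageDensity_nonneg hv hτ.1.le) hτ.1.le)]
  exact passageDensity_mul_le hv hτ.1

lemma integral_passageDensity_mul_le (hv : 0 ≤ v) (ht : 0 ≤ t) (ht2 : t ≤ 2) :
    ∫ τ in Ioc 0 t, passageDensity v τ * τ ≤ 4 * v := by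
  have hsqrt : √t ≤ 2 := by
    rw [Real.sqrt_le_left (by norm_num)]; linarith
  calc ∫ τ in Ioc 0 t, passageDensity v τ * τ ≤ ∫ τ in Ioc 0 t, v * τ ^ (-(1 / 2) : ℝ) :=
        setIntegral_mono_on (integrableOn_passageDensity_mul hv t)
          ((integrableOn_Ioc_rpow (by norm_num) t).const_mul v) measurableSet_Ioc
          fun τ hτ => passageDensity_mul_le hv hτ.1
    _ = 2 * √t * v := by rw [integral_const_mul, integral_Ioc_rpow_neg_half ht, mul_comm]
    _ ≤ 4 * v := by gcongr; linarith

lemma integrableOn_Ioc_passageDensity (hv : 0 ≤ v) (t : ℝ) :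
    IntegrableOn (passageDensity v) (Ioc 0 t) := by
  rcases hv.eq_or_lt with rfl | h
  · rw [passageDensity_zero_left]; exact integrableOn_zero
  · exact (integrableOn_passageDensity h).mono_set Ioc_subset_Ioi_self

lemma passageConst_mul_integral_Ioc_le (hv : 0 ≤ v) (t : ℝ) :
    passageConst * ∫ τ in Ioc 0 t, passageDensity v τ ≤ 1 := by
  rcases hv.eq_or_lt with rfl | h
  · simp [passageDensity_zero_left]
  · rw [← passageConst_mul_integral h]
    refine mul_le_mul_of_nonneg_left ?_ passageConst_pos.le
    exact setIntegral_mono_set (integrableOn_passageDensity h)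
      (ae_restrict_of_forall_mem measurableSet_Ioi fun τ hτ =>
        passageDensity_nonneg hv (le_of_lt hτ)) Ioc_subset_Ioi_self.eventuallyLE

lemma integral_Ioi_passageDensity_le (hv : 0 < v) (hδ : 0 < δ) :
    ∫ τ in Ioi δ, passageDensity v τ ≤ v * (2 / √δ) := by
  calc ∫ τ in Ioi δ, passageDensity v τ ≤ ∫ τ in Ioi δ, v * τ ^ (-(3 / 2) : ℝ) :=
        setIntegral_mono_on ((integrableOn_passageDensity hv).mono_set (Ioi_subset_Ioi hδ.le))
          ((integrableOn_Ioi_rpow_of_lt (by norm_num) hδ).const_mul _) measurableSet_Ioi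
          fun τ hτ => passageDensity_le hv.le (hδ.le.trans (le_of_lt hτ))
    _ = v * (2 / √δ) := by
        rw [integral_const_mul, integral_Ioi_rpow_of_lt (by norm_num) hδ, Real.sqrt_eq_rpow,
          show (-(3 / 2) + 1 : ℝ) = -(1 / 2) by norm_num, Real.rpow_neg hδ.le]
        field_simp

lemma le_passageConst_mul_integral_Ioc (hv : 0 < v) (hδ : 0 < δ) :
    1 - passageConst * (v * (2 / √δ)) ≤ passageConst * ∫ τ in Ioc 0 δ, passageDensity v τ := by
  have htotal := passageConst_mul_integral hv
  rw [← Ioc_union_Ioi_eq_Ioi hδ.le, setIntegral_union (Ioc_disjoint_Ioi le_rfl)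
    measurableSet_Ioi (integrableOn_Ioc_passageDensity hv.le δ)
    ((integrableOn_passageDensity hv).mono_set (Ioi_subset_Ioi hδ.le))] at htotal
  linarith [mul_le_mul_of_nonneg_left (integral_Ioi_passageDensity_le hv hδ) passageConst_pos.le]

end PassageIntegrals

/-- A temporal profile that vanishes at nonpositive times and is Lipschitz before time `2`. -/
structure IsLipschitzProfile (φ : ℝ → ℝ) (Λ : ℝ) : Prop where
  eq_zero : ∀ s ≤ 0, φ s = 0
  abs_sub_le : ∀ s < 2, ∀ s' < 2, |φ s - φ s'| ≤ Λ * |s - s'|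

namespace IsLipschitzProfile

variable {φ : ℝ → ℝ} {Λ s t : ℝ}

lemma const_nonneg (hφ : IsLipschitzProfile φ Λ) : 0 ≤ Λ := by
  simpa using (abs_nonneg _).trans (hφ.abs_sub_le 0 (by norm_num) 1 (by norm_num))

lemma abs_le (hφ : IsLipschitzProfile φ Λ) (hs : s < 2) : |φ s| ≤ 2 * Λ := by
  have hΛ := hφ.const_nonneg
  rcases le_or_gt s 0 with h | h
  · rw [hφ.eq_zero s h, abs_zero]; positivity
  · have := hφ.abs_sub_le s hs 0 (by norm_num)
    rw [hφ.eq_zero 0 le_rfl, sub_zero, sub_zero, abs_of_pos h] at this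
    nlinarith

lemma continuousOn (hφ : IsLipschitzProfile φ Λ) : ContinuousOn φ (Iio 2) := by
  have hlip : LipschitzOnWith (Real.toNNReal Λ) φ (Iio 2) :=
    LipschitzOnWith.of_dist_le_mul fun s hs s' hs' => by
      rw [Real.coe_toNNReal _ hφ.const_nonneg, Real.dist_eq, Real.dist_eq]
      exact hφ.abs_sub_le s hs s' hs'
  exact hlip.continuousOn

lemma aestronglyMeasurable_shift (hφ : IsLipschitzProfile φ Λ) (ht2 : t < 2) {S : Set ℝ}
    (hS : MeasurableSet S) (hS0 : S ⊆ Ioi 0) :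
    AEStronglyMeasurable (fun τ => φ (t - τ)) (volume.restrict S) := by
  refine (ContinuousOn.comp hφ.continuousOn (by fun_prop) fun τ hτ => ?_).aestronglyMeasurable hS
  have : 0 < τ := hS0 hτ
  exact mem_Iio.2 (by linarith)

end IsLipschitzProfile

/-- A factor modulating a temporal profile: it equals `1` at `τ = 0`, to first order. -/
structure IsModulation (ρ : ℝ → ℝ) (B : ℝ) : Prop where
  measurable : Measurable ρ
  map_zero : ρ 0 = 1
  abs_sub_one_le : ∀ τ ∈ Icc (0 : ℝ) 2, |ρ τ - 1| ≤ B * τ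

lemma isModulation_one : IsModulation (fun _ => 1) 0 := ⟨measurable_const, rfl, by simp⟩

lemma IsModulation.const_nonneg {ρ : ℝ → ℝ} {B : ℝ} (hρ : IsModulation ρ B) : 0 ≤ B := by
  have := (abs_nonneg _).trans (hρ.abs_sub_one_le 2 (by norm_num))
  linarith

/-- The flux of the tangential potential at height `u` above the wall: it is nonnegative and
vanishes at the wall at time `0`. -/
structure IsWallFlux (α : ℝ → ℝ → ℝ) (C : ℝ) : Prop where
  measurable : Measurable (Function.uncurry α)
  nonneg : ∀ u τ, 0 < u → 0 ≤ τ → 0 ≤ α u τ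
  le_mul_add : ∀ u τ, 0 < u → 0 ≤ τ → α u τ ≤ C * (u + τ)

lemma IsWallFlux.const_nonneg {α : ℝ → ℝ → ℝ} {C : ℝ} (hα : IsWallFlux α C) : 0 ≤ C := by
  simpa using (hα.nonneg 1 0 one_pos le_rfl).trans (hα.le_mul_add 1 0 one_pos le_rfl)

/-- The integrand `τ^{-3/2} (φ(t) - φ(t - τ) ρ(τ))` of the wall shear. -/
def shearIntegrand (φ ρ : ℝ → ℝ) (t τ : ℝ) : ℝ := τ ^ (-(3 / 2) : ℝ) * (φ t - φ (t - τ) * ρ τ)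

/-- The normal derivative of the tangential velocity at the wall, up to a positive constant. For
`ρ = 1` it is `M φ`. -/
def wallShear (φ ρ : ℝ → ℝ) (t : ℝ) : ℝ := ∫ τ in Ioi (0 : ℝ), shearIntegrand φ ρ t τ

/-- The wall shear with the first passage cut-off at height `r`. -/
def dampedShear (φ ρ : ℝ → ℝ) (t r : ℝ) : ℝ :=
  ∫ τ in Ioi (0 : ℝ), Real.exp (-r ^ 2 / (4 * τ)) * shearIntegrand φ ρ t τ

/-- The contribution of the flux at height `u` to the velocity at height `r`. -/
def wallFlux (φ : ℝ → ℝ) (α : ℝ → ℝ → ℝ) (t r u : ℝ) : ℝ :=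
  passageConst * (∫ τ in Ioc 0 t, φ (t - τ) * (passageDensity (r - u) τ * α u τ)) - φ t * α u 0

/-- The tangential velocity at height `r` on a normal line, up to a positive constant. -/
def wallProfile (φ ρ : ℝ → ℝ) (α : ℝ → ℝ → ℝ) (t r : ℝ) : ℝ :=
  φ t * (1 - ∫ u in Ioc 0 r, α u 0) -
    passageConst * ∫ τ in Ioc 0 t, φ (t - τ) *
      (passageDensity r τ * ρ τ - ∫ u in Ioc 0 r, passageDensity (r - u) τ * α u τ)

section Shear

variable {φ ρ : ℝ → ℝ} {Λ B t r τ : ℝ}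

lemma abs_increment_le (hφ : IsLipschitzProfile φ Λ) (hρ : IsModulation ρ B) (ht2 : t < 2)
    (hτ0 : 0 ≤ τ) (hτ2 : τ ≤ 2) : |φ t - φ (t - τ) * ρ τ| ≤ Λ * (1 + 2 * B) * τ := by
  have hΛ := hφ.const_nonneg
  have hlip := hφ.abs_sub_le t ht2 (t - τ) (by linarith)
  rw [sub_sub_cancel, abs_of_nonneg hτ0] at hlip
  calc |φ t - φ (t - τ) * ρ τ| = |(φ t - φ (t - τ)) - φ (t - τ) * (ρ τ - 1)| := by congr 1; ring
    _ ≤ |φ t - φ (t - τ)| + |φ (t - τ)| * |ρ τ - 1| := by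
        rw [← abs_mul]; exact abs_sub _ _
    _ ≤ Λ * τ + 2 * Λ * (B * τ) := by
        gcongr
        · exact hφ.abs_le (by linarith)
        · exact hρ.abs_sub_one_le τ ⟨hτ0, hτ2⟩
    _ = _ := by ring

lemma abs_shearIntegrand_le (hφ : IsLipschitzProfile φ Λ) (hρ : IsModulation ρ B) (ht2 : t < 2)
    (hτ : 0 < τ) : |shearIntegrand φ ρ t τ| ≤ 2 * (Λ * (1 + 2 * B)) * majorant τ := by
  have hΛ := hφ.const_nonneg
  have hB := hρ.const_nonneg
  rw [shearIntegrand, abs_mul, abs_of_nonneg (by positivity)]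
  refine le_mul_majorant hτ (fun h1 => ?_) (fun h1 => ?_)
  · calc _ ≤ τ ^ (-(3 / 2) : ℝ) * (Λ * (1 + 2 * B) * τ) := by
          gcongr; exact abs_increment_le hφ hρ ht2 hτ.le (by linarith)
      _ = Λ * (1 + 2 * B) * τ ^ (-(1 / 2) : ℝ) := by
          rw [← rpow_neg_three_halves_mul_self hτ]; ring
      _ ≤ 2 * (Λ * (1 + 2 * B)) * τ ^ (-(3 / 4) : ℝ) := by
          gcongr ?_ * ?_
          · linarith [mul_nonneg hΛ (by positivity : 0 ≤ 1 + 2 * B)]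
          · exact rpow_neg_half_le hτ h1
  · rw [mul_comm]
    gcongr
    rcases le_or_gt τ 2 with h2 | h2
    · rw [mul_comm 2]
      exact (abs_increment_le hφ hρ ht2 hτ.le h2).trans (by gcongr)
    · rw [hφ.eq_zero (t - τ) (by linarith), zero_mul, sub_zero]
      exact (hφ.abs_le ht2).trans (by nlinarith [mul_nonneg hΛ hB])

lemma integrableOn_shearIntegrand (hφ : IsLipschitzProfile φ Λ) (hρ : IsModulation ρ B)
    (ht2 : t < 2) : IntegrableOn (shearIntegrand φ ρ t) (Ioi 0) := by
  refine Integrable.mono' (integrableOn_majorant.const_mul (2 * (Λ * (1 + 2 * B)))) ?_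
    (ae_restrict_of_forall_mem measurableSet_Ioi fun τ hτ => abs_shearIntegrand_le hφ hρ ht2 hτ)
  have hshift := hφ.aestronglyMeasurable_shift ht2 measurableSet_Ioi subset_rfl
  exact AEStronglyMeasurable.mul (Measurable.aestronglyMeasurable (by fun_prop))
    (aestronglyMeasurable_const.sub (hshift.mul hρ.measurable.aestronglyMeasurable))

lemma integrableOn_damped (hφ : IsLipschitzProfile φ Λ) (hρ : IsModulation ρ B)
    (ht2 : t < 2) (r : ℝ) :
    IntegrableOn (fun τ => Real.exp (-r ^ 2 / (4 * τ)) * shearIntegrand φ ρ t τ) (Ioi 0) := by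
  refine Integrable.bdd_mul (c := 1) (integrableOn_shearIntegrand hφ hρ ht2)
    (Measurable.aestronglyMeasurable (by fun_prop))
    (ae_restrict_of_forall_mem measurableSet_Ioi fun τ hτ => ?_)
  rw [Real.norm_of_nonneg (Real.exp_pos _).le]
  exact exp_neg_div_le_one (sq_nonneg r) (le_of_lt hτ)

lemma tendsto_dampedShear (hφ : IsLipschitzProfile φ Λ) (hρ : IsModulation ρ B) (ht2 : t < 2) :
    Tendsto (dampedShear φ ρ t) (𝓝 0) (𝓝 (wallShear φ ρ t)) := by
  have hmeas := (integrableOn_shearIntegrand hφ hρ ht2).aestronglyMeasurable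
  refine tendsto_integral_filter_of_dominated_convergence
    (fun τ => 2 * (Λ * (1 + 2 * B)) * majorant τ)
    (Eventually.of_forall fun r => (Measurable.aestronglyMeasurable (by fun_prop)).mul hmeas)
    (Eventually.of_forall fun r => ae_restrict_of_forall_mem measurableSet_Ioi fun τ hτ => ?_)
    (integrableOn_majorant.const_mul _) (Eventually.of_forall fun τ => ?_)
  · rw [norm_mul, Real.norm_of_nonneg (Real.exp_pos _).le]
    exact (mul_le_of_le_one_left (norm_nonneg _)
      (exp_neg_div_le_one (sq_nonneg r) (le_of_lt hτ))).trans (abs_shearIntegrand_le hφ hρ ht2 hτ)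
  · have hcont : Continuous fun r : ℝ => Real.exp (-r ^ 2 / (4 * τ)) * shearIntegrand φ ρ t τ := by
      fun_prop
    simpa using hcont.tendsto 0

end Shear

section Flux

variable {φ : ℝ → ℝ} {α : ℝ → ℝ → ℝ} {Λ C t r u v τ : ℝ}

lemma abs_flux_le (hφ : IsLipschitzProfile φ Λ) (hα : IsWallFlux α C) (ht2 : t < 2) (hv : 0 ≤ v)
    (hu : 0 < u) (hτ : 0 ≤ τ) :
    |φ (t - τ) * (passageDensity v τ * α u τ)| ≤
      2 * Λ * C * (u * passageDensity v τ + passageDensity v τ * τ) := by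
  have hΛ := hφ.const_nonneg
  have hp := passageDensity_nonneg hv hτ
  rw [abs_mul, abs_of_nonneg (mul_nonneg hp (hα.nonneg u τ hu hτ))]
  calc _ ≤ 2 * Λ * (passageDensity v τ * (C * (u + τ))) := by
        gcongr
        · exact mul_nonneg hp (hα.nonneg u τ hu hτ)
        · exact hφ.abs_le (by linarith)
        · exact hα.le_mul_add u τ hu hτ
    _ = _ := by ring

lemma integrableOn_flux (hφ : IsLipschitzProfile φ Λ) (hα : IsWallFlux α C) (ht2 : t < 2)
    (hv : 0 ≤ v) (hu : 0 < u) :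
    IntegrableOn (fun τ => φ (t - τ) * (passageDensity v τ * α u τ)) (Ioc 0 t) := by
  refine Integrable.mono' ((((integrableOn_Ioc_passageDensity hv t).const_mul u).add
    (integrableOn_passageDensity_mul hv t)).const_mul (2 * Λ * C)) ?_
    (ae_restrict_of_forall_mem measurableSet_Ioc fun τ hτ => abs_flux_le hφ hα ht2 hv hu hτ.1.le)
  have hmeas : Measurable (α u) := hα.measurable.comp (measurable_const.prodMk measurable_id)
  exact (hφ.aestronglyMeasurable_shift ht2 measurableSet_Ioc Ioc_subset_Ioi_self).mul
    (Measurable.aestronglyMeasurable (by fun_prop))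

lemma abs_flux_le_rpow (hφ : IsLipschitzProfile φ Λ) (hα : IsWallFlux α C) (ht2 : t < 2)
    (hu : u ∈ Ioc 0 r) (hτ : τ ∈ Ioc 0 t) :
    |φ (t - τ) * (passageDensity (r - u) τ * α u τ)| ≤
      2 * Λ * C * (4 * (r + 2)) * (τ ^ (-(3 / 4) : ℝ) * (r - u) ^ (-(1 / 2) : ℝ)) := by
  have hΛ := hφ.const_nonneg
  have hC := hα.const_nonneg
  have hv : 0 ≤ r - u := sub_nonneg.2 hu.2
  have hp := passageDensity_nonneg hv hτ.1.le
  have hp_le : passageDensity (r - u) τ ≤ 4 * (r - u) ^ (-(1 / 2) : ℝ) * τ ^ (-(3 / 4) : ℝ) := by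
    rcases hv.eq_or_lt with h | h
    · rw [← h, passageDensity_zero_left]
      have := hτ.1
      positivity
    · exact passageDensity_le_rpow h hτ.1
  calc _ ≤ 2 * Λ * C * (u * passageDensity (r - u) τ + passageDensity (r - u) τ * τ) :=
        abs_flux_le hφ hα ht2 hv hu.1 hτ.1.le
    _ = 2 * Λ * C * ((u + τ) * passageDensity (r - u) τ) := by ring
    _ ≤ 2 * Λ * C * ((r + 2) * (4 * (r - u) ^ (-(1 / 2) : ℝ) * τ ^ (-(3 / 4) : ℝ))) := by
        have h1 := hu.1
        have h2 := hτ.1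
        gcongr
        · linarith [hu.2]
        · exact hu.2
        · linarith [hτ.2]
    _ = _ := by ring

lemma integrable_flux_prod (hφ : IsLipschitzProfile φ Λ) (hα : IsWallFlux α C) (ht2 : t < 2)
    (r : ℝ) :
    Integrable (fun q : ℝ × ℝ => φ (t - q.1) * (passageDensity (r - q.2) q.1 * α q.2 q.1))
      ((volume.restrict (Ioc 0 t)).prod (volume.restrict (Ioc 0 r))) := by
  have hbound := ((integrableOn_Ioc_rpow (s := -(3 / 4)) (by norm_num) t).mul_prod
    (integrableOn_Ioc_sub_rpow (s := -(1 / 2)) (by norm_num) r)).const_mul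
      (2 * Λ * C * (4 * (r + 2)))
  refine Integrable.mono' hbound ?_ ?_
  · have hshift := (hφ.aestronglyMeasurable_shift ht2 (measurableSet_Ioc (b := t))
      Ioc_subset_Ioi_self).comp_fst (ν := volume.restrict (Ioc 0 r))
    have hflux : Measurable fun q : ℝ × ℝ => α q.2 q.1 :=
      hα.measurable.comp (measurable_snd.prodMk measurable_fst)
    exact hshift.mul (Measurable.aestronglyMeasurable (Measurable.mul (by fun_prop) hflux))
  · rw [Measure.prod_restrict]
    exact ae_restrict_of_forall_mem (measurableSet_Ioc.prod measurableSet_Ioc) fun q hq =>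
      abs_flux_le_rpow hφ hα ht2 hq.2 hq.1

lemma integrableOn_flux_zero (hα : IsWallFlux α C) (r : ℝ) :
    IntegrableOn (fun u => α u 0) (Ioc 0 r) := by
  have hmeas : Measurable fun u => α u 0 :=
    hα.measurable.comp (measurable_id.prodMk measurable_const)
  refine Integrable.mono' (integrable_const (C * (r + 0))) hmeas.aestronglyMeasurable
    (ae_restrict_of_forall_mem measurableSet_Ioc fun u hu => ?_)
  rw [Real.norm_of_nonneg (hα.nonneg u 0 hu.1 le_rfl)]
  refine (hα.le_mul_add u 0 hu.1 le_rfl).trans ?_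
  have := hα.const_nonneg
  gcongr
  exact hu.2

lemma integrableOn_wallFlux (hφ : IsLipschitzProfile φ Λ) (hα : IsWallFlux α C) (ht2 : t < 2)
    (r : ℝ) : IntegrableOn (wallFlux φ α t r) (Ioc 0 r) :=
  ((integrable_flux_prod hφ hα ht2 r).integral_prod_right.const_mul passageConst).sub
    ((integrableOn_flux_zero hα r).const_mul (φ t))

lemma passageConst_mul_abs_integral_flux_le (hφ : IsLipschitzProfile φ Λ) (hα : IsWallFlux α C)
    (ht : 0 ≤ t) (ht2 : t < 2) (hv : 0 ≤ v) (hu : 0 < u) :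
    passageConst * |∫ τ in Ioc 0 t, φ (t - τ) * (passageDensity v τ * α u τ)| ≤
      2 * Λ * C * (u + passageConst * (4 * v)) := by
  have hΛ := hφ.const_nonneg
  have hC := hα.const_nonneg
  have hK := passageConst_pos
  have hp := (integrableOn_Ioc_passageDensity hv t).const_mul u
  have hpτ := integrableOn_passageDensity_mul hv t
  have hmem : |∫ τ in Ioc 0 t, φ (t - τ) * (passageDensity v τ * α u τ)| ≤ 2 * Λ * C *
      (u * (∫ τ in Ioc 0 t, passageDensity v τ) + ∫ τ in Ioc 0 t, passageDensity v τ * τ) := by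
    rw [← integral_const_mul, ← integral_add hp hpτ, ← integral_const_mul, ← Real.norm_eq_abs]
    exact norm_integral_le_of_norm_le ((hp.add hpτ).const_mul _)
      (ae_restrict_of_forall_mem measurableSet_Ioc fun τ hτ =>
        abs_flux_le hφ hα ht2 hv hu hτ.1.le)
  calc _ ≤ passageConst * (2 * Λ * C * (u * (∫ τ in Ioc 0 t, passageDensity v τ) +
        ∫ τ in Ioc 0 t, passageDensity v τ * τ)) := by gcongr
    _ = 2 * Λ * C * (u * (passageConst * ∫ τ in Ioc 0 t, passageDensity v τ) +
        passageConst * ∫ τ in Ioc 0 t, passageDensity v τ * τ) := by ring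
    _ ≤ 2 * Λ * C * (u * 1 + passageConst * (4 * v)) := by
      gcongr
      · exact passageConst_mul_integral_Ioc_le hv t
      · exact integral_passageDensity_mul_le hv ht ht2.le
    _ = _ := by rw [mul_one]

lemma abs_wallFlux_le (hφ : IsLipschitzProfile φ Λ) (hα : IsWallFlux α C) (ht : 0 ≤ t)
    (ht2 : t < 2) (hu : u ∈ Ioc 0 r) :
    |wallFlux φ α t r u| ≤ (4 + 8 * passageConst) * (Λ * C) * r := by
  have hΛ := hφ.const_nonneg
  have hC := hα.const_nonneg
  have hK := passageConst_pos
  have hu0 := hu.1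
  have hur := hu.2
  have hα0 := hα.nonneg u 0 hu0 le_rfl
  have hpast := passageConst_mul_abs_integral_flux_le hφ hα ht ht2 (sub_nonneg.2 hur) hu0
  have hpresent : |φ t| * α u 0 ≤ 2 * Λ * (C * (u + 0)) := by
    gcongr
    · exact hφ.abs_le ht2
    · exact hα.le_mul_add u 0 hu0 le_rfl
  calc |wallFlux φ α t r u| ≤ passageConst * |∫ τ in Ioc 0 t,
        φ (t - τ) * (passageDensity (r - u) τ * α u τ)| + |φ t| * α u 0 := by
        refine (abs_sub _ _).trans_eq ?_
        rw [abs_mul, abs_mul, abs_of_pos hK, abs_of_nonneg hα0]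
    _ ≤ 2 * Λ * C * (r + passageConst * (4 * r)) + 2 * Λ * (C * (r + 0)) := by
        refine (add_le_add hpast hpresent).trans ?_
        gcongr
        linarith
    _ = _ := by ring

lemma tendsto_integral_wallFlux_div (hφ : IsLipschitzProfile φ Λ) (hα : IsWallFlux α C)
    (ht : 0 ≤ t) (ht2 : t < 2) :
    Tendsto (fun r => (∫ u in Ioc 0 r, wallFlux φ α t r u) / r) (𝓝[>] 0) (𝓝 0) := by
  refine squeeze_zero_norm' (a := fun r => (4 + 8 * passageConst) * (Λ * C) * r) ?_ ?_
  · filter_upwards [self_mem_nhdsWithin] with r (hr : 0 < r)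
    have hle := norm_setIntegral_le_of_norm_le_const (μ := volume) (s := Ioc 0 r)
      (f := wallFlux φ α t r) (by simp) fun u hu => abs_wallFlux_le hφ hα ht ht2 hu
    rw [norm_div, Real.norm_of_nonneg hr.le, div_le_iff₀ hr]
    simpa [hr.le] using hle
  · have hcont : Continuous fun r : ℝ => (4 + 8 * passageConst) * (Λ * C) * r := by fun_prop
    simpa using (hcont.tendsto 0).mono_left nhdsWithin_le_nhds

end Flux

section Profile

variable {φ ρ : ℝ → ℝ} {α : ℝ → ℝ → ℝ} {Λ B C D e t r u τ : ℝ}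

lemma exp_mul_shearIntegrand (r τ : ℝ) :
    r * (Real.exp (-r ^ 2 / (4 * τ)) * shearIntegrand φ ρ t τ) =
      φ t * passageDensity r τ - φ (t - τ) * (passageDensity r τ * ρ τ) := by
  unfold shearIntegrand passageDensity; ring

lemma integrableOn_shift_mul_passageDensity (hφ : IsLipschitzProfile φ Λ) (hρ : IsModulation ρ B)
    (ht2 : t < 2) (hr : 0 < r) :
    IntegrableOn (fun τ => φ (t - τ) * (passageDensity r τ * ρ τ)) (Ioi 0) := by
  refine (((integrableOn_passageDensity hr).const_mul (φ t)).sub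
    ((integrableOn_damped hφ hρ ht2 r).const_mul r)).congr (Eventually.of_forall fun τ => ?_)
  simp only [Pi.sub_apply, exp_mul_shearIntegrand, sub_sub_cancel]

lemma integral_Ioc_shift_mul_passageDensity (hφ : IsLipschitzProfile φ Λ) (hρ : IsModulation ρ B)
    (ht2 : t < 2) (hr : 0 < r) :
    ∫ τ in Ioc 0 t, φ (t - τ) * (passageDensity r τ * ρ τ) =
      φ t * (∫ τ in Ioi (0 : ℝ), passageDensity r τ) - r * dampedShear φ ρ t r := by
  have hvanish : ∫ τ in Ioi (0 : ℝ), φ (t - τ) * (passageDensity r τ * ρ τ) =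
      ∫ τ in Ioc 0 t, φ (t - τ) * (passageDensity r τ * ρ τ) :=
    setIntegral_eq_of_subset_of_forall_sdiff_eq_zero measurableSet_Ioi Ioc_subset_Ioi_self
      fun τ hτ => by
        have : t < τ := not_le.1 fun h => hτ.2 ⟨hτ.1, h⟩
        rw [hφ.eq_zero _ (by linarith), zero_mul]
  rw [dampedShear, ← integral_const_mul r]
  simp only [exp_mul_shearIntegrand]
  rw [integral_sub ((integrableOn_passageDensity hr).const_mul _)
    (integrableOn_shift_mul_passageDensity hφ hρ ht2 hr), integral_const_mul, hvanish,
    sub_sub_cancel]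

lemma integral_wallFlux (hφ : IsLipschitzProfile φ Λ) (hα : IsWallFlux α C) (ht2 : t < 2) (r : ℝ) :
    ∫ u in Ioc 0 r, wallFlux φ α t r u =
      passageConst * (∫ τ in Ioc 0 t, ∫ u in Ioc 0 r,
        φ (t - τ) * (passageDensity (r - u) τ * α u τ)) - φ t * ∫ u in Ioc 0 r, α u 0 := by
  have hprod := integrable_flux_prod hφ hα ht2 r
  unfold wallFlux
  rw [integral_sub (hprod.integral_prod_right.const_mul passageConst)
    ((integrableOn_flux_zero hα r).const_mul (φ t)), integral_const_mul, integral_const_mul,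
    ← integral_integral_swap hprod]

lemma wallProfile_eq (hφ : IsLipschitzProfile φ Λ) (hρ : IsModulation ρ B) (hα : IsWallFlux α C)
    (ht2 : t < 2) (hr : 0 < r) :
    wallProfile φ ρ α t r =
      passageConst * (r * dampedShear φ ρ t r) + ∫ u in Ioc 0 r, wallFlux φ α t r u := by
  have hsplit : ∫ τ in Ioc 0 t, φ (t - τ) * (passageDensity r τ * ρ τ -
      ∫ u in Ioc 0 r, passageDensity (r - u) τ * α u τ) =
      (∫ τ in Ioc 0 t, φ (t - τ) * (passageDensity r τ * ρ τ)) -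
        ∫ τ in Ioc 0 t, ∫ u in Ioc 0 r, φ (t - τ) * (passageDensity (r - u) τ * α u τ) := by
    simp only [mul_sub, ← integral_const_mul]
    exact integral_sub ((integrableOn_shift_mul_passageDensity hφ hρ ht2 hr).mono_set
      Ioc_subset_Ioi_self) (integrable_flux_prod hφ hα ht2 r).integral_prod_left
  rw [wallProfile, hsplit, integral_Ioc_shift_mul_passageDensity hφ hρ ht2 hr,
    integral_wallFlux hφ hα ht2]
  linear_combination (-φ t) * passageConst_mul_integral hr

theorem tendsto_wallProfile_div (hφ : IsLipschitzProfile φ Λ) (hρ : IsModulation ρ B)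
    (hα : IsWallFlux α C) (ht : 0 ≤ t) (ht2 : t < 2) :
    Tendsto (fun r => wallProfile φ ρ α t r / r) (𝓝[>] 0)
      (𝓝 (passageConst * wallShear φ ρ t)) := by
  have hlim := (((tendsto_dampedShear hφ hρ ht2).mono_left
    (nhdsWithin_le_nhds (s := Ioi 0))).const_mul passageConst).add
    (tendsto_integral_wallFlux_div hφ hα ht ht2)
  rw [add_zero] at hlim
  refine hlim.congr' ?_
  filter_upwards [self_mem_nhdsWithin] with r (hr : 0 < r)
  rw [wallProfile_eq hφ hρ hα ht2 hr]
  field_simp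

/-! If the wall shear vanishes at a time `t > 1`, the velocity near the wall is still positive: just
before time `t` the modulation exceeds `1` and `φ` exceeds `φ t`, so the shear integrand is negative
for small `τ`, and this negative part is what the cut-off at height `r` removes; it has order `r`,
all other corrections have order `r²`. -/

lemma flux_lower_bound (hα : IsWallFlux α C) (hφm : ∀ s ∈ Ioo 1 t, φ t ≤ φ s) (ht : 0 ≤ φ t)
    (hdrop : ∀ u τ, 0 < u → 0 ≤ τ → -(D * (u * τ)) ≤ α u τ - α u 0) {v : ℝ} (hv : 0 ≤ v)
    (hu : 0 < u) (hτ : τ ∈ Ioc 0 ((t - 1) / 2)) :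
    φ t * (α u 0 * passageDensity v τ - D * u * (passageDensity v τ * τ)) ≤
      φ (t - τ) * (passageDensity v τ * α u τ) := by
  have hp := passageDensity_nonneg hv hτ.1.le
  have hατ := hα.nonneg u τ hu hτ.1.le
  calc _ = φ t * (passageDensity v τ * (α u 0 - D * (u * τ))) := by ring
    _ ≤ φ t * (passageDensity v τ * α u τ) := by
      gcongr; linarith [hdrop u τ hu hτ.1.le]
    _ ≤ _ := by
      gcongr
      exact hφm (t - τ) ⟨by linarith [hτ.1, hτ.2], by linarith [hτ.1]⟩

lemma integral_flux_lower_bound (hφ : IsLipschitzProfile φ Λ) (hα : IsWallFlux α C) (ht1 : 1 < t)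
    (ht2 : t < 2) (hφ0 : ∀ s ≤ t, 0 ≤ φ s) (hφm : ∀ s ∈ Ioo 1 t, φ t ≤ φ s)
    (hdrop : ∀ u τ, 0 < u → 0 ≤ τ → -(D * (u * τ)) ≤ α u τ - α u 0) {v : ℝ} (hv : 0 ≤ v)
    (hu : 0 < u) :
    φ t * (α u 0 * (∫ τ in Ioc 0 ((t - 1) / 2), passageDensity v τ) -
      D * u * ∫ τ in Ioc 0 ((t - 1) / 2), passageDensity v τ * τ) ≤
      ∫ τ in Ioc 0 t, φ (t - τ) * (passageDensity v τ * α u τ) := by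
  have hsub : Ioc 0 ((t - 1) / 2) ⊆ Ioc 0 t := Ioc_subset_Ioc_right (by linarith)
  have hflux := integrableOn_flux hφ hα ht2 hv hu
  have hp := (integrableOn_Ioc_passageDensity hv ((t - 1) / 2)).const_mul (α u 0)
  have hpτ := (integrableOn_passageDensity_mul hv ((t - 1) / 2)).const_mul (D * u)
  rw [← integral_const_mul, ← integral_const_mul, ← integral_sub hp hpτ, ← integral_const_mul]
  calc _ ≤ ∫ τ in Ioc 0 ((t - 1) / 2), φ (t - τ) * (passageDensity v τ * α u τ) :=
        setIntegral_mono_on ((hp.sub hpτ).const_mul _) (hflux.mono_set hsub) measurableSet_Ioc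
          fun τ hτ => flux_lower_bound hα hφm (hφ0 t le_rfl) hdrop hv hu hτ
    _ ≤ _ := setIntegral_mono_set hflux
        (ae_restrict_of_forall_mem measurableSet_Ioc fun τ hτ =>
          mul_nonneg (hφ0 _ (by linarith [hτ.1]))
            (mul_nonneg (passageDensity_nonneg hv hτ.1.le) (hα.nonneg u τ hu hτ.1.le)))
        hsub.eventuallyLE

lemma exists_wallFlux_ge (hφ : IsLipschitzProfile φ Λ) (hα : IsWallFlux α C) (ht1 : 1 < t)
    (ht2 : t < 2) (hφ0 : ∀ s ≤ t, 0 ≤ φ s) (hφm : ∀ s ∈ Ioo 1 t, φ t ≤ φ s) (hD : 0 ≤ D)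
    (hdrop : ∀ u τ, 0 < u → 0 ≤ τ → -(D * (u * τ)) ≤ α u τ - α u 0) :
    ∃ Q, ∀ r, ∀ u ∈ Ioo 0 r, -(Q * r ^ 2) ≤ wallFlux φ α t r u := by
  have hC := hα.const_nonneg
  have hK := passageConst_pos
  have hφt := hφ0 t le_rfl
  refine ⟨φ t * passageConst * (C * (2 / √((t - 1) / 2)) + 4 * D), fun r u hu => ?_⟩
  set δ := (t - 1) / 2 with hδ
  have hδ0 : 0 < δ := by rw [hδ]; linarith
  have hu0 := hu.1
  have hur := hu.2.le
  have hr0 : 0 ≤ r := hu0.le.trans hur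
  have hv : 0 < r - u := sub_pos.2 hu.2
  have hα0 := hα.nonneg u 0 hu0 le_rfl
  have hα_le : α u 0 ≤ C * u := by simpa using hα.le_mul_add u 0 hu0 le_rfl
  have hmass := le_passageConst_mul_integral_Ioc hv hδ0
  have hmoment := integral_passageDensity_mul_le hv.le hδ0.le (by rw [hδ]; linarith)
  have hpast := integral_flux_lower_bound hφ hα ht1 ht2 hφ0 hφm hdrop hv.le hu0
  have hlower : φ t * (α u 0 * (1 - passageConst * ((r - u) * (2 / √δ))) -
      passageConst * (D * u * (4 * (r - u)))) - φ t * α u 0 ≤ wallFlux φ α t r u := by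
    refine sub_le_sub_right ?_ _
    calc _ ≤ φ t * (α u 0 * (passageConst * ∫ τ in Ioc 0 δ, passageDensity (r - u) τ) -
          passageConst * (D * u * ∫ τ in Ioc 0 δ, passageDensity (r - u) τ * τ)) := by gcongr
      _ = passageConst * (φ t * (α u 0 * (∫ τ in Ioc 0 δ, passageDensity (r - u) τ) -
          D * u * ∫ τ in Ioc 0 δ, passageDensity (r - u) τ * τ)) := by ring
      _ ≤ _ := by gcongr
  refine le_trans ?_ hlower
  calc _ = -(φ t * passageConst * (C * r * (r * (2 / √δ)) + D * r * (4 * r))) := by ring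
    _ ≤ -(φ t * passageConst * (α u 0 * ((r - u) * (2 / √δ)) + D * u * (4 * (r - u)))) := by
      have hα_r : α u 0 ≤ C * r := hα_le.trans (by gcongr)
      have hv_r : r - u ≤ r := by linarith
      gcongr
    _ = _ := by ring

lemma shearIntegrand_le_neg (hφm : ∀ s ∈ Ioo 1 t, φ t ≤ φ s) (hφt : 0 ≤ φ t) (he : 0 ≤ e)
    (hgrow : e * τ ≤ ρ τ - 1) (hτ : 0 < τ) (hτt : τ < t - 1) :
    shearIntegrand φ ρ t τ ≤ -(φ t * e * τ ^ (-(1 / 2) : ℝ)) := by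
  have hρ : 1 ≤ ρ τ := by linarith [mul_nonneg he hτ.le]
  have hincr : φ t - φ (t - τ) * ρ τ ≤ -(φ t * e * τ) := by
    have hmod : φ t * ρ τ ≤ φ (t - τ) * ρ τ := by
      gcongr; exact hφm (t - τ) ⟨by linarith, by linarith⟩
    linarith [mul_le_mul_of_nonneg_left hgrow hφt]
  calc shearIntegrand φ ρ t τ ≤ τ ^ (-(3 / 2) : ℝ) * -(φ t * e * τ) := by
        unfold shearIntegrand; gcongr
    _ = _ := by rw [← rpow_neg_three_halves_mul_self hτ]; ring

lemma one_sub_exp_neg_le {m δ : ℝ} (hm : 0 ≤ m) (hδ : 0 < δ) (hτ : δ ≤ τ) :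
    1 - Real.exp (-m / (4 * τ)) ≤ m / (4 * δ) := by
  have hmono : m / (4 * τ) ≤ m / (4 * δ) := by gcongr
  have hexp := Real.add_one_le_exp (-m / (4 * τ))
  rw [neg_div] at hexp ⊢
  linarith

lemma exp_sub_one_mul_shearIntegrand_ge (hφ : IsLipschitzProfile φ Λ) (hρ : IsModulation ρ B)
    (ht2 : t < 2) (hφm : ∀ s ∈ Ioo 1 t, φ t ≤ φ s) (hφt : 0 ≤ φ t) (he : 0 ≤ e)
    (hgrow : ∀ τ ∈ Icc (0 : ℝ) 2, e * τ ≤ ρ τ - 1) (hr : r ^ 2 ≤ (t - 1) / 2) (ht1 : 1 < t)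
    (hτ : 0 < τ) :
    (Ioc 0 (r ^ 2)).indicator
        (fun τ => (1 - Real.exp (-(1 / 4))) * (φ t * e) * τ ^ (-(1 / 2) : ℝ)) τ -
      r ^ 2 / (4 * ((t - 1) / 2)) * (2 * (Λ * (1 + 2 * B)) * majorant τ) ≤
      Real.exp (-r ^ 2 / (4 * τ)) * shearIntegrand φ ρ t τ - shearIntegrand φ ρ t τ := by
  have hδ : 0 < (t - 1) / 2 := by linarith
  have hfar := abs_shearIntegrand_le hφ hρ ht2 hτ
  have herr : 0 ≤ r ^ 2 / (4 * ((t - 1) / 2)) * (2 * (Λ * (1 + 2 * B)) * majorant τ) :=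
    mul_nonneg (by positivity) ((abs_nonneg _).trans hfar)
  have hE := sub_nonneg.2 (exp_neg_div_le_one (sq_nonneg r) hτ.le)
  suffices h : (Ioc 0 (r ^ 2)).indicator
      (fun τ => (1 - Real.exp (-(1 / 4))) * (φ t * e) * τ ^ (-(1 / 2) : ℝ)) τ -
      r ^ 2 / (4 * ((t - 1) / 2)) * (2 * (Λ * (1 + 2 * B)) * majorant τ) ≤
      (1 - Real.exp (-r ^ 2 / (4 * τ))) * -shearIntegrand φ ρ t τ by linarith
  rcases le_or_gt τ ((t - 1) / 2) with hclose | hclose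
  · have hneg := shearIntegrand_le_neg hφm hφt he (hgrow τ ⟨hτ.le, by linarith⟩) hτ (by linarith)
    have hgain : 0 ≤ φ t * e * τ ^ (-(1 / 2) : ℝ) := by positivity
    refine (sub_le_self _ herr).trans ?_
    by_cases hmem : τ ∈ Ioc 0 (r ^ 2)
    · have hE4 : Real.exp (-r ^ 2 / (4 * τ)) ≤ Real.exp (-(1 / 4)) := by
        rw [Real.exp_le_exp, neg_div, neg_le_neg_iff, div_le_div_iff₀ (by norm_num) (by positivity)]
        linarith [hmem.2]
      rw [indicator_of_mem hmem, mul_assoc]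
      gcongr
      linarith
    · rw [indicator_of_notMem hmem]
      exact mul_nonneg hE (by linarith)
  · rw [indicator_of_notMem fun hmem => by linarith [hmem.2], zero_sub, mul_neg, neg_le_neg_iff]
    calc _ ≤ (1 - Real.exp (-r ^ 2 / (4 * τ))) * |shearIntegrand φ ρ t τ| := by
          gcongr; exact le_abs_self _
      _ ≤ _ := by
          gcongr; exact one_sub_exp_neg_le (sq_nonneg r) hδ hclose.le

lemma exists_dampedShear_ge (hφ : IsLipschitzProfile φ Λ) (hρ : IsModulation ρ B) (ht1 : 1 < t)
    (ht2 : t < 2) (hφm : ∀ s ∈ Ioo 1 t, φ t ≤ φ s) (hφt : 0 < φ t) (he : 0 < e)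
    (hgrow : ∀ τ ∈ Icc (0 : ℝ) 2, e * τ ≤ ρ τ - 1) (hshear : 0 ≤ wallShear φ ρ t) :
    ∃ c > 0, ∃ P, ∀ r > 0, r ^ 2 ≤ (t - 1) / 2 → c * r - P * r ^ 2 ≤ dampedShear φ ρ t r := by
  set c := (1 - Real.exp (-(1 / 4))) * (φ t * e)
  have hexp : Real.exp (-(1 / 4)) < 1 := Real.exp_lt_one_iff.2 (by norm_num)
  have hc0 : 0 < c := mul_pos (by linarith) (by positivity)
  refine ⟨c * 2, by positivity, 1 / (4 * ((t - 1) / 2)) *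
    (2 * (Λ * (1 + 2 * B)) * ∫ τ in Ioi (0 : ℝ), majorant τ), fun r hr hrt => ?_⟩
  have hgain : IntegrableOn ((Ioc 0 (r ^ 2)).indicator fun τ : ℝ => c * τ ^ (-(1 / 2) : ℝ))
      (Ioi 0) :=
    ((integrable_indicator_iff measurableSet_Ioc).2
      ((integrableOn_Ioc_rpow (by norm_num) (r ^ 2)).const_mul c)).integrableOn
  have hgain_eq : ∫ τ in Ioi (0 : ℝ), (Ioc 0 (r ^ 2)).indicator
      (fun τ : ℝ => c * τ ^ (-(1 / 2) : ℝ)) τ = c * (2 * r) := by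
    rw [setIntegral_indicator measurableSet_Ioc, inter_eq_right.2 Ioc_subset_Ioi_self,
      integral_const_mul, integral_Ioc_rpow_neg_half (by positivity), Real.sqrt_sq hr.le]
  have hloss : IntegrableOn (fun τ => r ^ 2 / (4 * ((t - 1) / 2)) *
      (2 * (Λ * (1 + 2 * B)) * majorant τ)) (Ioi 0) :=
    (integrableOn_majorant.const_mul _).const_mul _
  have hdamped := integrableOn_damped hφ hρ ht2 r
  have hfull := integrableOn_shearIntegrand hφ hρ ht2
  have hmono := setIntegral_mono_on (hgain.sub hloss) (hdamped.sub hfull) measurableSet_Ioi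
    fun τ hτ => exp_sub_one_mul_shearIntegrand_ge hφ hρ ht2 hφm hφt.le he.le hgrow hrt ht1 hτ
  simp only [Pi.sub_apply] at hmono
  rw [integral_sub hgain hloss, integral_sub hdamped hfull, integral_const_mul, integral_const_mul,
    hgain_eq, ← dampedShear, ← wallShear] at hmono
  calc _ = c * (2 * r) - r ^ 2 / (4 * ((t - 1) / 2)) *
        (2 * (Λ * (1 + 2 * B)) * ∫ τ in Ioi (0 : ℝ), majorant τ) := by ring
    _ ≤ _ := by linarith

lemma eventually_wallProfile_pos (hφ : IsLipschitzProfile φ Λ) (hρ : IsModulation ρ B)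
    (hα : IsWallFlux α C) (ht1 : 1 < t) (ht2 : t < 2) (hφt : 0 < φ t) (hφ0 : ∀ s ≤ t, 0 ≤ φ s)
    (hφm : ∀ s ∈ Ioo 1 t, φ t ≤ φ s) (he : 0 < e)
    (hgrow : ∀ τ ∈ Icc (0 : ℝ) 2, e * τ ≤ ρ τ - 1) (hD : 0 ≤ D)
    (hdrop : ∀ u τ, 0 < u → 0 ≤ τ → -(D * (u * τ)) ≤ α u τ - α u 0)
    (hshear : 0 ≤ wallShear φ ρ t) : ∀ᶠ r in 𝓝[>] 0, 0 < wallProfile φ ρ α t r := by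
  have hK := passageConst_pos
  obtain ⟨c, hc, P, hdamped⟩ := exists_dampedShear_ge hφ hρ ht1 ht2 hφm hφt he hgrow hshear
  obtain ⟨Q, hflux⟩ := exists_wallFlux_ge hφ hα ht1 ht2 hφ0 hφm hD hdrop
  have hsmall : ∀ᶠ r : ℝ in 𝓝[>] 0, r ^ 2 < (t - 1) / 2 := nhdsWithin_le_nhds
    (ContinuousAt.eventually_lt (by fun_prop) continuousAt_const (by simpa using by linarith))
  have hgain : ∀ᶠ r : ℝ in 𝓝[>] 0, 0 < passageConst * (c - P * r) - Q * r := nhdsWithin_le_nhds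
    (ContinuousAt.eventually_lt continuousAt_const (by fun_prop) (by simpa using mul_pos hK hc))
  filter_upwards [self_mem_nhdsWithin, hsmall, hgain] with r (hr : 0 < r) hr_small hr_gain
  have hflux_int : -(Q * r ^ 2) * r ≤ ∫ u in Ioc 0 r, wallFlux φ α t r u := by
    calc -(Q * r ^ 2) * r = ∫ _ in Ioo 0 r, -(Q * r ^ 2) := by simp [hr.le, mul_comm]
      _ ≤ ∫ u in Ioo 0 r, wallFlux φ α t r u :=
        setIntegral_mono_on (integrableOn_const (by simp))
          ((integrableOn_wallFlux hφ hα ht2 r).mono_set Ioo_subset_Ioc_self) measurableSet_Ioo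
          (hflux r)
      _ = _ := integral_Ioc_eq_integral_Ioo.symm
  rw [wallProfile_eq hφ hρ hα ht2 hr]
  calc 0 < r ^ 2 * (passageConst * (c - P * r) - Q * r) := by positivity
    _ = passageConst * (r * (c * r - P * r ^ 2)) + -(Q * r ^ 2) * r := by ring
    _ ≤ _ := by gcongr; exact hdamped r hr hr_small.le

end Profile

/-! ### The wall shear and its reversal -/

namespace IsTemporalProfile

variable {φ : ℝ → ℝ}

lemma isLipschitzProfile (hφ : IsTemporalProfile φ) {K : NNReal}
    (hK : LipschitzOnWith K φ (Icc 0 2)) : IsLipschitzProfile φ K where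
  eq_zero := hφ.zero
  abs_sub_le s hs s' hs' := by
    have hclip : ∀ s, φ s = φ (max s 0) := fun s => by
      rcases le_total s 0 with h | h
      · rw [max_eq_right h, hφ.zero s h, hφ.zero 0 le_rfl]
      · rw [max_eq_left h]
    have hmem : ∀ s < (2 : ℝ), max s 0 ∈ Icc (0 : ℝ) 2 := fun s hs =>
      ⟨le_max_right _ _, max_le hs.le zero_le_two⟩
    rw [hclip s, hclip s']
    exact (hK.dist_le_mul _ (hmem s hs) _ (hmem s' hs')).trans
      (mul_le_mul_of_nonneg_left (abs_max_sub_max_le_abs s s' 0) K.2)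

lemma monotoneOn_Iic (hφ : IsTemporalProfile φ) (hc : ContinuousOn φ (Iio 2)) :
    MonotoneOn φ (Iic 1) := by
  have hlt : MonotoneOn φ (Iio 1) := fun s (hs : s < 1) s' (hs' : s' < 1) h => by
    rcases le_or_gt s 0 with h0 | h0
    · rw [hφ.zero s h0]
      rcases le_or_gt s' 0 with h1 | h1
      · rw [hφ.zero s' h1]
      · exact (hφ.pos s' ⟨h1, hs'⟩).le
    · exact hφ.mono ⟨h0, hs⟩ ⟨h0.trans_le h, hs'⟩ h
  rw [← Iio_insert]
  have : (𝓝[<] (1 : ℝ)).NeBot := inferInstance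
  exact hlt.insert_of_continuousWithinAt (mem_closure_iff_clusterPt.1 (by simp))
    ((hc 1 (mem_Iio.2 one_lt_two)).mono (Iio_subset_Iio one_le_two))

lemma nonneg_of_le_one (hφ : IsTemporalProfile φ) (hc : ContinuousOn φ (Iio 2)) {s : ℝ}
    (hs : s ≤ 1) : 0 ≤ φ s := by
  have h0 : min s 0 ≤ 0 := min_le_right s 0
  simpa only [hφ.zero _ h0] using
    hφ.monotoneOn_Iic hc (h0.trans zero_le_one) hs (min_le_left s 0)

lemma pos_of_le_one (hφ : IsTemporalProfile φ) (hc : ContinuousOn φ (Iio 2)) {s : ℝ} (h0 : 0 < s)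
    (hs : s ≤ 1) : 0 < φ s :=
  (hφ.pos (s / 2) ⟨by linarith, by linarith⟩).trans_le
    (hφ.monotoneOn_Iic hc (by simp only [mem_Iic]; linarith) hs (by linarith))

end IsTemporalProfile

section WallShear

variable {φ ρ ρ₁ ρ₂ : ℝ → ℝ} {Λ B B₁ B₂ Φ t : ℝ}

lemma M_eq_wallShear (φ : ℝ → ℝ) (t : ℝ) : M φ t = wallShear φ (fun _ => 1) t := by
  unfold M wallShear
  rw [← integral_indicator measurableSet_Iio, ← integral_indicator measurableSet_Ioi,
    ← integral_sub_left_eq_self _ volume t]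
  congr 1 with τ
  by_cases h : 0 < τ
  · rw [indicator_of_mem (show t - τ ∈ Iio t from sub_lt_self t h),
      indicator_of_mem (show τ ∈ Ioi 0 from h), sub_sub_cancel, shearIntegrand, Real.rpow_neg h.le]
    ring
  · rw [indicator_of_notMem (show t - τ ∉ Iio t from fun h' => h (sub_lt_self_iff t |>.1 h')),
      indicator_of_notMem (show τ ∉ Ioi 0 from h)]

lemma continuousOn_wallShear (hφ : IsLipschitzProfile φ Λ) (hρ : IsModulation ρ B) :
    ContinuousOn (wallShear φ ρ) (Iio 2) := by
  refine continuousOn_of_dominated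
    (fun t ht => (integrableOn_shearIntegrand hφ hρ ht).aestronglyMeasurable)
    (fun t ht => ae_restrict_of_forall_mem measurableSet_Ioi fun τ hτ =>
      abs_shearIntegrand_le hφ hρ ht hτ)
    (integrableOn_majorant.const_mul _)
    (ae_restrict_of_forall_mem measurableSet_Ioi fun τ (hτ : 0 < τ) => ?_)
  have hshift : ContinuousOn (fun t => φ (t - τ)) (Iio 2) :=
    hφ.continuousOn.comp (by fun_prop) fun t ht => (sub_lt_self t hτ).trans ht
  exact continuousOn_const.mul (hφ.continuousOn.sub (hshift.mul continuousOn_const))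

lemma shearIntegrand_sub (φ ρ₁ ρ₂ : ℝ → ℝ) (t τ : ℝ) :
    shearIntegrand φ ρ₁ t τ - shearIntegrand φ ρ₂ t τ =
      τ ^ (-(3 / 2) : ℝ) * (φ (t - τ) * (ρ₂ τ - ρ₁ τ)) := by
  unfold shearIntegrand; ring

lemma integrableOn_shearIntegrand_sub (hφ : IsLipschitzProfile φ Λ) (h₁ : IsModulation ρ₁ B₁)
    (h₂ : IsModulation ρ₂ B₂) (ht2 : t < 2) :
    IntegrableOn (fun τ => τ ^ (-(3 / 2) : ℝ) * (φ (t - τ) * (ρ₂ τ - ρ₁ τ))) (Ioc 0 t) := by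
  simp only [← shearIntegrand_sub]
  exact ((integrableOn_shearIntegrand hφ h₁ ht2).sub
    (integrableOn_shearIntegrand hφ h₂ ht2)).mono_set Ioc_subset_Ioi_self

lemma wallShear_sub (hφ : IsLipschitzProfile φ Λ) (h₁ : IsModulation ρ₁ B₁)
    (h₂ : IsModulation ρ₂ B₂) (ht2 : t < 2) :
    wallShear φ ρ₁ t - wallShear φ ρ₂ t =
      ∫ τ in Ioc 0 t, τ ^ (-(3 / 2) : ℝ) * (φ (t - τ) * (ρ₂ τ - ρ₁ τ)) := by
  rw [wallShear, wallShear, ← integral_sub (integrableOn_shearIntegrand hφ h₁ ht2)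
    (integrableOn_shearIntegrand hφ h₂ ht2)]
  simp only [shearIntegrand_sub]
  refine setIntegral_eq_of_subset_of_forall_sdiff_eq_zero measurableSet_Ioi Ioc_subset_Ioi_self
    fun τ hτ => ?_
  have : t < τ := not_le.1 fun h => hτ.2 ⟨hτ.1, h⟩
  rw [hφ.eq_zero _ (by linarith), zero_mul, mul_zero]

lemma wallShear_lt (hφ : IsLipschitzProfile φ Λ) (h₁ : IsModulation ρ₁ B₁)
    (h₂ : IsModulation ρ₂ B₂) (ht : 0 < t) (ht2 : t < 2) (hlt : ∀ τ ∈ Ioc (0 : ℝ) 2, ρ₁ τ < ρ₂ τ)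
    (hφ0 : ∀ s ≤ t, 0 ≤ φ s) (hφp : ∀ s ∈ Ioo (0 : ℝ) 1, 0 < φ s) :
    wallShear φ ρ₂ t < wallShear φ ρ₁ t := by
  rw [← sub_pos, wallShear_sub hφ h₁ h₂ ht2]
  refine (setIntegral_pos_iff_support_of_nonneg_ae
    (ae_restrict_of_forall_mem measurableSet_Ioc fun τ hτ => ?_)
    (integrableOn_shearIntegrand_sub hφ h₁ h₂ ht2)).2 ?_
  · have hgap := sub_nonneg.2 (hlt τ ⟨hτ.1, hτ.2.trans ht2.le⟩).le
    exact mul_nonneg (Real.rpow_nonneg hτ.1.le _)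
      (mul_nonneg (hφ0 _ (sub_le_self t hτ.1.le)) hgap)
  · have hvol : 0 < volume (Ioo (max (t - 1) 0) t) := by
      rw [Real.volume_Ioo, ENNReal.ofReal_pos, sub_pos, max_lt_iff]
      exact ⟨by linarith, ht⟩
    refine hvol.trans_le (measure_mono fun τ hτ => ?_)
    obtain ⟨hτ1, hτ0⟩ := max_lt_iff.1 hτ.1
    have hφτ := hφp (t - τ) ⟨sub_pos.2 hτ.2, by linarith⟩
    have hgap := sub_pos.2 (hlt τ ⟨hτ0, by linarith [hτ.2]⟩)
    exact ⟨(mul_pos (Real.rpow_pos_of_pos hτ0 _) (mul_pos hφτ hgap)).ne', hτ0, hτ.2.le⟩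

lemma wallShear_one_sub_le (hφ : IsLipschitzProfile φ Λ) (hρ : IsModulation ρ B) (ht : 0 ≤ t)
    (ht2 : t < 2) (hΦ : ∀ s < t, |φ s| ≤ Φ) :
    wallShear φ (fun _ => 1) t - wallShear φ ρ t ≤ Φ * B * (2 * √t) := by
  have hΦ0 : 0 ≤ Φ := (abs_nonneg _).trans (hΦ (t - 1) (by linarith))
  rw [wallShear_sub hφ isModulation_one hρ ht2, ← integral_Ioc_rpow_neg_half ht,
    ← integral_const_mul]
  refine setIntegral_mono_on (integrableOn_shearIntegrand_sub hφ isModulation_one hρ ht2)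
    ((integrableOn_Ioc_rpow (by norm_num) t).const_mul _) measurableSet_Ioc fun τ hτ => ?_
  have hτ0 : 0 < τ := hτ.1
  calc _ ≤ τ ^ (-(3 / 2) : ℝ) * |φ (t - τ) * (ρ τ - 1)| := by gcongr; exact le_abs_self _
    _ ≤ τ ^ (-(3 / 2) : ℝ) * (Φ * (B * τ)) := by
        rw [abs_mul]
        gcongr
        · exact hΦ _ (by linarith)
        · exact hρ.abs_sub_one_le τ ⟨hτ.1.le, hτ.2.trans ht2.le⟩
    _ = _ := by rw [← rpow_neg_three_halves_mul_self hτ0]; ring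

lemma le_wallShear_one (hφ : IsLipschitzProfile φ Λ) (hm : MonotoneOn φ (Iic 1)) (ht : 0 < t)
    (ht1 : t ≤ 1) : 2 / √t * φ t ≤ wallShear φ (fun _ => 1) t := by
  have htail : ∫ τ in Ioi t, shearIntegrand φ (fun _ => 1) t τ = 2 / √t * φ t := by
    have hzero : ∀ τ ∈ Ioi t, shearIntegrand φ (fun _ => 1) t τ = τ ^ (-(3 / 2) : ℝ) * φ t :=
      fun τ (hτ : t < τ) => by
        rw [shearIntegrand, hφ.eq_zero (t - τ) (by linarith), zero_mul, sub_zero]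
    rw [setIntegral_congr_fun measurableSet_Ioi hzero, integral_mul_const,
      integral_Ioi_rpow_of_lt (by norm_num) ht, Real.sqrt_eq_rpow,
      show (-(3 / 2) + 1 : ℝ) = -(1 / 2) by norm_num, Real.rpow_neg ht.le]
    congr 1
    field_simp
  rw [← htail]
  refine setIntegral_mono_set (integrableOn_shearIntegrand hφ isModulation_one (by linarith))
    (ae_restrict_of_forall_mem measurableSet_Ioi fun τ (hτ : 0 < τ) => ?_)
    (Ioi_subset_Ioi ht.le).eventuallyLE
  have hpast : φ (t - τ) ≤ φ t := hm (by simp only [mem_Iic]; linarith) ht1 (by linarith)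
  exact mul_nonneg (Real.rpow_nonneg hτ.le _) (by linarith)

lemma wallShear_pos_of_le_one (hφ : IsTemporalProfile φ) (hL : IsLipschitzProfile φ Λ)
    (hρ : IsModulation ρ (1 / 2)) (ht : 0 < t) (ht1 : t ≤ 1) : 0 < wallShear φ ρ t := by
  have hmono := hφ.monotoneOn_Iic hL.continuousOn
  have hφt := hφ.pos_of_le_one hL.continuousOn ht ht1
  have hgap := wallShear_one_sub_le hL hρ ht.le (by linarith) (Φ := φ t) fun s hs => by
    rw [abs_of_nonneg (hφ.nonneg_of_le_one hL.continuousOn (hs.le.trans ht1))]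
    exact hmono (hs.le.trans ht1) ht1 hs.le
  have hsqrt : 0 < √t := Real.sqrt_pos.2 ht
  have hsqrt1 : √t ≤ 1 := Real.sqrt_le_one.2 ht1
  calc 0 < φ t * (2 / √t - √t) := by
        have : 2 ≤ 2 / √t := by rw [le_div_iff₀ hsqrt]; linarith
        exact mul_pos hφt (by linarith)
    _ = 2 / √t * φ t - φ t * (1 / 2) * (2 * √t) := by ring
    _ ≤ wallShear φ ρ t := by linarith [le_wallShear_one hL hmono ht ht1]

lemma wallShear_one_neg (hφ : IsTemporalProfile φ) (hL : IsLipschitzProfile φ Λ) (ht1 : 1 < t)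
    (ht2 : t < 2) (hneg : φ t ≤ 0) : wallShear φ (fun _ => 1) t < 0 := by
  have hle : ∀ τ > 0, φ t ≤ φ (t - τ) := fun τ hτ => by
    rcases le_or_gt (t - τ) 1 with h1 | h1
    · exact hneg.trans (hφ.nonneg_of_le_one hL.continuousOn h1)
    · exact hφ.anti ⟨h1, by linarith⟩ ⟨ht1, ht2⟩ (by linarith)
  rw [← neg_pos, wallShear, ← integral_neg]
  refine (setIntegral_pos_iff_support_of_nonneg_ae
    (ae_restrict_of_forall_mem measurableSet_Ioi fun τ (hτ : 0 < τ) => ?_)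
    (integrableOn_shearIntegrand hL isModulation_one ht2).neg).2 ?_
  · exact neg_nonneg.2 (mul_nonpos_of_nonneg_of_nonpos (Real.rpow_nonneg hτ.le _)
      (by linarith [hle τ hτ]))
  · have hvol : 0 < volume (Ioo (t - 1) t) := by
      rw [Real.volume_Ioo, ENNReal.ofReal_pos]; linarith
    refine hvol.trans_le (measure_mono fun τ hτ => ?_)
    have hτ0 : 0 < τ := by linarith [hτ.1]
    have hφτ := hφ.pos (t - τ) ⟨sub_pos.2 hτ.2, by linarith [hτ.1]⟩
    exact ⟨(neg_pos.2 (mul_neg_of_pos_of_neg (Real.rpow_pos_of_pos hτ0 _) (by linarith))).ne', hτ0⟩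

lemma M_pos_of_le_one (hφ : IsTemporalProfile φ) (hL : IsLipschitzProfile φ Λ) (ht : 0 < t)
    (ht1 : t ≤ 1) : 0 < M φ t := by
  rw [M_eq_wallShear]
  exact wallShear_pos_of_le_one hφ hL ⟨measurable_const, rfl, fun τ hτ => by simpa using hτ.1⟩
    ht ht1

lemma escapeTime_le (hφ : IsTemporalProfile φ) (hL : IsLipschitzProfile φ Λ) (ht : 0 < t)
    (hneg : M φ t < 0) : escapeTime φ ≤ t :=
  csSup_le ⟨1, ⟨one_pos, one_lt_two⟩, fun _ hs => M_pos_of_le_one hφ hL hs.1 hs.2.le⟩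
    fun _ hr => not_lt.1 fun h => (hr.2 t ⟨ht, h⟩).not_gt hneg

end WallShear

/-- A temporal profile, Lipschitz before time `2`, whose wall shear `M` becomes negative before
time `2`. -/
structure IsReversingProfile (φ : ℝ → ℝ) (Λ : ℝ) : Prop where
  temporal : IsTemporalProfile φ
  lipschitz : IsLipschitzProfile φ Λ
  exists_neg : ∃ t ∈ Ioo (0 : ℝ) 2, M φ t < 0

namespace IsReversingProfile

variable {φ : ℝ → ℝ} {Λ t : ℝ}

lemma escapeTime_lt_two (h : IsReversingProfile φ Λ) : escapeTime φ < 2 := by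
  obtain ⟨t, ht, hneg⟩ := h.exists_neg
  exact (escapeTime_le h.temporal h.lipschitz ht.1 hneg).trans_lt ht.2

lemma le_escapeTime (ht : t ∈ Ioo (0 : ℝ) 2) (hpos : ∀ s ∈ Ioo 0 t, 0 < M φ s) :
    t ≤ escapeTime φ :=
  le_csSup ⟨2, fun _ hr => hr.1.2.le⟩ ⟨ht, hpos⟩

lemma M_pos (h : IsReversingProfile φ Λ) (ht : t ∈ Ioo 0 (escapeTime φ)) : 0 < M φ t := by
  have hne : {r | r ∈ Ioo (0 : ℝ) 2 ∧ ∀ t ∈ Ioo 0 r, 0 < M φ t}.Nonempty :=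
    ⟨1, ⟨one_pos, one_lt_two⟩,
      fun s hs => M_pos_of_le_one h.temporal h.lipschitz hs.1 hs.2.le⟩
  obtain ⟨r, hr, htr⟩ := exists_lt_of_lt_csSup hne ht.2
  exact hr.2 t ⟨ht.1, htr⟩

lemma one_le_escapeTime (h : IsReversingProfile φ Λ) : 1 ≤ escapeTime φ :=
  le_escapeTime ⟨one_pos, one_lt_two⟩ fun _ hs =>
    M_pos_of_le_one h.temporal h.lipschitz hs.1 hs.2.le

lemma M_escapeTime_nonpos (h : IsReversingProfile φ Λ) : M φ (escapeTime φ) ≤ 0 := by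
  by_contra! hc
  have hcont : ContinuousOn (M φ) (Iio 2) :=
    (continuousOn_wallShear h.lipschitz isModulation_one).congr fun t _ => M_eq_wallShear φ t
  have hnear : ∀ᶠ t in 𝓝 (escapeTime φ), 0 < M φ t :=
    (hcont.continuousAt (Iio_mem_nhds h.escapeTime_lt_two)).eventually_const_lt hc
  obtain ⟨u, hu, hIco⟩ := exists_Ico_subset_of_mem_nhds hnear ⟨2, h.escapeTime_lt_two⟩
  obtain ⟨r, hr, hru⟩ := exists_between (lt_min hu h.escapeTime_lt_two)
  have hr0 : 0 < r := by linarith [h.one_le_escapeTime]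
  refine hr.not_ge (le_escapeTime ⟨hr0, hru.trans_le (min_le_right _ _)⟩ fun t ht => ?_)
  rcases lt_or_ge t (escapeTime φ) with hlt | hge
  · exact h.M_pos ⟨ht.1, hlt⟩
  · exact hIco ⟨hge, ht.2.trans (hru.trans_le (min_le_left _ _))⟩

lemma one_lt_escapeTime (h : IsReversingProfile φ Λ) : 1 < escapeTime φ := by
  refine h.one_le_escapeTime.lt_of_ne fun heq => ?_
  have := h.M_escapeTime_nonpos
  rw [← heq] at this
  exact this.not_gt (M_pos_of_le_one h.temporal h.lipschitz one_pos le_rfl)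

lemma pos_of_lt_escapeTime (h : IsReversingProfile φ Λ) (ht : t ∈ Ioo 0 (escapeTime φ)) :
    0 < φ t := by
  rcases le_or_gt t 1 with h1 | h1
  · exact h.temporal.pos_of_le_one h.lipschitz.continuousOn ht.1 h1
  · by_contra! hc
    have hneg := wallShear_one_neg h.temporal h.lipschitz h1 (ht.2.trans h.escapeTime_lt_two) hc
    rw [← M_eq_wallShear] at hneg
    exact hneg.not_gt (h.M_pos ht)

lemma nonneg_of_le_escapeTime (h : IsReversingProfile φ Λ) (ht : t ≤ escapeTime φ) : 0 ≤ φ t := by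
  have hlt : ∀ s < escapeTime φ, 0 ≤ φ s := fun s hs => by
    rcases le_or_gt s 0 with h0 | h0
    · rw [h.temporal.zero s h0]
    · exact (h.pos_of_lt_escapeTime ⟨h0, hs⟩).le
  rcases ht.eq_or_lt with rfl | ht
  · have hcont := h.lipschitz.continuousOn.continuousAt (Iio_mem_nhds h.escapeTime_lt_two)
    refine ge_of_tendsto (hcont.tendsto.mono_left (nhdsWithin_le_nhds (s := Iio (escapeTime φ)))) ?_
    filter_upwards [self_mem_nhdsWithin] using hlt
  · exact hlt t ht

end IsReversingProfile

/-- The first time at which the wall shear becomes negative. -/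
def reversalTime (φ ρ : ℝ → ℝ) : ℝ := sInf {t | t ∈ Ioo (0 : ℝ) 2 ∧ wallShear φ ρ t < 0}

section ReversalTime

variable {φ ρ : ℝ → ℝ} {t : ℝ}

lemma reversalTime_lt (hc : ContinuousOn (wallShear φ ρ) (Iio 2)) (ht : t ∈ Ioo (0 : ℝ) 2)
    (hneg : wallShear φ ρ t < 0) : reversalTime φ ρ < t := by
  have hnear : ∀ᶠ s in 𝓝[<] t, wallShear φ ρ s < 0 := nhdsWithin_le_nhds
    ((hc.continuousAt (Iio_mem_nhds ht.2)).eventually_lt_const hneg)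
  obtain ⟨s, hs, hst⟩ := (hnear.and (Ioo_mem_nhdsLT ht.1)).exists
  refine lt_of_le_of_lt (csInf_le ⟨0, fun x hx => hx.1.1.le⟩ ?_) hst.2
  exact ⟨⟨hst.1, hst.2.trans ht.2⟩, hs⟩

lemma wallShear_nonneg_of_lt (ht : t ∈ Ioo (0 : ℝ) 2) (hlt : t < reversalTime φ ρ) :
    0 ≤ wallShear φ ρ t := by
  by_contra! hc
  exact notMem_of_lt_csInf hlt ⟨0, fun x hx => hx.1.1.le⟩ ⟨ht, hc⟩

lemma le_reversalTime {r : ℝ} (ht : t ∈ Ioo (0 : ℝ) 2) (hneg : wallShear φ ρ t < 0)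
    (hr : ∀ s ∈ Ioc 0 r, 0 < wallShear φ ρ s) : r ≤ reversalTime φ ρ :=
  le_csInf ⟨t, ht, hneg⟩ fun s hs => not_lt.1 fun hsr =>
    (hr s ⟨hs.1.1, hsr.le⟩).not_gt hs.2

lemma exists_seq_reversalTime (hc : ContinuousOn (wallShear φ ρ) (Iio 2))
    (ht : t ∈ Ioo (0 : ℝ) 2) (hneg : wallShear φ ρ t < 0) :
    ∃ τ : ℕ → ℝ, (∀ k, reversalTime φ ρ < τ k) ∧ Tendsto τ atTop (𝓝 (reversalTime φ ρ)) ∧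
      ∀ k, τ k ∈ Ioo 0 2 ∧ wallShear φ ρ (τ k) < 0 := by
  obtain ⟨τ, -, hlim, hτ⟩ := exists_seq_tendsto_sInf
    (S := {t | t ∈ Ioo (0 : ℝ) 2 ∧ wallShear φ ρ t < 0}) ⟨t, ht, hneg⟩ ⟨0, fun x hx => hx.1.1.le⟩
  exact ⟨τ, fun k => reversalTime_lt hc (hτ k).1 (hτ k).2, hlim, hτ⟩

lemma wallShear_reversalTime_nonpos (hc : ContinuousOn (wallShear φ ρ) (Iio 2))
    (ht : t ∈ Ioo (0 : ℝ) 2) (hneg : wallShear φ ρ t < 0) :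
    wallShear φ ρ (reversalTime φ ρ) ≤ 0 := by
  obtain ⟨τ, -, hlim, hτ⟩ := exists_seq_reversalTime hc ht hneg
  have hlt := (reversalTime_lt hc ht hneg).trans ht.2
  exact le_of_tendsto' ((hc.continuousAt (Iio_mem_nhds hlt)).tendsto.comp hlim)
    fun k => (hτ k).2.le

end ReversalTime

namespace IsRatioFamily

variable {ρ : ℝ → ℝ → ℝ} {c B x : ℝ}

lemma sub_one_nonneg (hρ : IsRatioFamily ρ c B) (hx : c < x) {τ : ℝ} (hτ : τ ∈ Icc (0 : ℝ) 2) :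
    0 ≤ ρ x τ - 1 := by
  obtain ⟨e, he, hgrow⟩ := hρ.exists_le_sub_one x hx
  exact (mul_nonneg he.le hτ.1).trans (hgrow τ hτ)

lemma one_lt (hρ : IsRatioFamily ρ c B) (hx : c < x) {τ : ℝ} (hτ : τ ∈ Ioc (0 : ℝ) 2) :
    1 < ρ x τ := by
  obtain ⟨e, he, hgrow⟩ := hρ.exists_le_sub_one x hx
  linarith [mul_pos he hτ.1, hgrow τ (Ioc_subset_Icc_self hτ)]

lemma isModulation (hρ : IsRatioFamily ρ c B) (hx : c < x) :
    IsModulation (ρ x) (B / (x - 1) ^ 2) where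
  measurable := hρ.measurable x hx
  map_zero := hρ.map_zero x hx
  abs_sub_one_le τ hτ := by
    rw [abs_of_nonneg (hρ.sub_one_nonneg hx hτ)]; exact hρ.sub_one_le x hx τ hτ

lemma isModulation_half (hρ : IsRatioFamily ρ c B) (hx : c < x) : IsModulation (ρ x) (1 / 2) where
  measurable := hρ.measurable x hx
  map_zero := hρ.map_zero x hx
  abs_sub_one_le τ hτ := by
    rw [abs_of_nonneg (hρ.sub_one_nonneg hx hτ)]; exact hρ.sub_one_le_half x hx τ hτ

end IsRatioFamily

namespace IsReversingProfile

variable {φ : ℝ → ℝ} {ρ : ℝ → ℝ → ℝ} {Λ c B x t : ℝ}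

lemma escapeTime_mem (h : IsReversingProfile φ Λ) : escapeTime φ ∈ Ioo (0 : ℝ) 2 :=
  ⟨one_pos.trans h.one_lt_escapeTime, h.escapeTime_lt_two⟩

lemma wallShear_escapeTime_neg (h : IsReversingProfile φ Λ) (hρ : IsRatioFamily ρ c B)
    (hx : c < x) : wallShear φ (ρ x) (escapeTime φ) < 0 := by
  have hlt := wallShear_lt h.lipschitz isModulation_one (hρ.isModulation hx) h.escapeTime_mem.1
    h.escapeTime_lt_two (fun τ hτ => hρ.one_lt hx hτ) (fun s hs => h.nonneg_of_le_escapeTime hs)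
    h.temporal.pos
  rw [← M_eq_wallShear] at hlt
  exact hlt.trans_le h.M_escapeTime_nonpos

lemma continuousOn_wallShear (h : IsReversingProfile φ Λ) (hρ : IsRatioFamily ρ c B)
    (hx : c < x) : ContinuousOn (wallShear φ (ρ x)) (Iio 2) :=
  StokesHalfSpace.continuousOn_wallShear h.lipschitz (hρ.isModulation hx)

lemma wallShear_pos_of_le_one (h : IsReversingProfile φ Λ) (hρ : IsRatioFamily ρ c B)
    (hx : c < x) (ht : t ∈ Ioc (0 : ℝ) 1) : 0 < wallShear φ (ρ x) t :=
  StokesHalfSpace.wallShear_pos_of_le_one h.temporal h.lipschitz (hρ.isModulation_half hx)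
    ht.1 ht.2

lemma reversalTime_lt_escapeTime (h : IsReversingProfile φ Λ) (hρ : IsRatioFamily ρ c B)
    (hx : c < x) : reversalTime φ (ρ x) < escapeTime φ :=
  reversalTime_lt (h.continuousOn_wallShear hρ hx) h.escapeTime_mem
    (h.wallShear_escapeTime_neg hρ hx)

lemma wallShear_reversalTime_nonpos (h : IsReversingProfile φ Λ) (hρ : IsRatioFamily ρ c B)
    (hx : c < x) : wallShear φ (ρ x) (reversalTime φ (ρ x)) ≤ 0 :=
  StokesHalfSpace.wallShear_reversalTime_nonpos (h.continuousOn_wallShear hρ hx) h.escapeTime_mem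
    (h.wallShear_escapeTime_neg hρ hx)

lemma one_lt_reversalTime (h : IsReversingProfile φ Λ) (hρ : IsRatioFamily ρ c B) (hx : c < x) :
    1 < reversalTime φ (ρ x) := by
  refine (le_reversalTime h.escapeTime_mem (h.wallShear_escapeTime_neg hρ hx)
    fun s hs => h.wallShear_pos_of_le_one hρ hx hs).lt_of_ne fun heq => ?_
  have hneg := h.wallShear_reversalTime_nonpos hρ hx
  rw [← heq] at hneg
  exact hneg.not_gt (h.wallShear_pos_of_le_one hρ hx ⟨one_pos, le_rfl⟩)

lemma strictMonoOn_reversalTime (h : IsReversingProfile φ Λ) (hρ : IsRatioFamily ρ c B) :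
    StrictMonoOn (fun x => reversalTime φ (ρ x)) (Ioi c) := by
  intro x₁ h₁ x₂ h₂ hlt
  have hT := h.reversalTime_lt_escapeTime hρ h₂
  have hmem : reversalTime φ (ρ x₂) ∈ Ioo (0 : ℝ) 2 :=
    ⟨one_pos.trans (h.one_lt_reversalTime hρ h₂), hT.trans h.escapeTime_lt_two⟩
  refine reversalTime_lt (h.continuousOn_wallShear hρ h₁) hmem ?_
  refine (wallShear_lt h.lipschitz (hρ.isModulation h₂) (hρ.isModulation h₁) hmem.1 hmem.2
    (fun τ hτ => hρ.strictAntiOn τ hτ h₁ h₂ hlt)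
    (fun s hs => h.nonneg_of_le_escapeTime (hs.trans hT.le)) h.temporal.pos).trans_le
    (h.wallShear_reversalTime_nonpos hρ h₂)

lemma exists_pos_le_wallShear_one (h : IsReversingProfile φ Λ) {r : ℝ} (hr1 : 1 ≤ r)
    (hr : r < escapeTime φ) : ∃ μ > 0, ∀ t ∈ Icc 1 r, μ ≤ wallShear φ (fun _ => 1) t := by
  obtain ⟨m, hm, hmin⟩ := (isCompact_Icc (a := (1 : ℝ)) (b := r)).exists_isMinOn ⟨1, le_rfl, hr1⟩
    ((StokesHalfSpace.continuousOn_wallShear h.lipschitz isModulation_one).mono fun t ht =>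
      ht.2.trans_lt (hr.trans h.escapeTime_lt_two))
  refine ⟨_, ?_, fun t ht => hmin ht⟩
  rw [← M_eq_wallShear]
  exact h.M_pos ⟨one_pos.trans_le hm.1, hm.2.trans_lt hr⟩

lemma tendsto_reversalTime (h : IsReversingProfile φ Λ) (hρ : IsRatioFamily ρ c B) :
    Tendsto (fun x => reversalTime φ (ρ x)) atTop (𝓝 (escapeTime φ)) := by
  refine tendsto_order.2 ⟨fun l hl => ?_, fun u hu => ?_⟩
  · obtain ⟨r, hlr, hrT⟩ := exists_between (max_lt hl h.one_lt_escapeTime)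
    obtain ⟨hl_r, hr1⟩ := max_lt_iff.1 hlr
    obtain ⟨μ, hμ, hμ_le⟩ := h.exists_pos_le_wallShear_one hr1.le hrT
    have hlim : Tendsto (fun x : ℝ => 2 * Λ * (B / (x - 1) ^ 2) * (2 * √2)) atTop (𝓝 0) := by
      have hsq : Tendsto (fun x : ℝ => (x - 1) ^ 2) atTop atTop :=
        (tendsto_pow_atTop two_ne_zero).comp (tendsto_atTop_add_const_right _ (-1) tendsto_id)
      simpa using ((hsq.const_div_atTop B).const_mul (2 * Λ)).mul_const (2 * √2)
    filter_upwards [hlim.eventually_lt_const hμ, eventually_gt_atTop c] with x hxμ hx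
    refine hl_r.trans_le (le_reversalTime h.escapeTime_mem (h.wallShear_escapeTime_neg hρ hx)
      fun t ht => ?_)
    rcases le_total t 1 with ht1 | ht1
    · exact h.wallShear_pos_of_le_one hρ hx ⟨ht.1, ht1⟩
    · have ht2 : t < 2 := ht.2.trans_lt (hrT.trans h.escapeTime_lt_two)
      have hmod := hρ.isModulation hx
      have hB := hmod.const_nonneg
      have hΛ := h.lipschitz.const_nonneg
      have hgap := wallShear_one_sub_le h.lipschitz hmod ht.1.le ht2
        fun s hs => h.lipschitz.abs_le (hs.trans ht2)
      have hgap_le : 2 * Λ * (B / (x - 1) ^ 2) * (2 * √t) ≤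
          2 * Λ * (B / (x - 1) ^ 2) * (2 * √2) := by gcongr
      linarith [hμ_le t ⟨ht1, ht.2⟩]
  · filter_upwards [eventually_gt_atTop c] with x hx
    exact (h.reversalTime_lt_escapeTime hρ hx).trans hu

end IsReversingProfile

section WallSign

variable {φ : ℝ → ℝ} {ρ α : ℝ → ℝ → ℝ} {Λ c B C x t : ℝ}

lemma eventually_wallProfile_neg {ρ : ℝ → ℝ} (hφ : IsLipschitzProfile φ Λ) (hρ : IsModulation ρ B)
    (hα : IsWallFlux α C) (ht : t ∈ Ioo (0 : ℝ) 2) (hneg : wallShear φ ρ t < 0) :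
    ∀ᶠ r in 𝓝[>] 0, wallProfile φ ρ α t r < 0 := by
  filter_upwards [self_mem_nhdsWithin, (tendsto_wallProfile_div hφ hρ hα ht.1.le
    ht.2).eventually_lt_const (mul_neg_of_pos_of_neg passageConst_pos hneg)] with r hr hdiv
  exact neg_of_div_neg_left hdiv (mem_Ioi.1 hr).le

lemma IsReversingProfile.eventually_wallProfile_pos (h : IsReversingProfile φ Λ)
    (hρ : IsRatioFamily ρ c B) (hx : c < x) (hα : IsWallFlux α C)
    (hdrop : ∃ D ≥ 0, ∀ u τ, 0 < u → 0 ≤ τ → -(D * (u * τ)) ≤ α u τ - α u 0)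
    (ht : t ∈ Ioo 0 (reversalTime φ (ρ x))) : ∀ᶠ r in 𝓝[>] 0, 0 < wallProfile φ (ρ x) α t r := by
  have hmod := hρ.isModulation hx
  have htT := ht.2.trans (h.reversalTime_lt_escapeTime hρ hx)
  have ht2 := htT.trans h.escapeTime_lt_two
  rcases le_or_gt t 1 with ht1 | ht1
  · filter_upwards [self_mem_nhdsWithin, (tendsto_wallProfile_div h.lipschitz hmod hα ht.1.le
      ht2).eventually_const_lt (mul_pos passageConst_pos
        (h.wallShear_pos_of_le_one hρ hx ⟨ht.1, ht1⟩))] with r hr hdiv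
    exact (div_pos_iff_of_pos_right hr).1 hdiv
  · obtain ⟨e, he, hgrow⟩ := hρ.exists_le_sub_one x hx
    obtain ⟨D, hD, hdrop⟩ := hdrop
    exact StokesHalfSpace.eventually_wallProfile_pos h.lipschitz hmod hα ht1 ht2
      (h.pos_of_lt_escapeTime ⟨ht.1, htT⟩)
      (fun s hs => h.nonneg_of_le_escapeTime (hs.trans htT.le))
      (fun s hs => h.temporal.anti ⟨hs.1, hs.2.trans ht2⟩ ⟨ht1, ht2⟩ hs.2.le) he hgrow hD hdrop
      (wallShear_nonneg_of_lt ⟨ht.1, ht2⟩ ht.2)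

end WallSign

/-! ### Derivatives of the kernels -/

section Coordinates

variable {d : ℕ}

lemma joinPt_castSucc (z : Eu d) (r : ℝ) (i : Fin d) : joinPt z r i.castSucc = z i := by
  simp [joinPt]

lemma joinPt_last (z : Eu d) (r : ℝ) : joinPt z r (Fin.last d) = r := by
  simp [joinPt]

lemma joinPt_sub (z w : Eu d) (r q : ℝ) : joinPt z r - joinPt w q = joinPt (z - w) (r - q) := by
  ext j
  refine Fin.lastCases ?_ (fun i => ?_) j
  · simp only [PiLp.sub_apply, joinPt_last]
  · simp only [PiLp.sub_apply, joinPt_castSucc]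

lemma joinPt_add_smul_axis_last (z : Eu d) (r ε : ℝ) :
    joinPt z r + ε • axis (Fin.last d) = joinPt z (r + ε) := by
  ext j
  refine Fin.lastCases ?_ (fun i => ?_) j
  · simp [joinPt_last, axis]
  · simp [joinPt_castSucc, axis]

lemma norm_sq_joinPt (z : Eu d) (r : ℝ) : ‖joinPt z r‖ ^ 2 = ‖z‖ ^ 2 + r ^ 2 := by
  rw [EuclideanSpace.real_norm_sq_eq, EuclideanSpace.real_norm_sq_eq, Fin.sum_univ_castSucc]
  simp only [joinPt_castSucc, joinPt_last]

lemma partialD_last_joinPt (f : Eu (d + 1) → ℝ) (z : Eu d) (r : ℝ) :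
    partialD (Fin.last d) f (joinPt z r) = deriv (fun ρ => f (joinPt z ρ)) r := by
  simp only [partialD, lineDeriv, joinPt_add_smul_axis_last]
  rw [deriv_comp_const_add (f := fun ρ => f (joinPt z ρ)), add_zero]

end Coordinates

section NewtonKernel

variable {k : ℕ} {x : Eu k}

lemma partialD_comp_norm_sq {f : ℝ → ℝ} {f' : ℝ} (j : Fin k) (hf : HasDerivAt f f' (‖x‖ ^ 2)) :
    partialD j (fun y => f (‖y‖ ^ 2)) x = f' * (2 * x j) := by
  have hinner : inner ℝ x (axis j) = x j := by simp [axis, EuclideanSpace.inner_single_right]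
  have hline : HasDerivAt (fun ε : ℝ => x + ε • axis j) (axis j) 0 := by
    simpa using ((hasDerivAt_id (0 : ℝ)).smul_const (axis j : Eu k)).const_add x
  have hsq := hline.norm_sq
  rw [zero_smul, add_zero, hinner] at hsq
  refine (HasDerivAt.comp 0 ?_ hsq).deriv
  rwa [zero_smul, add_zero]

lemma unitBallVolume_pos (k : ℕ) : 0 < unitBallVolume k :=
  ENNReal.toReal_pos (Metric.measure_ball_pos _ _ one_pos).ne' measure_ball_lt_top.ne

lemma unitBallVolume_two : unitBallVolume 2 = Real.pi := by
  rw [unitBallVolume, Measure.real, EuclideanSpace.volume_ball_fin_two]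
  simp [Real.pi_pos.le]

lemma partialD_newtonKernel (hk : 2 ≤ k) (j : Fin k) (hx : 0 < ‖x‖ ^ 2) :
    partialD j newtonKernel x = (‖x‖ ^ 2) ^ (-(k : ℝ) / 2) / (k * unitBallVolume k) * x j := by
  rcases hk.eq_or_lt with rfl | hk
  · have hN : newtonKernel = fun y : Eu 2 => 1 / (4 * Real.pi) * Real.log (‖y‖ ^ 2) := by
      ext y
      rw [newtonKernel, if_pos rfl, Real.log_pow]
      push_cast; field_simp; ring
    rw [hN, partialD_comp_norm_sq j ((Real.hasDerivAt_log hx.ne').const_mul _),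
      unitBallVolume_two, Nat.cast_two, neg_div_self two_ne_zero, Real.rpow_neg_one]
    field_simp; norm_num
  · have hk' : (2 : ℝ) < k := by exact_mod_cast hk
    have hk0 : (k : ℝ) - 2 ≠ 0 := by linarith
    have hω := (unitBallVolume_pos k).ne'
    have hN : newtonKernel = fun y : Eu k =>
        -(1 / (k * ((k : ℝ) - 2) * unitBallVolume k)) * (‖y‖ ^ 2) ^ ((2 - (k : ℝ)) / 2) := by
      ext y
      rw [newtonKernel, if_neg hk.ne', ← Real.rpow_natCast, ← Real.rpow_mul (norm_nonneg _),
        Nat.cast_two, mul_div_cancel₀ _ two_ne_zero]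
    rw [hN, partialD_comp_norm_sq j ((Real.hasDerivAt_rpow_const (Or.inl hx.ne')).const_mul _),
      show (2 - (k : ℝ)) / 2 - 1 = -(k : ℝ) / 2 by ring]
    field_simp; ring

lemma potential_zero_time (s m u : ℝ) : potential s m u 0 = potential s (m + u ^ 2) 0 0 := by
  refine setIntegral_congr_fun measurableSet_Ioi fun σ _ => ?_
  simp only [radialHeat, lineHeat_zero, add_zero]
  rw [lineHeat, neg_add, add_div, Real.exp_add]
  ring

/-- The constant `κ` in `D_{x_i} N(z, h) = κ zᵢ potential (|z|², h, 0)`. -/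
def newtonConst (d : ℕ) : ℝ :=
  1 / (((d + 1 : ℕ) : ℝ) * unitBallVolume (d + 1) * potential ((d : ℝ) / 2 + 1) 1 0 0)

lemma newtonConst_pos (d : ℕ) : 0 < newtonConst d := by
  have hω := unitBallVolume_pos (d + 1)
  have hp := potential_pos (one_le_half_add_one d) one_pos le_rfl 0
  unfold newtonConst; positivity

lemma partialD_newtonKernel_joinPt {d : ℕ} (i : Fin d) (z : Eu d) {h : ℝ}
    (hzh : 0 < ‖z‖ ^ 2 + h ^ 2) : partialD i.castSucc newtonKernel (joinPt z h) =
      newtonConst d * (z i * potential ((d : ℝ) / 2 + 1) (‖z‖ ^ 2) h 0) := by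
  have hp := (potential_pos (one_le_half_add_one d) one_pos le_rfl 0).ne'
  rw [← norm_sq_joinPt] at hzh
  rw [partialD_newtonKernel (Nat.succ_le_succ i.pos) _ hzh, potential_zero_time, ← norm_sq_joinPt,
    potential_scale hzh le_rfl, zero_div, zero_div, joinPt_castSucc, newtonConst,
    show (1 / 2 - ((d : ℝ) / 2 + 1)) = -((d + 1 : ℕ) : ℝ) / 2 by push_cast; ring]
  generalize potential ((d : ℝ) / 2 + 1) 1 0 0 = p at hp ⊢
  field_simp

end NewtonKernel

section HeatKernel

variable {d : ℕ} {t : ℝ}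

lemma heatKernel_joinPt (z : Eu d) (r : ℝ) (ht : 0 < t) :
    heatKernel (joinPt z r) t = heatKernel z t * (passageConst * lineHeat r t) := by
  have hsqrt : (4 * Real.pi * t) ^ (-(1 / 2) : ℝ) = passageConst * t ^ (-(1 / 2) : ℝ) := by
    rw [Real.mul_rpow (by positivity) ht.le, Real.rpow_neg (by positivity), ← Real.sqrt_eq_rpow,
      Real.sqrt_mul (by norm_num), show (4 : ℝ) = 2 ^ 2 by norm_num,
      Real.sqrt_sq (by norm_num), passageConst]
    ring
  rw [heatKernel, heatKernel, lineHeat, if_pos ht, if_pos ht, norm_sq_joinPt,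
    show -((d + 1 : ℕ) : ℝ) / 2 = -(d : ℝ) / 2 + -(1 / 2) by push_cast; ring,
    Real.rpow_add (by positivity), hsqrt, neg_add, add_div, Real.exp_add]
  ring

lemma partialD_heatKernel_joinPt (z : Eu d) (r : ℝ) (ht : 0 < t) :
    partialD (Fin.last d) (fun z => heatKernel z t) (joinPt z r) =
      -(1 / 2) * passageConst * passageDensity r t * heatKernel z t := by
  simp_rw [partialD_last_joinPt, heatKernel_joinPt z _ ht]
  rw [(((hasDerivAt_lineHeat r ht).const_mul _).const_mul _).deriv]
  ring

lemma heatKernel_nonneg (x : Eu d) (t : ℝ) : 0 ≤ heatKernel x t := by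
  have := Real.pi_pos
  unfold heatKernel
  split_ifs <;> positivity

lemma continuous_heatKernel (t : ℝ) : Continuous (fun x : Eu d => heatKernel x t) := by
  unfold heatKernel
  split_ifs <;> fun_prop

end HeatKernel

/-! ### Convolution with the tangential heat kernel -/

section GaussianConvolution

variable {d : ℕ} {b σ τ : ℝ}

lemma abs_mul_exp_neg_sq_le (hb : 0 < b) (x : ℝ) : |x| * Real.exp (-b * x ^ 2) ≤ 1 / √b := by
  have hexp := Real.add_one_le_exp (b * x ^ 2)
  have hsq : b * x ^ 2 = (√b * |x|) ^ 2 := by rw [mul_pow, Real.sq_sqrt hb.le, sq_abs]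
  rw [le_div_iff₀ (Real.sqrt_pos.2 hb), neg_mul, Real.exp_neg, mul_right_comm,
    mul_inv_le_iff₀ (Real.exp_pos _), one_mul, mul_comm]
  nlinarith [sq_nonneg (√b * |x| - 1)]

lemma integrable_exp_neg_mul_norm_sq (hb : 0 < b) :
    Integrable (fun v : Eu d => Real.exp (-b * ‖v‖ ^ 2)) := by
  refine Integrable.of_integral_ne_zero ?_
  rw [GaussianFourier.integral_rexp_neg_mul_sq_norm hb]
  have := Real.pi_pos
  positivity

lemma integrable_coord_mul_exp (i : Fin d) (hb : 0 < b) :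
    Integrable (fun v : Eu d => v i * Real.exp (-b * ‖v‖ ^ 2)) := by
  refine ((integrable_exp_neg_mul_norm_sq (half_pos hb)).const_mul (1 / √(b / 2))).mono'
    (by fun_prop) (ae_of_all _ fun v => ?_)
  have hsplit : -b * ‖v‖ ^ 2 = -(b / 2) * ‖v‖ ^ 2 + -(b / 2) * ‖v‖ ^ 2 := by ring
  have hbound := abs_mul_exp_neg_sq_le (half_pos hb) ‖v‖
  rw [abs_norm] at hbound
  rw [norm_mul, Real.norm_of_nonneg (Real.exp_pos _).le, Real.norm_eq_abs, hsplit, Real.exp_add,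
    ← mul_assoc]
  gcongr
  exact (mul_le_mul_of_nonneg_right (abs_coord_le i v) (Real.exp_pos _).le).trans hbound

lemma integral_coord_mul_exp (i : Fin d) (b : ℝ) :
    ∫ v : Eu d, v i * Real.exp (-b * ‖v‖ ^ 2) = 0 := by
  have hodd := integral_neg_eq_self (fun v : Eu d => v i * Real.exp (-b * ‖v‖ ^ 2)) volume
  simp only [PiLp.neg_apply, norm_neg, neg_mul, integral_neg] at hodd ⊢
  linarith

lemma integral_sub_coord_mul_exp (i : Fin d) (hb : 0 < b) (c : ℝ) :
    ∫ v : Eu d, (c - v i) * Real.exp (-b * ‖v‖ ^ 2) = c * (Real.pi / b) ^ ((d : ℝ) / 2) := by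
  simp only [sub_mul]
  rw [integral_sub ((integrable_exp_neg_mul_norm_sq hb).const_mul c)
    (integrable_coord_mul_exp i hb), integral_const_mul, integral_coord_mul_exp,
    GaussianFourier.integral_rexp_neg_mul_sq_norm hb, finrank_euclideanSpace_fin, sub_zero]

lemma integrable_heatKernel (ht : 0 < τ) : Integrable (fun x : Eu d => heatKernel x τ) := by
  refine ((integrable_exp_neg_mul_norm_sq (b := 1 / (4 * τ)) (by positivity)).const_mul
    ((4 * Real.pi * τ) ^ (-(d : ℝ) / 2))).congr (ae_of_all _ fun v => ?_)
  simp only [heatKernel, if_pos ht]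
  congr 2; ring

-- Completing the square around the minimizer `(τ / (σ + τ)) z` of the exponent.
lemma exp_neg_norm_sq_mul_exp_neg_norm_sq (hσ : 0 < σ) (hτ : 0 < τ) (v z : Eu d) :
    Real.exp (-‖v + (τ / (σ + τ)) • z‖ ^ 2 / (4 * τ)) *
        Real.exp (-‖z - (v + (τ / (σ + τ)) • z)‖ ^ 2 / (4 * σ)) =
      Real.exp (-‖z‖ ^ 2 / (4 * (σ + τ))) *
        Real.exp (-((σ + τ) / (4 * σ * τ)) * ‖v‖ ^ 2) := by
  have hsub : z - (v + (τ / (σ + τ)) • z) = (σ / (σ + τ)) • z - v := by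
    rw [show σ / (σ + τ) = 1 - τ / (σ + τ) by field_simp; ring]; module
  rw [hsub, norm_add_sq_real, norm_sub_sq_real, real_inner_smul_right, real_inner_smul_left,
    norm_smul, norm_smul, mul_pow, mul_pow, Real.norm_eq_abs, Real.norm_eq_abs, sq_abs, sq_abs,
    real_inner_comm, ← Real.exp_add, ← Real.exp_add]
  congr 1
  field_simp
  ring

lemma integral_heatKernel_mul_radialHeat (i : Fin d) (z : Eu d) (hσ : 0 < σ) (hτ : 0 < τ) :
    ∫ w : Eu d, heatKernel w τ * ((z - w) i * radialHeat ((d : ℝ) / 2 + 1) (‖z - w‖ ^ 2) σ) =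
      z i * radialHeat ((d : ℝ) / 2 + 1) (‖z‖ ^ 2) (σ + τ) := by
  set C : ℝ := (4 * Real.pi * τ) ^ (-(d : ℝ) / 2) * σ ^ (-((d : ℝ) / 2 + 1)) *
    Real.exp (-‖z‖ ^ 2 / (4 * (σ + τ))) with hC
  have hshift : ∀ v : Eu d, heatKernel (v + (τ / (σ + τ)) • z) τ *
      ((z - (v + (τ / (σ + τ)) • z)) i *
        radialHeat ((d : ℝ) / 2 + 1) (‖z - (v + (τ / (σ + τ)) • z)‖ ^ 2) σ) =
      C * ((σ / (σ + τ) * z i - v i) * Real.exp (-((σ + τ) / (4 * σ * τ)) * ‖v‖ ^ 2)) := fun v => by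
    have hcoord : (z - (v + (τ / (σ + τ)) • z)) i = σ / (σ + τ) * z i - v i := by
      simp only [PiLp.sub_apply, PiLp.add_apply, PiLp.smul_apply, smul_eq_mul]
      field_simp; ring
    rw [hcoord, heatKernel, if_pos hτ, radialHeat, hC]
    linear_combination (4 * Real.pi * τ) ^ (-(d : ℝ) / 2) * σ ^ (-((d : ℝ) / 2 + 1)) *
      (σ / (σ + τ) * z i - v i) * exp_neg_norm_sq_mul_exp_neg_norm_sq hσ hτ v z
  have hmass : (Real.pi / ((σ + τ) / (4 * σ * τ))) ^ ((d : ℝ) / 2) *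
      (4 * Real.pi * τ) ^ (-(d : ℝ) / 2) = (σ / (σ + τ)) ^ ((d : ℝ) / 2) := by
    rw [show Real.pi / ((σ + τ) / (4 * σ * τ)) = (4 * Real.pi * τ) * (σ / (σ + τ)) by field_simp,
      Real.mul_rpow (by positivity) (by positivity), neg_div, Real.rpow_neg (by positivity)]
    field_simp
  have hpow : (σ / (σ + τ)) ^ ((d : ℝ) / 2) * (σ / (σ + τ)) * σ ^ (-((d : ℝ) / 2 + 1)) =
      (σ + τ) ^ (-((d : ℝ) / 2 + 1)) := by
    rw [← Real.rpow_add_one (by positivity), Real.div_rpow hσ.le (by positivity),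
      Real.rpow_neg hσ.le, Real.rpow_neg (by positivity)]
    field_simp
  rw [← integral_add_right_eq_self _ ((τ / (σ + τ)) • z)]
  simp_rw [hshift]
  rw [integral_const_mul, integral_sub_coord_mul_exp i (by positivity), radialHeat, hC, ← hpow,
    ← hmass]
  ring

lemma integrableOn_radialHeat {s m : ℝ} (hs : 3 / 2 ≤ s) (hm : 0 < m) :
    IntegrableOn (radialHeat s m) (Ioi 0) := by
  refine (integrableOn_potential (s := s - 1 / 2) (by linarith) hm le_rfl 0).congr_fun
    (fun σ (hσ : 0 < σ) => ?_) measurableSet_Ioi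
  simp only [lineHeat_zero, radialHeat, add_zero]
  rw [mul_right_comm, ← Real.rpow_add hσ]
  congr 2; ring

lemma abs_coord_mul_radialHeat_mul_lineHeat_le (i : Fin d) (z : Eu d) (s h : ℝ) (hσ : 0 < σ) :
    |z i * (radialHeat s (‖z‖ ^ 2) σ * lineHeat h σ)| ≤ 2 * radialHeat s (h ^ 2) σ := by
  have hcoord : |z i| * Real.exp (-‖z‖ ^ 2 / (4 * σ)) ≤ 2 * √σ := by
    have hexp := abs_mul_exp_neg_sq_le (b := 1 / (4 * σ)) (by positivity) ‖z‖
    rw [abs_norm, neg_mul, one_div_mul_eq_div, ← neg_div, one_div (4 * σ), Real.sqrt_inv, one_div,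
      inv_inv, Real.sqrt_mul (by norm_num), show (4 : ℝ) = 2 ^ 2 by norm_num,
      Real.sqrt_sq (by norm_num)] at hexp
    norm_num at hexp ⊢
    exact (mul_le_mul_of_nonneg_right (abs_coord_le i z) (Real.exp_pos _).le).trans hexp
  have hsqrt : √σ * σ ^ (-(1 / 2) : ℝ) = 1 := by
    rw [Real.sqrt_eq_rpow, ← Real.rpow_add hσ]; norm_num
  rw [abs_mul, abs_of_nonneg (mul_nonneg (radialHeat_nonneg hσ.le) (lineHeat_pos hσ).le)]
  calc _ = |z i| * Real.exp (-‖z‖ ^ 2 / (4 * σ)) *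
        (σ ^ (-s) * σ ^ (-(1 / 2) : ℝ) * Real.exp (-h ^ 2 / (4 * σ))) := by
        unfold radialHeat lineHeat; ring
    _ ≤ 2 * √σ * (σ ^ (-s) * σ ^ (-(1 / 2) : ℝ) * Real.exp (-h ^ 2 / (4 * σ))) := by gcongr
    _ = _ := by
        unfold radialHeat
        linear_combination 2 * (σ ^ (-s) * Real.exp (-h ^ 2 / (4 * σ))) * hsqrt

lemma integrable_heatKernel_mul_potential_integrand {s h : ℝ} (hs : 3 / 2 ≤ s) (i : Fin d)
    (z : Eu d) (hτ : 0 < τ) (hh : 0 < h) :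
    Integrable (fun p : Eu d × ℝ => heatKernel p.1 τ *
      ((z - p.1) i * (radialHeat s (‖z - p.1‖ ^ 2) p.2 * lineHeat h p.2)))
      (volume.prod (volume.restrict (Ioi 0))) := by
  have hheat : Measurable fun p : Eu d × ℝ => heatKernel p.1 τ :=
    (continuous_heatKernel τ).measurable.comp measurable_fst
  refine ((integrable_heatKernel hτ).mul_prod ((integrableOn_radialHeat hs
    (pow_pos hh 2)).const_mul 2)).mono' (hheat.mul (by fun_prop)).aestronglyMeasurable ?_
  have hpos : ∀ᵐ p ∂(volume : Measure (Eu d)).prod (volume.restrict (Ioi (0 : ℝ))), 0 < p.2 :=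
    Measure.quasiMeasurePreserving_snd.ae (ae_restrict_mem measurableSet_Ioi)
  filter_upwards [hpos] with p hp
  rw [norm_mul, Real.norm_of_nonneg (heatKernel_nonneg p.1 τ)]
  exact mul_le_mul_of_nonneg_left (abs_coord_mul_radialHeat_mul_lineHeat_le i _ s h hp)
    (heatKernel_nonneg p.1 τ)

lemma integral_heatKernel_mul_potential (i : Fin d) (z : Eu d) {h : ℝ} (hτ : 0 < τ)
    (hh : 0 < h) :
    ∫ w : Eu d, heatKernel w τ * ((z - w) i * potential ((d : ℝ) / 2 + 1) (‖z - w‖ ^ 2) h 0) =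
      z i * potential ((d : ℝ) / 2 + 1) (‖z‖ ^ 2) h τ := by
  have hs : 3 / 2 ≤ (d : ℝ) / 2 + 1 := by
    have : (1 : ℝ) ≤ d := by exact_mod_cast i.pos
    linarith
  simp only [potential, add_zero, ← integral_const_mul]
  rw [integral_integral_swap (integrable_heatKernel_mul_potential_integrand hs i z hτ hh)]
  refine setIntegral_congr_fun measurableSet_Ioi fun σ hσ => ?_
  rw [← mul_assoc, ← integral_heatKernel_mul_radialHeat i z hσ hτ, ← integral_mul_const]
  congr! 2
  ring

end GaussianConvolution

/-! ### The Poisson kernel -/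

section OneSidedConvolution

variable {p f f' F F' : ℝ → ℝ} {K : NNReal} {R b : ℝ}

lemma lipschitzOnWith_comp_max_zero (hb : 0 < b) (hf : Continuous f)
    (hf' : ∀ u > 0, HasDerivAt f (f' u) u) (hK : ∀ u ∈ Ioo 0 b, ‖f' u‖₊ ≤ K) :
    LipschitzOnWith K (fun v => f (max v 0)) (Iic b) := by
  have hIoo : LipschitzOnWith K f (Ioo 0 b) :=
    (convex_Ioo 0 b).lipschitzOnWith_of_nnnorm_hasDerivWithin_le
      (fun u hu => (hf' u hu.1).hasDerivWithinAt) hK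
  have hIcc : LipschitzOnWith K f (Icc 0 b) :=
    closure_Ioo hb.ne ▸ hIoo.closure hf.continuousOn
  have hmax : LipschitzOnWith 1 (fun v : ℝ => max v 0) (Iic b) :=
    (LipschitzWith.id.max_const 0).lipschitzOnWith
  simpa only [mul_one, Function.comp_def] using
    hIcc.comp hmax fun v hv => ⟨le_max_right _ _, max_le hv hb.le⟩

lemma hasDerivAt_comp_max_zero (hf' : ∀ u > 0, HasDerivAt f (f' u) u) {v : ℝ} (hv : v ≠ 0) :
    HasDerivAt (fun v => f (max v 0)) ((Ioi 0).indicator f' v) v := by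
  rcases hv.lt_or_gt with hv | hv
  · rw [indicator_of_notMem (notMem_Ioi.2 hv.le)]
    refine (hasDerivAt_const v (f 0)).congr_of_eventuallyEq ?_
    filter_upwards [Iio_mem_nhds hv] with w hw
    rw [max_eq_right (le_of_lt hw)]
  · rw [indicator_of_mem (mem_Ioi.2 hv)]
    refine (hf' v hv).congr_of_eventuallyEq ?_
    filter_upwards [Ioi_mem_nhds hv] with w hw
    rw [max_eq_left (le_of_lt hw)]

lemma hasDerivAt_integral_mul_comp_sub (hp : Continuous p) (hF : Continuous F)
    (hlip : LipschitzOnWith K F (Iic b)) (hF' : ∀ v ≠ 0, HasDerivAt F (F' v) v) (hR : R < b) :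
    HasDerivAt (fun r => ∫ ρ in Ioc 0 b, p ρ * F (r - ρ))
      (∫ ρ in Ioc 0 b, p ρ * F' (R - ρ)) R := by
  have hlip' : ∀ ρ ∈ Ioc 0 b,
      LipschitzOnWith (Real.nnabs (|p ρ| * K)) (fun r => p ρ * F (r - ρ)) (Iio b) :=
    fun ρ hρ => LipschitzOnWith.of_dist_le_mul fun v hv w hw => by
      have hvw := hlip.dist_le_mul (v - ρ) (by simp only [mem_Iio, mem_Iic] at *; linarith [hρ.1])
        (w - ρ) (by simp only [mem_Iio, mem_Iic] at *; linarith [hρ.1])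
      rw [dist_sub_right] at hvw
      rw [Real.coe_nnabs, abs_of_nonneg (by positivity), Real.dist_eq, ← mul_sub, abs_mul,
        mul_assoc]
      exact mul_le_mul_of_nonneg_left hvw (abs_nonneg _)
  have hne : ∀ᵐ ρ ∂volume.restrict (Ioc 0 b), R - ρ ≠ 0 :=
    ae_restrict_of_ae ((Measure.ae_ne volume R).mono fun ρ hρ => sub_ne_zero.2 hρ.symm)
  have hmeas : AEStronglyMeasurable (fun ρ => F' (R - ρ)) (volume.restrict (Ioc 0 b)) :=
    ((measurable_deriv F).comp (measurable_const.sub measurable_id)).aestronglyMeasurable.congr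
      (hne.mono fun ρ hρ => (hF' _ hρ).deriv)
  have hint {g : ℝ → ℝ} (hg : Continuous g) : IntegrableOn g (Ioc 0 b) :=
    hg.integrableOn_Icc.mono_set Ioc_subset_Icc_self
  exact (hasDerivAt_integral_of_dominated_loc_of_lip (Iio_mem_nhds hR)
    (Eventually.of_forall fun r => Continuous.aestronglyMeasurable (by fun_prop))
    (hint (by fun_prop))
    (hp.aestronglyMeasurable.mul hmeas)
    (ae_restrict_of_forall_mem measurableSet_Ioc hlip') (hint (by fun_prop))
    (hne.mono fun ρ hρ => ((hF' _ hρ).comp_sub_const R ρ).const_mul (p ρ))).2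

lemma hasDerivAt_one_sided_convolution (hR : 0 < R) (hp : Continuous p) (hf : Continuous f)
    (hf' : ∀ u > 0, HasDerivAt f (f' u) u) (hK : ∀ u ∈ Ioo 0 (R + 1), ‖f' u‖₊ ≤ K) :
    HasDerivAt (fun R => ∫ ρ in (0 : ℝ)..R, p ρ * f (R - ρ))
      (p R * f 0 + ∫ ρ in Ioc 0 R, p ρ * f' (R - ρ)) R := by
  -- The increment of `f` from `0`, extended by `0`, makes the domain of integration fixed.
  set F : ℝ → ℝ := fun v => f (max v 0) - f 0 with hF
  have hlip : LipschitzOnWith K F (Iic (R + 1)) :=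
    LipschitzOnWith.of_dist_le_mul fun v hv w hw => by
      rw [dist_sub_right]
      exact (lipschitzOnWith_comp_max_zero (by linarith) hf hf' hK).dist_le_mul v hv w hw
  have hvanish {r ρ : ℝ} (hρ : ρ ∈ Ioc 0 (R + 1) \ Ioc 0 r) : r - ρ ≤ 0 :=
    sub_nonpos.2 (le_of_not_ge fun h => hρ.2 ⟨hρ.1.1, h⟩)
  have hsplit : ∀ᶠ r in 𝓝 R, ∫ ρ in (0 : ℝ)..r, p ρ * f (r - ρ) =
      (∫ ρ in (0 : ℝ)..r, p ρ) * f 0 + ∫ ρ in Ioc 0 (R + 1), p ρ * F (r - ρ) := by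
    filter_upwards [Ioo_mem_nhds hR (lt_add_one R)] with r hr
    rw [setIntegral_eq_of_subset_of_forall_sdiff_eq_zero measurableSet_Ioc
      (Ioc_subset_Ioc_right hr.2.le) fun ρ hρ => by simp [hF, max_eq_right (hvanish hρ)],
      ← intervalIntegral.integral_of_le hr.1.le, ← intervalIntegral.integral_mul_const,
      ← intervalIntegral.integral_add (Continuous.intervalIntegrable (by fun_prop) _ _)
        (Continuous.intervalIntegrable (by fun_prop) _ _)]
    refine intervalIntegral.integral_congr fun ρ hρ => ?_
    rw [uIcc_of_le hr.1.le] at hρ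
    simp only [hF, max_eq_left (sub_nonneg.2 hρ.2)]
    ring
  have hderiv : ∫ ρ in Ioc 0 R, p ρ * f' (R - ρ) =
      ∫ ρ in Ioc 0 (R + 1), p ρ * (Ioi 0).indicator f' (R - ρ) := by
    rw [integral_Ioc_eq_integral_Ioo, setIntegral_eq_of_subset_of_forall_sdiff_eq_zero
      measurableSet_Ioc (Ioo_subset_Ioc_self.trans (Ioc_subset_Ioc_right (lt_add_one R).le))]
    · refine setIntegral_congr_fun measurableSet_Ioo fun ρ hρ => ?_
      rw [indicator_of_mem (mem_Ioi.2 (sub_pos.2 hρ.2))]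
    · intro ρ hρ
      rw [indicator_of_notMem (s := Ioi 0) fun h => hρ.2 ⟨hρ.1.1, sub_pos.1 h⟩, mul_zero]
  rw [hderiv]
  exact (((hp.integral_hasStrictDerivAt 0 R).hasDerivAt.mul_const (f 0)).add
    (hasDerivAt_integral_mul_comp_sub hp (by fun_prop) hlip
      (fun v hv => (hasDerivAt_comp_max_zero hf' hv).sub_const (f 0))
      (lt_add_one R))).congr_of_eventuallyEq hsplit

end OneSidedConvolution

section PoissonKernel

variable {d : ℕ} {s m r τ : ℝ}

lemma continuous_passageDensity (τ : ℝ) : Continuous (fun u => passageDensity u τ) := by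
  unfold passageDensity; fun_prop

/-- The profile in the normal variable `r` of the tangential entries `L_{in}`. -/
def tensorProfile (s r τ m : ℝ) : ℝ :=
  passageDensity r τ * potential s m 0 τ -
    ∫ u in Ioc 0 r, passageDensity (r - u) τ * potentialFlux s m u τ

lemma hasDerivAt_integral_passageDensity_mul_potential (hs : 1 ≤ s) (hm : 0 < m) (hr : 0 < r)
    (hτ : 0 ≤ τ) :
    HasDerivAt (fun r => ∫ ρ in (0 : ℝ)..r, passageDensity ρ τ * potential s m (r - ρ) τ)
      (tensorProfile s r τ m) r := by
  have hbound : ∀ u ∈ Ioo 0 (r + 1),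
      ‖-potentialFlux s m u τ‖₊ ≤ (potentialFluxBound s m * (r + 1 + τ)).toNNReal :=
    fun u hu => by
      rw [nnnorm_neg, Real.nnnorm_of_nonneg (potentialFlux_nonneg hτ hu.1.le),
        ← NNReal.coe_le_coe, NNReal.coe_mk]
      refine ((potentialFlux_le hs hm le_rfl hτ hu.1).trans ?_).trans (Real.le_coe_toNNReal _)
      have := potentialFluxBound_nonneg s m
      gcongr
      exact hu.2.le
  have hreflect : ∫ ρ in Ioc 0 r, passageDensity ρ τ * -potentialFlux s m (r - ρ) τ =
      -∫ u in Ioc 0 r, passageDensity (r - u) τ * potentialFlux s m u τ := by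
    rw [← intervalIntegral.integral_of_le hr.le, ← intervalIntegral.integral_of_le hr.le]
    simpa using intervalIntegral.integral_comp_sub_left (a := 0) (b := r)
      (fun u => passageDensity (r - u) τ * -potentialFlux s m u τ) r
  have hconv := hasDerivAt_one_sided_convolution hr (continuous_passageDensity τ)
    (continuous_potential hs hm hτ) (fun u hu => hasDerivAt_potential hs hm hτ hu) hbound
  rwa [hreflect, ← sub_eq_add_neg] at hconv

lemma integral_partialD_heatKernel_mul_newtonKernel (i : Fin d) (z : Eu d) {q : ℝ}
    (hτ : 0 < τ) (hq : q < r) :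
    ∫ w : Eu d, partialD (Fin.last d) (fun z => heatKernel z τ) (joinPt w q) *
        partialD i.castSucc newtonKernel (joinPt z r - joinPt w q) =
      -(1 / 2) * passageConst * newtonConst d * z i *
        (passageDensity q τ * potential ((d : ℝ) / 2 + 1) (‖z‖ ^ 2) (r - q) τ) := by
  have hrq := sub_pos.2 hq
  have hintegrand : ∀ w : Eu d,
      partialD (Fin.last d) (fun z => heatKernel z τ) (joinPt w q) *
        partialD i.castSucc newtonKernel (joinPt z r - joinPt w q) =
      -(1 / 2) * passageConst * newtonConst d * passageDensity q τ * (heatKernel w τ *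
        ((z - w) i * potential ((d : ℝ) / 2 + 1) (‖z - w‖ ^ 2) (r - q) 0)) := fun w => by
    rw [partialD_heatKernel_joinPt w q hτ, joinPt_sub,
      partialD_newtonKernel_joinPt i (z - w) (by positivity)]
    ring
  simp_rw [hintegrand]
  rw [integral_const_mul, integral_heatKernel_mul_potential i z hτ hrq]
  ring

lemma tensorL_joinPt (i : Fin d) {z : Eu d} (hz : 0 < ‖z‖ ^ 2) (hr : 0 < r)
    (hτ : 0 < τ) : tensorL i.castSucc (Fin.last d) (joinPt z r) τ =
      -2 * newtonConst d * passageConst *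
        (z i * tensorProfile ((d : ℝ) / 2 + 1) r τ (‖z‖ ^ 2)) := by
  have hinner : ∀ᶠ R in 𝓝 r, ∫ q in (0 : ℝ)..R, ∫ w : Eu d,
      partialD (Fin.last d) (fun z => heatKernel z τ) (joinPt w q) *
        partialD i.castSucc newtonKernel (joinPt z R - joinPt w q) =
      -(1 / 2) * passageConst * newtonConst d * z i * ∫ q in (0 : ℝ)..R,
        passageDensity q τ * potential ((d : ℝ) / 2 + 1) (‖z‖ ^ 2) (R - q) τ := by
    filter_upwards [Ioi_mem_nhds hr] with R hR
    rw [← intervalIntegral.integral_const_mul]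
    exact intervalIntegral.integral_congr_Ioo_of_le (le_of_lt hR) fun q hq =>
      integral_partialD_heatKernel_mul_newtonKernel i z hτ hq.2
  rw [tensorL, partialD_last_joinPt]
  simp only [joinPt_last]
  rw [EventuallyEq.deriv_eq hinner, ((hasDerivAt_integral_passageDensity_mul_potential
    (one_le_half_add_one d) hz hr hτ.le).const_mul _).deriv]
  ring

end PoissonKernel

/-! ### The velocity above the wall -/

section AverageIntegral

variable {d : ℕ} {w : Eu d → ℝ} {i : Fin d} {x : ℝ} {Ω : Type*} [MeasurableSpace Ω]
  {ν : Measure Ω} [IsFiniteMeasure ν] {F : Ω → ℝ → ℝ}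

lemma IsRadialKernel.integral (hF : Measurable (Function.uncurry F))
    (hbound : ∀ ρ > 0, ∃ C, ∀ᵐ u ∂ν, ∀ m ≥ ρ, |F u m| ≤ C) :
    IsRadialKernel (fun m => ∫ u, F u m ∂ν) where
  measurable := (hF.comp measurable_swap).stronglyMeasurable.integral_prod_right'.measurable
  bounded ρ hρ := by
    obtain ⟨C, hC⟩ := hbound ρ hρ
    exact ⟨C * ν.real univ, fun m hm => (Real.norm_eq_abs _).symm.trans_le
      (norm_integral_le_of_norm_le_const (hC.mono fun u hu => hu m hm))⟩

lemma tangentialAverage_integral (hw : IsSpatialWeight w) (hF : Measurable (Function.uncurry F))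
    (hbound : ∀ ρ > 0, ∃ C, ∀ᵐ u ∂ν, ∀ m ≥ ρ, |F u m| ≤ C) (hx : 1 < x) :
    tangentialAverage w i (fun m => ∫ u, F u m ∂ν) x =
      ∫ u, tangentialAverage w i (F u) x ∂ν := by
  obtain ⟨C, hC⟩ := hbound _ (sq_sub_one_pos hx)
  have hmeas : Measurable fun z : Eu d × Ω =>
      (x - z.1 i) * F z.2 (‖x • axis i - z.1‖ ^ 2) :=
    Measurable.mul (by fun_prop) (hF.comp (measurable_snd.prodMk (by fun_prop)))
  have hint : Integrable (fun z : Eu d × Ω =>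
      w z.1 * ((x - z.1 i) * F z.2 (‖x • axis i - z.1‖ ^ 2))) (volume.prod ν) := by
    refine (hw.integrable.mul_prod (integrable_const ((x + 1) * C))).mono'
      (hw.integrable.aestronglyMeasurable.comp_fst.mul hmeas.aestronglyMeasurable) ?_
    filter_upwards [Measure.quasiMeasurePreserving_snd.ae hC] with z hz
    rw [norm_mul, Real.norm_of_nonneg (hw.nonneg z.1), Real.norm_eq_abs]
    refine hw.mul_le_mul (G := fun y => |(x - y i) * F z.2 (‖x • axis i - y‖ ^ 2)|)
      (H := fun _ => (x + 1) * C) (fun y hy => ?_) z.1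
    have hcoord := abs_le.1 (abs_coord_le i y)
    rw [abs_mul]
    gcongr
    · exact abs_le.2 ⟨by linarith, by linarith⟩
    · exact hz _ (norm_sq_smul_axis_sub_mem_Icc i hx hy).1
  simp only [tangentialAverage, ← integral_const_mul]
  exact integral_integral_swap hint

end AverageIntegral

section Velocity

variable {d : ℕ} {w : Eu d → ℝ} {i : Fin d} {x r τ : ℝ}

lemma ae_abs_mul_potentialFlux_le {s Q ρ : ℝ} {q : ℝ → ℝ} (hs : 1 ≤ s) (hτ : 0 ≤ τ)
    (hQ : ∀ u ∈ Ioc 0 r, |q u| ≤ Q) (hρ : 0 < ρ) :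
    ∃ C, ∀ᵐ u ∂volume.restrict (Ioc 0 r), ∀ m ≥ ρ, |q u * potentialFlux s m u τ| ≤ C := by
  refine ⟨Q * (potentialFluxBound s ρ * (r + τ)),
    ae_restrict_of_forall_mem measurableSet_Ioc fun u hu m hm => ?_⟩
  have hB := potentialFluxBound_nonneg s ρ
  have hflux := potentialFlux_nonneg (s := s) (m := m) hτ hu.1.le
  rw [abs_mul, abs_of_nonneg hflux]
  refine mul_le_mul (hQ u hu) ?_ hflux ((abs_nonneg _).trans (hQ u hu))
  refine (potentialFlux_le hs hρ hm hτ hu.1).trans ?_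
  gcongr
  exact hu.2

lemma isRadialKernel_integral_mul_potentialFlux {s Q : ℝ} {q : ℝ → ℝ} (hs : 1 ≤ s) (hτ : 0 ≤ τ)
    (hq : Measurable q) (hQ : ∀ u ∈ Ioc 0 r, |q u| ≤ Q) :
    IsRadialKernel (fun m => ∫ u in Ioc 0 r, q u * potentialFlux s m u τ) :=
  .integral (by fun_prop) fun _ => ae_abs_mul_potentialFlux_le hs hτ hQ

lemma tangentialAverage_integral_mul_potentialFlux {Q : ℝ} {q : ℝ → ℝ} (hw : IsSpatialWeight w)
    (hx : 1 < x) (hτ : 0 ≤ τ) (hq : Measurable q) (hQ : ∀ u ∈ Ioc 0 r, |q u| ≤ Q) :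
    tangentialAverage w i
        (fun m => ∫ u in Ioc 0 r, q u * potentialFlux ((d : ℝ) / 2 + 1) m u τ) x =
      ∫ u in Ioc 0 r, q u * tangentialFlux w i x u τ := by
  rw [tangentialAverage_integral hw (by fun_prop)
    (fun _ => ae_abs_mul_potentialFlux_le (one_le_half_add_one d) hτ hQ) hx]
  simp only [tangentialAverage_const_mul, tangentialFlux]

lemma potential_eq_sub_integral {s m : ℝ} (hs : 1 ≤ s) (hm : 0 < m) (hτ : 0 ≤ τ) (hr : 0 ≤ r) :
    potential s m r τ = potential s m 0 τ - ∫ u in Ioc 0 r, potentialFlux s m u τ := by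
  have hint : IntervalIntegrable (fun u => potentialFlux s m u τ) volume 0 r := by
    rw [intervalIntegrable_iff_integrableOn_Ioc_of_le hr]
    obtain ⟨C, hC⟩ := ae_abs_mul_potentialFlux_le (r := r) (q := 1) hs hτ
      (fun _ _ => abs_one.le) hm
    refine Integrable.of_bound (C := C) (Measurable.aestronglyMeasurable (by fun_prop)) ?_
    filter_upwards [hC] with u hu
    simpa using hu m le_rfl
  have hFTC := intervalIntegral.integral_eq_sub_of_hasDerivAt_of_le hr
    (continuous_potential hs hm hτ).continuousOn
    (fun u hu => hasDerivAt_potential hs hm hτ hu.1) hint.neg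
  rw [intervalIntegral.integral_neg, intervalIntegral.integral_of_le hr] at hFTC
  linarith

lemma tangentialAverage_congr {F G : ℝ → ℝ} (hw : IsSpatialWeight w) (hx : 1 < x)
    (hFG : ∀ m > 0, F m = G m) : tangentialAverage w i F x = tangentialAverage w i G x := by
  refine integral_congr_ae (ae_of_all _ fun y => ?_)
  rcases lt_or_ge ‖y‖ 1 with hy | hy
  · simp only [hFG _ ((sq_sub_one_pos hx).trans_le (norm_sq_smul_axis_sub_mem_Icc i hx hy).1)]
  · simp [hw.eq_zero y hy]

lemma tangentialAverage_potential (hw : IsSpatialWeight w) (hx : 1 < x) (hτ : 0 ≤ τ)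
    (hr : 0 ≤ r) :
    tangentialAverage w i (fun m => potential ((d : ℝ) / 2 + 1) m r τ) x =
      tangentialPotential w i x τ - ∫ u in Ioc 0 r, tangentialFlux w i x u τ := by
  have hs := one_le_half_add_one d
  have hFTC : tangentialAverage w i (fun m => potential ((d : ℝ) / 2 + 1) m r τ) x =
      tangentialAverage w i (fun m => potential ((d : ℝ) / 2 + 1) m 0 τ -
        ∫ u in Ioc 0 r, 1 * potentialFlux ((d : ℝ) / 2 + 1) m u τ) x :=
    tangentialAverage_congr hw hx fun m hm => by
      simp only [one_mul, potential_eq_sub_integral hs hm hτ hr]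
  have hone : ∀ u ∈ Ioc 0 r, |(1 : ℝ)| ≤ 1 := fun _ _ => abs_one.le
  rw [hFTC, tangentialAverage_sub hw (IsRadialKernel.potential hs hτ 0)
    (isRadialKernel_integral_mul_potentialFlux hs hτ measurable_const hone) hx,
    tangentialAverage_integral_mul_potentialFlux hw hx hτ measurable_const hone,
    tangentialPotential]
  simp only [one_mul]

lemma tangentialAverage_tensorProfile (hw : IsSpatialWeight w) (hx : 1 < x) (hτ : 0 ≤ τ) :
    tangentialAverage w i (tensorProfile ((d : ℝ) / 2 + 1) r τ) x =
      passageDensity r τ * tangentialPotential w i x τ -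
        ∫ u in Ioc 0 r, passageDensity (r - u) τ * tangentialFlux w i x u τ := by
  have hs := one_le_half_add_one d
  have hmeas : Measurable fun u => passageDensity (r - u) τ := by fun_prop
  have hbound : ∀ u ∈ Ioc 0 r, |passageDensity (r - u) τ| ≤ r * τ ^ (-(3 / 2) : ℝ) :=
    fun u hu => by
      have hru : 0 ≤ r - u := sub_nonneg.2 hu.2
      rw [abs_of_nonneg (passageDensity_nonneg hru hτ)]
      refine (passageDensity_le hru hτ).trans ?_
      gcongr
      exact sub_le_self r hu.1.le
  unfold tensorProfile
  rw [tangentialAverage_sub hw ((IsRadialKernel.potential hs hτ 0).const_mul _)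
    (isRadialKernel_integral_mul_potentialFlux hs hτ hmeas hbound) hx, tangentialAverage_const_mul,
    tangentialAverage_integral_mul_potentialFlux hw hx hτ hmeas hbound, tangentialPotential]

lemma integral_poissonRegular_mul (hw : IsSpatialWeight w) (hx : 1 < x) (hr : 0 < r)
    (hτ : 0 < τ) (q : ℝ) :
    ∫ y, poissonRegular i.castSucc (Fin.last d) (joinPt (x • axis i) r - joinPt y 0) τ *
        (w y * q) =
      -2 * newtonConst d * passageConst * q *
        tangentialAverage w i (tensorProfile ((d : ℝ) / 2 + 1) r τ) x := by
  rw [tangentialAverage, ← integral_const_mul]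
  refine integral_congr_ae (ae_of_all _ fun y => ?_)
  dsimp only
  rcases lt_or_ge ‖y‖ 1 with hy | hy
  · have hpos : 0 < ‖x • axis i - y‖ ^ 2 :=
      (sq_sub_one_pos hx).trans_le (norm_sq_smul_axis_sub_mem_Icc i hx hy).1
    have hcoord : (x • axis i - y) i = x - y i := by simp [axis]
    rw [poissonRegular, if_neg (Fin.castSucc_lt_last i).ne, joinPt_sub, sub_zero,
      tensorL_joinPt i hpos hr hτ, hcoord]
    ring
  · simp [hw.eq_zero y hy]

lemma integral_partialD_newtonKernel_mul (hr : 0 < r)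
    (q : ℝ) :
    ∫ y, partialD i.castSucc newtonKernel (joinPt (x • axis i) r - joinPt y 0) * (w y * q) =
      newtonConst d * q *
        tangentialAverage w i (fun m => potential ((d : ℝ) / 2 + 1) m r 0) x := by
  rw [tangentialAverage, ← integral_const_mul]
  refine integral_congr_ae (ae_of_all _ fun y => ?_)
  dsimp only
  have hcoord : (x • axis i - y) i = x - y i := by simp [axis]
  rw [joinPt_sub, sub_zero, partialD_newtonKernel_joinPt i _ (by positivity), hcoord]
  ring

/-- The tangential flux normalized by the tangential potential at time `0`. -/
def tangentialFluxRatio (w : Eu d → ℝ) (i : Fin d) (x u τ : ℝ) : ℝ :=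
  tangentialFlux w i x u τ / tangentialPotential w i x 0

lemma exists_isWallFlux_tangentialFluxRatio (hw : IsSpatialWeight w) (i : Fin d) (hx : 1 < x) :
    ∃ C, IsWallFlux (tangentialFluxRatio w i x) C := by
  have hpos := tangentialPotential_pos (i := i) hw hx le_rfl
  obtain ⟨C, -, hC⟩ := exists_tangentialFlux_le hw i hx
  refine ⟨C / tangentialPotential w i x 0, (measurable_tangentialFlux hw i x).div_const _,
    fun u τ hu hτ => div_nonneg (tangentialFlux_nonneg hw hx hu.le hτ) hpos.le,
    fun u τ hu hτ => ?_⟩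
  rw [div_mul_eq_mul_div]
  exact div_le_div_of_nonneg_right (hC u τ hu hτ) hpos.le

lemma exists_tangentialFluxRatio_sub_ge (hw : IsSpatialWeight w) (i : Fin d) (hx : 1 < x) :
    ∃ D ≥ 0, ∀ u τ, 0 < u → 0 ≤ τ →
      -(D * (u * τ)) ≤ tangentialFluxRatio w i x u τ - tangentialFluxRatio w i x u 0 := by
  have hpos := tangentialPotential_pos (i := i) hw hx le_rfl
  obtain ⟨D, hD0, hD⟩ := exists_tangentialFlux_sub_ge hw i hx
  refine ⟨D / tangentialPotential w i x 0, div_nonneg hD0 hpos.le, fun u τ hu hτ => ?_⟩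
  rw [tangentialFluxRatio, tangentialFluxRatio, ← sub_div, div_mul_eq_mul_div, ← neg_div]
  exact div_le_div_of_nonneg_right (hD u τ hu hτ) hpos.le

/-- The normal boundary data `w(y) φ(s) e_n`; `boundaryData d a ψ φ` is the case `w = a ψ(|·|)`. -/
def normalData (w : Eu d → ℝ) (φ : ℝ → ℝ) (y : Eu d) (s : ℝ) : Eu (d + 1) :=
  (w y * φ s) • axis (Fin.last d)

lemma stokesVelocity_normalData (g : Eu d → ℝ) (φ : ℝ → ℝ) (j : Fin (d + 1)) (z : Eu (d + 1))
    (t : ℝ) :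
    stokesVelocity (normalData g φ) j z t =
      (∫ τ in (0 : ℝ)..t, ∫ y, poissonRegular j (Fin.last d) (z - joinPt y 0) τ *
        (g y * φ (t - τ))) +
      2 * ∫ y, partialD j newtonKernel (z - joinPt y 0) * (g y * φ t) := by
  have hlast : ∀ y s, normalData g φ y s (Fin.last d) = g y * φ s := fun y s => by
    simp [normalData, axis]
  have hcast : ∀ y s (k : Fin d), normalData g φ y s k.castSucc = 0 := fun y s k => by
    simp [normalData, axis]
  have hreflect := intervalIntegral.integral_comp_sub_left (a := 0) (b := t)
    (fun τ => ∫ y, poissonRegular j (Fin.last d) (z - joinPt y 0) τ * (g y * φ (t - τ))) t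
  simp only [sub_sub_cancel, sub_self, sub_zero] at hreflect
  simp only [stokesVelocity, Fin.sum_univ_castSucc, hlast, hcast, mul_zero, integral_zero,
    intervalIntegral.integral_zero, Finset.sum_const_zero, zero_add, hreflect]

lemma stokesVelocity_normalData_joinPt (hw : IsSpatialWeight w) (φ : ℝ → ℝ)
    (hx : 1 < x) (hr : 0 < r) {t : ℝ} (ht : 0 ≤ t) :
    stokesVelocity (normalData w φ) i.castSucc (joinPt (x • axis i) r) t =
      2 * newtonConst d * tangentialPotential w i x 0 *
        wallProfile φ (tangentialRatio w i x) (tangentialFluxRatio w i x) t r := by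
  have hP := (tangentialPotential_pos (i := i) hw hx le_rfl).ne'
  have hregular : ∫ τ in (0 : ℝ)..t, ∫ y, poissonRegular i.castSucc (Fin.last d)
        (joinPt (x • axis i) r - joinPt y 0) τ * (w y * φ (t - τ)) =
      -2 * newtonConst d * passageConst * ∫ τ in Ioc 0 t, φ (t - τ) *
        (passageDensity r τ * tangentialPotential w i x τ -
          ∫ u in Ioc 0 r, passageDensity (r - u) τ * tangentialFlux w i x u τ) := by
    rw [intervalIntegral.integral_of_le ht, ← integral_const_mul]
    refine setIntegral_congr_fun measurableSet_Ioc fun τ hτ => ?_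
    rw [integral_poissonRegular_mul hw hx hr hτ.1,
      tangentialAverage_tensorProfile hw hx hτ.1.le]
    ring
  have hflux : ∀ u τ, tangentialFlux w i x u τ =
      tangentialPotential w i x 0 * tangentialFluxRatio w i x u τ :=
    fun u τ => (mul_div_cancel₀ _ hP).symm
  have hpotential : ∀ τ, tangentialPotential w i x τ =
      tangentialPotential w i x 0 * tangentialRatio w i x τ :=
    fun τ => (mul_div_cancel₀ _ hP).symm
  rw [stokesVelocity_normalData, hregular, integral_partialD_newtonKernel_mul hr,
    tangentialAverage_potential hw hx le_rfl hr.le, wallProfile]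
  generalize tangentialPotential w i x 0 = P at hflux hpotential hP ⊢
  simp only [hflux, hpotential, mul_left_comm _ P, integral_const_mul, ← mul_sub]
  ring

end Velocity

/-! ### Separation points -/

section SeparationPoint

variable {d : ℕ} {v : Eu (d + 1) → ℝ → ℝ} {x' : Eu d} {t t' : ℝ}

lemma condPlus_iff_eventually : CondPlus v x' t ↔ ∀ᶠ r in 𝓝[>] 0, 0 < v (joinPt x' r) t :=
  (mem_nhdsGT_iff_exists_Ioo_subset (s := {r | 0 < v (joinPt x' r) t})).symm

lemma condMinus_iff_eventually : CondMinus v x' t ↔ ∀ᶠ r in 𝓝[>] 0, v (joinPt x' r) t < 0 :=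
  (mem_nhdsGT_iff_exists_Ioo_subset (s := {r | v (joinPt x' r) t < 0})).symm

lemma CondPlus.not_condMinus (h : CondPlus v x' t) : ¬CondMinus v x' t := fun h' => by
  obtain ⟨r, hpos, hneg⟩ :=
    ((condPlus_iff_eventually.1 h).and (condMinus_iff_eventually.1 h')).exists
  exact hpos.not_gt hneg

namespace IsSeparationPoint

lemma le (h : IsSeparationPoint v x' t) (h' : IsSeparationPoint v x' t') : t' ≤ t := by
  by_contra! hlt
  obtain ⟨ht, -, τ, hτt, hlim, hτ⟩ := h
  obtain ⟨k, hk⟩ := (hlim.eventually_lt_const hlt).exists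
  exact (h'.2.1 (τ k) ⟨ht.trans (hτt k), hk⟩).not_condMinus (hτ k)

lemma iff_eq (h : IsSeparationPoint v x' t) : IsSeparationPoint v x' t' ↔ t' = t :=
  ⟨fun h' => le_antisymm (h.le h') (h'.le h), fun heq => heq ▸ h⟩

end IsSeparationPoint

end SeparationPoint

lemma isSeparationPoint_reversalTime {d : ℕ} {w : Eu d → ℝ} {φ : ℝ → ℝ} {i : Fin d}
    {Λ c B x : ℝ} (hw : IsSpatialWeight w) (hφ : IsReversingProfile φ Λ)
    (hρ : IsRatioFamily (tangentialRatio w i) c B) (hc : 1 < c) (hx : c < x) :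
    IsSeparationPoint (stokesVelocity (normalData w φ) i.castSucc) (x • axis i)
      (reversalTime φ (tangentialRatio w i x)) := by
  have hx1 := hc.trans hx
  obtain ⟨C, hα⟩ := exists_isWallFlux_tangentialFluxRatio hw i hx1
  have hpos : 0 < 2 * newtonConst d * tangentialPotential w i x 0 :=
    mul_pos (mul_pos two_pos (newtonConst_pos d)) (tangentialPotential_pos hw hx1 le_rfl)
  have hT := one_pos.trans (hφ.one_lt_reversalTime hρ hx)
  obtain ⟨τ, hτ, hlim, hneg⟩ := exists_seq_reversalTime (hφ.continuousOn_wallShear hρ hx)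
    hφ.escapeTime_mem (hφ.wallShear_escapeTime_neg hρ hx)
  refine ⟨hT, fun t ht => ?_, τ, hτ, hlim, fun k => ?_⟩
  · rw [condPlus_iff_eventually]
    filter_upwards [self_mem_nhdsWithin, hφ.eventually_wallProfile_pos hρ hx hα
      (exists_tangentialFluxRatio_sub_ge hw i hx1) ht] with r hr hprofile
    rw [stokesVelocity_normalData_joinPt hw φ hx1 hr ht.1.le]
    exact mul_pos hpos hprofile
  · rw [condMinus_iff_eventually]
    filter_upwards [self_mem_nhdsWithin, eventually_wallProfile_neg hφ.lipschitz
      (hρ.isModulation hx) hα (hneg k).1 (hneg k).2] with r hr hprofile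
    rw [stokesVelocity_normalData_joinPt hw φ hx1 hr (hneg k).1.1.le]
    exact mul_neg_of_pos_of_neg hpos hprofile

section Profiles

variable {d : ℕ} {ψ φ : ℝ → ℝ}

lemma IsSpatialProfile.isSpatialWeight {a : ℝ} (hψ : IsSpatialProfile d ψ) (ha : 0 < a) :
    IsSpatialWeight (fun y : Eu d => a * ψ ‖y‖) := by
  have hcont : Continuous fun y : Eu d => a * ψ ‖y‖ := hψ.smooth.continuous.const_mul a
  have hsupport : HasCompactSupport fun y : Eu d => ψ ‖y‖ :=
    (isCompact_closedBall (0 : Eu d) 1).of_isClosed_subset (isClosed_tsupport _)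
      (hψ.support.trans Metric.ball_subset_closedBall)
  have hnonneg : ∀ y : Eu d, 0 ≤ a * ψ ‖y‖ := fun y => mul_nonneg ha.le (hψ.nonneg y)
  have hint : Integrable fun y : Eu d => a * ψ ‖y‖ :=
    hcont.integrable_of_hasCompactSupport hsupport.mul_left
  have hψ0 : 1 < ψ ‖(0 : Eu d)‖ := hψ.one_lt 0 (Metric.mem_ball_self (by norm_num))
  refine ⟨hint, fun y hy => ?_, hnonneg, ?_⟩
  · have hy' : y ∉ tsupport fun y : Eu d => ψ ‖y‖ := fun h =>
      (mem_ball_zero_iff.1 (hψ.support h)).not_ge hy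
    rw [image_eq_zero_of_notMem_tsupport hy', mul_zero]
  · exact integral_pos_of_integrable_nonneg_nonzero hcont hint hnonneg
      (mul_pos ha (one_pos.trans hψ0)).ne'

lemma IsC1Holder.exists_lipschitzOnWith {α : ℝ} (hφ : IsC1Holder α φ) :
    ∃ K, LipschitzOnWith K φ (Icc 0 2) :=
  hφ.1.exists_lipschitzOnWith one_ne_zero (convex_Icc 0 2) isCompact_Icc

end Profiles

end

end StokesHalfSpace

theorem theorem1p3_general (d : ℕ) : ∃ c : ℝ, 1 < c ∧
    ∀ (w : Eu d → ℝ) (φ : ℝ → ℝ) (K : NNReal), IsSpatialWeight w → IsTemporalProfile φ →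
      LipschitzOnWith K φ (Icc 0 2) → (∃ t ∈ Ioo (0 : ℝ) 2, M φ t < 0) →
      ∀ i : Fin d, ∃ tstar : ℝ → ℝ,
        (∀ x > c, tstar x ∈ Ioo 1 (escapeTime φ) ∧
          ∀ t, IsSeparationPoint (stokesVelocity (normalData w φ) i.castSucc) (x • axis i) t ↔
            t = tstar x) ∧
        StrictMonoOn tstar (Ioi c) ∧ Tendsto tstar atTop (𝓝 (escapeTime φ)) := by
  obtain ⟨c, B, hc, hratio⟩ := exists_isRatioFamily_tangentialRatio d
  refine ⟨c, hc, fun w φ K hw hφ hK hneg i => ?_⟩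
  have hρ := hratio w hw i
  have hrev : IsReversingProfile φ K := ⟨hφ, hφ.isLipschitzProfile hK, hneg⟩
  exact ⟨fun x => reversalTime φ (tangentialRatio w i x),
    fun x hx => ⟨⟨hrev.one_lt_reversalTime hρ hx, hrev.reversalTime_lt_escapeTime hρ hx⟩,
      fun _ => (isSeparationPoint_reversalTime hw hrev hρ hc hx).iff_eq⟩,
    hrev.strictMonoOn_reversalTime hρ, hrev.tendsto_reversalTime hρ⟩

theorem theorem1p3 (d : ℕ) (hd : 1 ≤ d) :
    ∃ c : ℝ, 1 < c ∧
      ∀ (a : ℝ) (ψ φ : ℝ → ℝ) (α t₀ t₁ : ℝ), 0 < a → IsSpatialProfile d ψ →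
        0 < α → α < 1 → IsC1Holder α φ → IsTemporalProfile φ →
        1 < t₀ → t₀ < t₁ → t₁ < 2 → (∀ t ∈ Set.Ioo t₀ t₁, M φ t < 0) →
        ∀ i : Fin d, ∃ tstar : ℝ → ℝ,
          (∀ x : ℝ, c < x → tstar x ∈ Set.Ioo 1 t₀ ∧
            ∀ t : ℝ, IsSeparationPoint (stokesVelocity (boundaryData d a ψ φ) i.castSucc)
              (x • axis i) t ↔ t = tstar x) ∧
          (∀ x₁ x₂ : ℝ, c < x₁ → x₁ < x₂ → tstar x₁ < tstar x₂) ∧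
          (∀ x : ℝ, c < x → tstar x < escapeTime φ) ∧
          Filter.Tendsto tstar Filter.atTop (nhds (escapeTime φ)) := by
  obtain ⟨c, hc, h⟩ := theorem1p3_general d
  refine ⟨c, hc, fun a ψ φ α t₀ t₁ ha hψ _ _ hφα hφ ht₀ ht₀₁ ht₁ hneg i => ?_⟩
  obtain ⟨K, hK⟩ := hφα.exists_lipschitzOnWith
  have hpos : ∀ t ∈ Ioo t₀ t₁, 0 < t := fun t ht => by linarith [ht.1]
  obtain ⟨t, ht⟩ := nonempty_Ioo.2 ht₀₁
  obtain ⟨tstar, hsep, hmono, hlim⟩ := h (fun y => a * ψ ‖y‖) φ K (hψ.isSpatialWeight ha) hφ hK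
    ⟨t, ⟨hpos t ht, ht.2.trans ht₁⟩, hneg t ht⟩ i
  have hT : escapeTime φ ≤ t₀ := by
    by_contra! hlt
    obtain ⟨s, hs₀, hs⟩ := exists_between (lt_min hlt ht₀₁)
    have hs_mem : s ∈ Ioo t₀ t₁ := ⟨hs₀, hs.trans_le (min_le_right _ _)⟩
    exact (hs.trans_le (min_le_left _ _)).not_ge
      (escapeTime_le hφ (hφ.isLipschitzProfile hK) (hpos s hs_mem) (hneg s hs_mem))
  exact ⟨tstar, fun x hx => ⟨⟨(hsep x hx).1.1, (hsep x hx).1.2.trans_le hT⟩, (hsep x hx).2⟩,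
    fun x₁ x₂ hx₁ hx => hmono hx₁ (hx₁.trans hx) hx, fun x hx => (hsep x hx).1.2, hlim⟩
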